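/- **Graph and groups.** Let $X=\mathrm{GP}(8,3)$ be the Möbius–Kantor graph, with vertices $1,\dots,16$, outer edges $\{j,1+(j\bmod 8)\}$, spokes $\{j,8+j\}$ and inner edges $\{8+j,\,9+((j+2)\bmod 8)\}$, $1\le j\le 8$. Let $\rho=(1,2,3,4,5,6,7,8)(9,10,11,12,13,14,15,16)$, $\sigma=(1,14,7,12,5,10,3,16)(2,11,8,9,6,15,4,13)$, $\omega=(2,8,9)(3,16,14)(4,13,6)(7,12,10)$ in $\mathrm{Aut}\,X$, and $H=\langle\rho^2,\omega\rangle$, $M=\langle\rho^2,\omega,\sigma\rangle$. **Coverings.** A graph epimorphism $\wp:\tilde X\to X$ is a regular covering projection if some group $\mathrm{CT}(\wp)\le\mathrm{Aut}\,\tilde X$ acts semiregularly on vertices and its orbits on vertices and arcs are the vertex and arc fibres of $\wp$; it is $p$-elementary abelian if $\mathrm{CT}(\wp)$ is an elementary abelian $p$-group. An automorphism $\alpha$ of $X$ lifts if $\alpha\circ\wp=\wp\circ\tilde\alpha$ for some $\tilde\alpha\in\mathrm{Aut}\,\tilde X$. Projections $\wp,\wp'$ onto $X$ are isomorphic if $\alpha\circ\wp=\wp'\circ\tilde\alpha$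 for some $\alpha\in\mathrm{Aut}\,X$ and some isomorphism $\tilde\alpha:\tilde X\to\tilde X'$. The projection $\wp$ is edge-transitive (vertex-transitive) if some edge-transitive (vertex-transitive) subgroup of $\mathrm{Aut}\,X$ lifts, and semisymmetric if it is edge- but not vertex-transitive. A semisymmetric (edge-transitive) projection is minimal semisymmetric (minimal edge-transitive) if it is not a composition $\wp'\circ\wp''$ of two nontrivial regular covering projections with $\wp'$ (the one onto $X$) semisymmetric (edge-transitive). Covering graphs are connected. **Voltages.** For a $d\times 9$ matrix $Z$ over $\mathbb Z_p$ with columns $\zeta(x),\zeta(x_1),\dots,\zeta(x_8)$, let $\zeta$ be the voltage assignment in $\mathbb Z_p^d$ with these values on the arcs $x=(16,11)$ and $x_j=(j,1+(j\bmod 8))$, the negatives of these values on the reversed arcs, and $0$ on all other arcs; $\wp_Z$ is the projection of the derived graph (vertex set $V(X)\times\mathbb Z_p^d$, with $(u,a)\sim(v,a+\zeta(u,v))$ for $u\sim v$) onto $X$. Consider the rows $$r(s)=(0,s,1,si,i,-s,-1,-si,-i),$$ $$r'(s)=(0,\,1+(1+s)i,\,-1-s-si,\,1+s-i,\,-s+(1+s)i,\,-1-(1+s)i,\,1+s+si,\,-1-s+i,\,s-(1+s)i),$$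 $$q(\alpha,\beta)=(0,\alpha+1,-1,\beta,1,-(\alpha+1),1,-\beta,-1),\qquad q'(\alpha,\beta)=(0,\beta,1,-(\alpha+1),1,-\beta,-1,\alpha+1,-1),$$ $$t(c)=(-4,1+c,-3-c,1+c,1-c,-3+c,1-c,1+c,-3-c).$$ Let $\wp_s$ (for a fixed $i$ with $i^2=-1$), $\wp_{\alpha,\beta}$, $\wp_{\nu,c}$, $\wp'_{b,c}$ be the projections $\wp_Z$ given by the matrices $Z$ with rows $(r(s),r'(s))$; $(q(\alpha,\beta),q'(\alpha,\beta))$; $(t(c),r(\nu),r'(\nu))$; $(t(c),q(-1,b),q'(-1,b))$, respectively. **Theorem.** Let $p$ be a prime. *Numbers.* The number of isomorphism classes of minimal semisymmetric $p$-elementary abelian regular covering projections of $X$ is $0$ if $p=2$; $(p-1)/4$ if $p\equiv 5,9,13,17,21\pmod{24}$; $1+(p-1)/4$ if $p\equiv1\pmod{24}$; $(p+1)/4$ if $p\equiv3,7,11,15,23\pmod{24}$; and $1+(p+1)/4$ if $p\equiv19\pmod{24}$. *List.* For odd $p$ and any choice of the constants $i,\nu,b,c\in\mathbb Z_p$ below,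 every such projection is isomorphic to one of the following. Each of the following is minimal semisymmetric with $\mathrm{CT}\cong\mathbb Z_p^d$ ($d$ the number of rows) and has the stated largest group that lifts. Projections from different items are not isomorphic. 1. $p\equiv5\pmod 8$, $i^2=-1$: $\wp_s$ with $s\in\mathbb Z_p\setminus\{-1,i\}$; the largest group that lifts is $H$. 2. $p\equiv1\pmod 8$, $i^2=-1$, $\nu^2=-i$: (a) $\wp_s$ with $s\in\mathbb Z_p\setminus\{-1,i,\nu,-\nu,-1+\nu-\nu^2,-1-\nu-\nu^2\}$, group $H$; (b) $\wp_s$ with $s=-1+\nu-\nu^2$, group $M$; (c) if moreover $p\equiv1\pmod{24}$ and $c^2=-3$: $\wp_{\nu,c}$, group $H$. 3. $p\equiv7\pmod 8$: $\wp_{\alpha,\beta}$ with $\alpha^2+\beta^2=-1$, group $H$. 4. $p\equiv3\pmod 8$, $b^2=-2$: (a) $\wp_{\alpha,\beta}$ with $\alpha^2+\beta^2=-1$ and $(\alpha,\beta)\notin\{(\pm1,\pm b)\}$ (all four sign choices), group $H$; (b) $\wp_{1,b}$, group $M$; (c) if moreover $p\equiv19\pmod{24}$ and $c^2=-3$: $\wp'_{b,c}$,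 group $H$. Within items 1 and 2(a), $\wp_s\cong\wp_{s'}$ if and only if $s'$ lies in $$\Big\{s,\ -\tfrac{i}{s},\ \tfrac{((i-1)/2)s+i}{s-(i-1)/2},\ \tfrac{(i-1)s+i}{s-(i-1)}\Big\}\subseteq\mathbb Z_p\cup\{\infty\},$$ a set with exactly four elements. Within items 3 and 4(a), $\wp_{\alpha,\beta}\cong\wp_{\alpha',\beta'}$ if and only if $(\alpha',\beta')$ lies in $\{(\alpha,\beta),(\tfrac1\alpha,-\tfrac\beta\alpha),(\alpha,-\beta),(\tfrac1\alpha,\tfrac\beta\alpha)\}$, a set with exactly four elements. The projections with $d=2$ are minimal edge-transitive; those in 2(c) and 4(c) are not. -/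

import Mathlib

universe u v w

/-! ### Covering projections of simple graphs -/

namespace GraphCovering

/-- A vertex-transitive group of automorphisms. -/
def IsVertexTransitive {V : Type v} {X : SimpleGraph V} (G : Subgroup (X ≃g X)) : Prop :=
  ∀ x y : V, ∃ g ∈ G, g x = y

/-- An edge-transitive group of automorphisms. -/
def IsEdgeTransitive {V : Type v} {X : SimpleGraph V} (G : Subgroup (X ≃g X)) : Prop :=
  ∀ e ∈ X.edgeSet, ∀ f ∈ X.edgeSet, ∃ g ∈ G, Sym2.map g e = f

/-- The group `K` of automorphisms of `Y` acts semiregularly, and its orbits on vertices and on arcs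
are exactly the vertex fibres and the arc fibres of the epimorphism `φ : Y → X`. -/
structure IsCoveringGroup {W : Type w} {V : Type v} {Y : SimpleGraph W} {X : SimpleGraph V}
    (φ : Y →g X) (K : Subgroup (Y ≃g Y)) : Prop where
  surjective : Function.Surjective φ
  surjective_arc : ∀ u v : V, X.Adj u v → ∃ x y : W, Y.Adj x y ∧ φ x = u ∧ φ y = v
  semiregular : ∀ g ∈ K, ∀ x : W, g x = x → g = 1
  orbit_vertex : ∀ x y : W, (∃ g ∈ K, g x = y) ↔ φ x = φ y
  orbit_arc : ∀ x x' y y' : W, Y.Adj x x' → Y.Adj y y' →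
    ((∃ g ∈ K, g x = y ∧ g x' = y') ↔ (φ x = φ y ∧ φ x' = φ y'))

/-- Regular covering projections. -/
def IsRegularCovering {W : Type w} {V : Type v} {Y : SimpleGraph W} {X : SimpleGraph V}
    (φ : Y →g X) : Prop :=
  ∃ K : Subgroup (Y ≃g Y), IsCoveringGroup φ K

/-- Regular `N`-covering projections, for an abstract group `N`. -/
def IsRegularNCovering {W : Type w} {V : Type v} {Y : SimpleGraph W} {X : SimpleGraph V}
    (φ : Y →g X) (N : Type*) [Group N] : Prop :=
  ∃ K : Subgroup (Y ≃g Y), IsCoveringGroup φ K ∧ Nonempty (K ≃* N)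

/-- Regular covering projections whose group of covering transformations is an
elementary abelian `p`-group. -/
def IsElementaryAbelianCovering {W : Type w} {V : Type v} {Y : SimpleGraph W} {X : SimpleGraph V}
    (p : ℕ) (φ : Y →g X) : Prop :=
  ∃ K : Subgroup (Y ≃g Y), IsCoveringGroup φ K ∧
    (∀ g ∈ K, ∀ h ∈ K, g * h = h * g) ∧ (∀ g ∈ K, g ^ p = 1)

/-- The automorphism `a` of `X` lifts along `φ : Y → X`. -/
def Lifts {W : Type w} {V : Type v} {Y : SimpleGraph W} {X : SimpleGraph V}
    (φ : Y →g X) (a : X ≃g X) : Prop :=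
  ∃ b : Y ≃g Y, ∀ x : W, a (φ x) = φ (b x)

/-- The largest group of automorphisms of `X` that lifts along `φ`. -/
def liftGroup {W : Type w} {V : Type v} {Y : SimpleGraph W} {X : SimpleGraph V}
    (φ : Y →g X) : Subgroup (X ≃g X) where
  carrier := {a | Lifts φ a}
  one_mem' := ⟨1, fun _ => rfl⟩
  mul_mem' := by
    rintro a a' ⟨b, hb⟩ ⟨b', hb'⟩
    refine ⟨b * b', fun x => ?_⟩
    change a (a' (φ x)) = φ (b (b' x))
    rw [hb' x, hb (b' x)]
  inv_mem' := by
    rintro a ⟨b, hb⟩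
    refine ⟨b⁻¹, fun x => ?_⟩
    have h := hb (b⁻¹ x)
    have h1 : b (b⁻¹ x) = x := b.apply_symm_apply x
    rw [h1] at h
    rw [← h]
    exact a.symm_apply_apply _

/-- Some vertex-transitive group of automorphisms lifts along `φ`. -/
def IsVertexTransitiveProj {W : Type w} {V : Type v} {Y : SimpleGraph W} {X : SimpleGraph V}
    (φ : Y →g X) : Prop :=
  ∃ G : Subgroup (X ≃g X), IsVertexTransitive G ∧ ∀ a ∈ G, Lifts φ a

/-- Some edge-transitive group of automorphisms lifts along `φ`. -/
def IsEdgeTransitiveProj {W : Type w} {V : Type v} {Y : SimpleGraph W} {X : SimpleGraph V}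
    (φ : Y →g X) : Prop :=
  ∃ G : Subgroup (X ≃g X), IsEdgeTransitive G ∧ ∀ a ∈ G, Lifts φ a

/-- Semisymmetric projections: edge- but not vertex-transitive ones. -/
def IsSemisymmetricProj {W : Type w} {V : Type v} {Y : SimpleGraph W} {X : SimpleGraph V}
    (φ : Y →g X) : Prop :=
  IsEdgeTransitiveProj φ ∧ ¬ IsVertexTransitiveProj φ

/-- Edge-transitive projections with no decomposition `φ = φ' ∘ φ''` into nontrivial (that is,
non-injective) regular covering projections such that `φ'` is edge-transitive. -/
def IsMinimalEdgeTransitiveProj {W : Type w} {V : Type v} {Y : SimpleGraph W} {X : SimpleGraph V}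
    (φ : Y →g X) : Prop :=
  IsEdgeTransitiveProj φ ∧
    ¬ ∃ (Z : Type w) (G : SimpleGraph Z) (φ' : G →g X) (φ'' : Y →g G),
      φ = φ'.comp φ'' ∧ IsRegularCovering φ' ∧ IsRegularCovering φ'' ∧
      ¬ Function.Injective φ' ∧ ¬ Function.Injective φ'' ∧ IsEdgeTransitiveProj φ'

/-- Semisymmetric projections with no decomposition `φ = φ' ∘ φ''` into nontrivial (that is,
non-injective) regular covering projections such that `φ'` is semisymmetric. -/
def IsMinimalSemisymmetricProj {W : Type w} {V : Type v} {Y : SimpleGraph W} {X : SimpleGraph V}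
    (φ : Y →g X) : Prop :=
  IsSemisymmetricProj φ ∧
    ¬ ∃ (Z : Type w) (G : SimpleGraph Z) (φ' : G →g X) (φ'' : Y →g G),
      φ = φ'.comp φ'' ∧ IsRegularCovering φ' ∧ IsRegularCovering φ'' ∧
      ¬ Function.Injective φ' ∧ ¬ Function.Injective φ'' ∧ IsSemisymmetricProj φ'

/-- A graph together with a graph morphism to `X`. -/
structure GraphOver {V : Type v} (X : SimpleGraph V) where
  Vert : Type w
  graph : SimpleGraph Vert
  proj : graph →g X

/-- Isomorphism of projections onto `X`. -/
def GraphOver.Isomorphic {V : Type v} {X : SimpleGraph V}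
    (P : GraphOver.{v, w} X) (Q : GraphOver.{v, u} X) : Prop :=
  ∃ (a : X ≃g X) (b : P.graph ≃g Q.graph), ∀ x : P.Vert, a (P.proj x) = Q.proj (b x)

/-- The derived graph `Cov(X; ζ)` of a voltage assignment `ζ`, with its projection onto `X`
(the values of `ζ` off the arcs of `X` play no role). -/
def derivedCover {V : Type v} (X : SimpleGraph V) {N : Type w} [AddGroup N] (ζ : V → V → N)
    (hζ : ∀ a b, ζ b a = - ζ a b) : GraphOver X where
  Vert := V × N
  graph :=
    { Adj := fun x y => X.Adj x.1 y.1 ∧ y.2 = x.2 + ζ x.1 y.1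
      symm := by
        constructor
        rintro x y ⟨h, e⟩
        refine ⟨h.symm, ?_⟩
        rw [e, hζ x.1 y.1, add_neg_cancel_right]
      loopless := ⟨fun x h => X.irrefl h.1⟩ }
  proj := { toFun := Prod.fst, map_rel' := fun h => h.1 }

end GraphCovering

/-! ### The Möbius-Kantor graph, its automorphisms and voltage assignments on it -/

namespace MobiusKantor

open GraphCovering

/-- Outer vertices are `Sum.inl i`, inner vertices are `Sum.inr i`. -/
abbrev Vertex : Type := ZMod 8 ⊕ ZMod 8

/-- The outer edges `{uᵢ, uᵢ₊₁}`, the spokes `{uᵢ, vᵢ}` and the inner edges `{vᵢ, vᵢ₊₃}`. -/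
def edgeRel : Vertex → Vertex → Prop
  | Sum.inl i, Sum.inl j => j = i + 1
  | Sum.inl i, Sum.inr j => j = i
  | Sum.inr i, Sum.inr j => j = i + 3
  | Sum.inr _, Sum.inl _ => False

instance : DecidableRel edgeRel
  | Sum.inl i, Sum.inl j => inferInstanceAs (Decidable (j = i + 1))
  | Sum.inl i, Sum.inr j => inferInstanceAs (Decidable (j = i))
  | Sum.inr i, Sum.inr j => inferInstanceAs (Decidable (j = i + 3))
  | Sum.inr _, Sum.inl _ => inferInstanceAs (Decidable False)

/-- The Möbius-Kantor graph `GP(8,3)`. -/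
def MK : SimpleGraph Vertex := SimpleGraph.fromRel edgeRel

instance : DecidableRel MK.Adj := fun a b =>
  inferInstanceAs (Decidable (a ≠ b ∧ (edgeRel a b ∨ edgeRel b a)))

/-- The vertex with label `k`, for `k = 1, …, 16`: the outer vertices are labelled `1, …, 8` in
cyclic order, and `8 + i` is the label of the inner neighbour of the outer vertex `i`. -/
def vtx (k : ℕ) : Vertex := if k ≤ 8 then Sum.inl (k : ZMod 8) else Sum.inr ((k - 8 : ℕ) : ZMod 8)

/-- The cyclic permutation of the vertices with the given labels. -/
def cyc (l : List ℕ) : Equiv.Perm Vertex := (l.map vtx).formPerm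

def rhoPerm : Equiv.Perm Vertex :=
  cyc [1, 2, 3, 4, 5, 6, 7, 8] * cyc [9, 10, 11, 12, 13, 14, 15, 16]

def sigmaPerm : Equiv.Perm Vertex :=
  cyc [1, 14, 7, 12, 5, 10, 3, 16] * cyc [2, 11, 8, 9, 6, 15, 4, 13]

def omegaPerm : Equiv.Perm Vertex :=
  cyc [2, 8, 9] * cyc [3, 16, 14] * cyc [4, 13, 6] * cyc [7, 12, 10]

theorem rhoPerm_adj : ∀ a b : Vertex, MK.Adj (rhoPerm a) (rhoPerm b) ↔ MK.Adj a b := by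
  decide +kernel

theorem sigmaPerm_adj : ∀ a b : Vertex, MK.Adj (sigmaPerm a) (sigmaPerm b) ↔ MK.Adj a b := by
  decide +kernel

theorem omegaPerm_adj : ∀ a b : Vertex, MK.Adj (omegaPerm a) (omegaPerm b) ↔ MK.Adj a b := by
  decide +kernel

/-- The automorphism `ρ`. -/
def rho : MK ≃g MK := ⟨rhoPerm, fun {a b} => rhoPerm_adj a b⟩

/-- The automorphism `σ`. -/
def sigma : MK ≃g MK := ⟨sigmaPerm, fun {a b} => sigmaPerm_adj a b⟩

/-- The automorphism `ω`. -/
def omega : MK ≃g MK := ⟨omegaPerm, fun {a b} => omegaPerm_adj a b⟩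

/-- The group `H = ⟨ρ², ω⟩`. -/
def H : Subgroup (MK ≃g MK) := Subgroup.closure {rho ^ 2, omega}

/-- The group `M = ⟨ρ², ω, σ⟩`. -/
def M : Subgroup (MK ≃g MK) := Subgroup.closure {rho ^ 2, omega, sigma}

/-- The cotree arcs: `x = (16, 11)` has index `0`, and `xⱼ = (j, 1 + (j mod 8))` has index `j`
for `1 ≤ j ≤ 8`. -/
def cotreeArc (j : Fin 9) : Vertex × Vertex :=
  if j = 0 then (vtx 16, vtx 11) else (vtx (j : ℕ), vtx (1 + (j : ℕ) % 8))

/-- The voltage assignment given by the columns `ζ(x), ζ(x₁), …, ζ(x₈)` of `Z`; it is trivial on the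
arcs of the spanning tree that consists of all spokes and all inner edges except `{11, 16}`. -/
def voltage {F : Type} [AddCommGroup F] {d : ℕ} (Z : Matrix (Fin d) (Fin 9) F) (a b : Vertex) :
    Fin d → F :=
  (∑ j, if cotreeArc j = (a, b) then Z.col j else 0) -
    ∑ j, if cotreeArc j = (b, a) then Z.col j else 0

/-- The projection `Cov(GP(8,3); ζ) → GP(8,3)` for the voltage assignment `ζ` given by `Z`. -/
def cov {F : Type} [AddCommGroup F] {d : ℕ} (Z : Matrix (Fin d) (Fin 9) F) : GraphOver.{0, 0} MK :=
  derivedCover MK (voltage Z) (fun _ _ => (neg_sub _ _).symm)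

/-- Minimal semisymmetric `p`-elementary abelian regular covering projections of the Möbius-Kantor
graph by connected graphs. -/
def IsMinSemisymCover (p : ℕ) (P : GraphOver.{0, u} MK) : Prop :=
  P.graph.Connected ∧ IsElementaryAbelianCovering p P.proj ∧ IsMinimalSemisymmetricProj P.proj

/-- Isomorphism of projections, as an equivalence relation. -/
def isoSetoid (p : ℕ) : Setoid {P : GraphOver.{0, u} MK // IsMinSemisymCover p P} where
  r P Q := P.1.Isomorphic Q.1
  iseqv :=
    { refl := fun _ => ⟨1, 1, fun _ => rfl⟩
      symm := by
        rintro P Q ⟨a, b, h⟩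
        refine ⟨a.symm, b.symm, fun y => ?_⟩
        have h1 := h (b.symm y)
        rw [b.apply_symm_apply] at h1
        rw [← h1, a.symm_apply_apply]
      trans := by
        rintro P Q R ⟨a, b, h⟩ ⟨a', b', h'⟩
        refine ⟨a.trans a', b.trans b', fun x => ?_⟩
        change a' (a (P.1.proj x)) = R.1.proj (b' (b x))
        rw [h x, h' (b x)] }

/-- The number of isomorphism classes of minimal semisymmetric `p`-elementary abelian regular
covering projections of the Möbius-Kantor graph. -/
noncomputable def numClasses (p : ℕ) : ℕ∞ := ENat.card (Quotient (isoSetoid.{u} p))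

/-- The voltages `Z` in `ℤ_p^d` define a minimal semisymmetric `ℤ_p^d`-covering projection,
and `K` is the largest group that lifts along it. -/
def IsMinSemisymWith (p : ℕ) {d : ℕ} (Z : Matrix (Fin d) (Fin 9) (ZMod p))
    (K : Subgroup (MK ≃g MK)) : Prop :=
  IsMinSemisymCover p (cov Z) ∧
    IsRegularNCovering (cov Z).proj (Multiplicative (Fin d → ZMod p)) ∧
    liftGroup (cov Z).proj = K

section Voltages

variable {F : Type} [Field F]

/-- The voltages with parameter `s`, for `i² = -1`. -/
def voltS (i s : F) : Matrix (Fin 2) (Fin 9) F :=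
  !![0, s, 1, s * i, i, -s, -1, -(s * i), -i;
     0, 1 + (1 + s) * i, -1 - s - s * i, 1 + s - i, -s + (1 + s) * i,
       -1 - (1 + s) * i, 1 + s + s * i, -1 - s + i, s - (1 + s) * i]

/-- The voltages with parameters `α, β`. -/
def voltAB (α β : F) : Matrix (Fin 2) (Fin 9) F :=
  !![0, α + 1, -1, β, 1, -(α + 1), 1, -β, -1;
     0, β, 1, -(α + 1), 1, -β, -1, α + 1, -1]

/-- The three-dimensional voltages for `i² = -1`, `ν² = -i`, `c² = -3`. -/
def voltS3 (i ν c : F) : Matrix (Fin 3) (Fin 9) F :=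
  !![-4, 1 + c, -3 - c, 1 + c, 1 - c, -3 + c, 1 - c, 1 + c, -3 - c;
     0, ν, 1, ν * i, i, -ν, -1, -(ν * i), -i;
     0, 1 + (1 + ν) * i, -1 - ν - ν * i, 1 + ν - i, -ν + (1 + ν) * i,
       -1 - (1 + ν) * i, 1 + ν + ν * i, -1 - ν + i, ν - (1 + ν) * i]

/-- The three-dimensional voltages for `b² = -2`, `c² = -3`. -/
def voltAB3 (b c : F) : Matrix (Fin 3) (Fin 9) F :=
  !![-4, 1 + c, -3 - c, 1 + c, 1 - c, -3 + c, 1 - c, 1 + c, -3 - c;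
     0, 0, -1, b, 1, 0, 1, -b, -1;
     0, b, 1, 0, 1, -b, -1, 0, -1]

open Classical in
/-- The fractional linear map `s ↦ (a s + b) / (c s + d)` on `F ∪ {∞}`. -/
noncomputable def moebius (a b c d : F) (s : OnePoint F) : OnePoint F :=
  s.elim (if c = 0 then OnePoint.infty else ((a / c : F) : OnePoint F))
    (fun t => if c * t + d = 0 then OnePoint.infty
      else (((a * t + b) / (c * t + d) : F) : OnePoint F))

/-- The orbit `{s, -i/s, (((i-1)/2)s+i)/(s-(i-1)/2), ((i-1)s+i)/(s-(i-1))}` in `F ∪ {∞}`. -/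
def orbitS (i : F) (s : OnePoint F) : Set (OnePoint F) :=
  {s, moebius 0 (-i) 1 0 s, moebius ((i - 1) / 2) i 1 (-((i - 1) / 2)) s,
    moebius (i - 1) i 1 (-(i - 1)) s}

/-- The orbit `{(α, β), (1/α, -β/α), (α, -β), (1/α, β/α)}`. -/
def orbitAB (q : F × F) : Set (F × F) :=
  {q, (1 / q.1, -q.2 / q.1), (q.1, -q.2), (1 / q.1, q.2 / q.1)}

/-- The parameters `-1, i, ν, -ν, -1 + ν - ν², -1 - ν - ν²`, for `ν² = -i`. -/
def exceptS (i ν : F) : Set F := {-1, i, ν, -ν, -1 + ν - ν ^ 2, -1 - ν - ν ^ 2}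

/-- The parameters `(±1, ±b)`, for `b² = -2`. -/
def exceptAB (b : F) : Set (F × F) := {(1, b), (1, -b), (-1, b), (-1, -b)}

end Voltages

end MobiusKantor

open GraphCovering MobiusKantor

/-! The classification is carried over to linear algebra on the first cohomology of $X$ with
coefficients in $\mathbb Z_p$, which the spanning tree identifies with `Fin 9 → ZMod p`. A covering
determines the subspace `cobSpace` of classes that become coboundaries upstairs. Between connected
$p$-elementary abelian coverings, a morphism over $X$ exists exactly when the subspace of the target
lies in that of the source (`cobSpace_le_of_hom`, `exists_hom_of_cobSpace_le`), and every subspace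
occurs (`exists_cover`). Hence an automorphism lifts iff its pullback preserves the subspace
(`lifts_iff`), isomorphism classes of projections are orbits of subspaces (`isomorphic_iff`), and
nontrivial decompositions are proper nonzero subspaces (`exists_decomposition_iff`). The task is to
find the minimal subspaces whose stabiliser is edge- but not vertex-transitive.

On the group side, a subgroup is edge-transitive iff it contains $H$ (`isEdgeTransitive_iff`). The
cosets of $H$ are represented by $1,\sigma,\rho,\rho\sigma$ (`exists_coset`), and a group containing
$H$ is vertex-transitive iff it contains $\rho$ or $\rho\sigma$ (`isVertexTransitive_iff`). So the
subspaces wanted are stable under $H$ but under neither $\rho$ nor $\rho\sigma$. For $p=2$ there are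
none: on each single vector, $\rho\sigma$ agrees with an element of the group ring of $H$
(`exists_quaternion_eq`).

For odd $p$ every $H$-stable subspace is the sum of its intersections with `Ef`, `E3` and `Em`, of
dimensions 2, 3 and 4 (`eq_sup_parts`). The `E3` part is stable under all of $\mathrm{Aut}\,X$, and
$\rho\sigma$ acts as $-1$ on `Ef`, so the failure of $\rho\sigma$ must happen in `Em`. Either $\rho$
fails there too, and minimality leaves an $H$-stable proper nonzero subspace of `Em`; or the `Em`
part is $\rho$-stable, and then $\rho$ must fail on `Ef`, which forces an $\omega$-eigenline and so
$c^2=-3$ with $c\ne0$ (`IsMinSemi.classify`). This is where the three-dimensional coverings come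
from.

The "lines" of `Em`, its proper nonzero $H$-stable subspaces, are two-dimensional over $F$ and $p+1$
in number. If $i^2=-1$ is solvable, a line is determined by its $i$-eigenvector of $\rho^2$, hence
by a point of a projective line on which $\rho$ and $\sigma$ act by fractional linear maps
(`IsLine.eq_LS`). Otherwise the lines are the points of the conic $\alpha^2+\beta^2=-1$
(`IsLine.exists_eq_LAB`). The exceptional parameters are the fixed points of $\rho$, $\sigma$ and
$\rho\sigma$.

An orbit has four elements, none of them $\sigma$-stable, or two elements, both $\sigma$-stable. So
four times the number of classes is the number of minimal subspaces plus the number of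
$\sigma$-stable ones (`four_mul_card_classes`). -/

namespace GraphCovering

/-! ### Unique lifting and morphisms between regular coverings -/

section General

variable {V W Z : Type*} {X : SimpleGraph V} {Y : SimpleGraph W} {G : SimpleGraph Z}
  {φ : Y →g X} {K : Subgroup (Y ≃g Y)}

theorem IsCoveringGroup.proj_apply (h : IsCoveringGroup φ K) {g : Y ≃g Y} (hg : g ∈ K) (x : W) :
    φ (g x) = φ x :=
  ((h.orbit_vertex x (g x)).1 ⟨g, hg, rfl⟩).symm

theorem IsCoveringGroup.exists_adj_lift (h : IsCoveringGroup φ K) {x : W} {v : V}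
    (hv : X.Adj (φ x) v) : ∃ y, Y.Adj x y ∧ φ y = v := by
  obtain ⟨x₁, y₁, hadj, hx, hy⟩ := h.surjective_arc _ _ hv
  obtain ⟨g, hg, rfl⟩ := (h.orbit_vertex x₁ x).2 hx
  exact ⟨g y₁, g.map_rel_iff.2 hadj, (h.proj_apply hg y₁).trans hy⟩

/-- Two arcs out of `x` over the same arc differ by an element of `K` fixing `x`, which is trivial
by semiregularity. This local injectivity is the source of all uniqueness statements below. -/
theorem IsCoveringGroup.adj_unique (h : IsCoveringGroup φ K) {x y y' : W} (hy : Y.Adj x y)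
    (hy' : Y.Adj x y') (e : φ y = φ y') : y = y' := by
  obtain ⟨g, hg, hx, rfl⟩ := (h.orbit_arc x y x y' hy hy').2 ⟨rfl, e⟩
  rw [h.semiregular g hg x hx]
  rfl

/-- A function compatible with adjacency is determined on a connected graph by one value. -/
theorem eq_of_preconnected (hG : G.Preconnected) {P : Z → Prop}
    (hstep : ∀ x y, G.Adj x y → P x → P y) {z₀ : Z} (h₀ : P z₀) (z : Z) : P z := by
  obtain ⟨w⟩ := hG z₀ z
  induction w with
  | nil => exact h₀
  | cons hadj _ ih => exact ih (hstep _ _ hadj h₀)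

theorem IsCoveringGroup.hom_unique (h : IsCoveringGroup φ K) (hG : G.Preconnected)
    (f f' : G →g Y) (hf : ∀ z, φ (f z) = φ (f' z)) {z₀ : Z} (h₀ : f z₀ = f' z₀) (z : Z) :
    f z = f' z := by
  refine eq_of_preconnected hG (P := fun z => f z = f' z) (fun x y hxy hx => ?_) h₀ z
  have h1 : Y.Adj (f x) (f y) := f.map_rel hxy
  have h2 : Y.Adj (f x) (f' y) := by
    rw [hx]
    exact f'.map_rel hxy
  exact h.adj_unique h1 h2 (hf y)

theorem IsCoveringGroup.exists_deck (h : IsCoveringGroup φ K) (hY : Y.Connected)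
    (f : Y →g Y) (hf : ∀ x, φ (f x) = φ x) : ∃ g ∈ K, ∀ x, f x = g x := by
  obtain ⟨x₀⟩ := hY.nonempty
  obtain ⟨g, hg, hgx⟩ := (h.orbit_vertex x₀ (f x₀)).2 (hf x₀).symm
  refine ⟨g, hg, h.hom_unique hY.preconnected f g.toHom (fun z => ?_) (z₀ := x₀) hgx.symm⟩
  rw [hf]
  exact (h.proj_apply hg z).symm

variable {W' : Type*} {Y' : SimpleGraph W'} {ψ : Y' →g X} {L : Subgroup (Y' ≃g Y')}

/-- Both composites of `f` and `f'` are endomorphisms over `X`, hence deck transformations. This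
makes `f` bijective, and applying `f'` shows that it reflects adjacency. -/
theorem IsCoveringGroup.exists_iso (h : IsCoveringGroup φ K) (h' : IsCoveringGroup ψ L)
    (hY : Y.Connected) (hY' : Y'.Connected) (f : Y →g Y') (f' : Y' →g Y)
    (hf : ∀ x, ψ (f x) = φ x) (hf' : ∀ x, φ (f' x) = ψ x) :
    ∃ b : Y ≃g Y', ∀ x, b x = f x := by
  obtain ⟨g, -, hg⟩ := h.exists_deck hY (f'.comp f) (fun x => by
    change φ (f' (f x)) = _
    rw [hf', hf])
  obtain ⟨g', -, hg'⟩ := h'.exists_deck hY' (f.comp f') (fun x => by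
    change ψ (f (f' x)) = _
    rw [hf, hf'])
  replace hg : ∀ x, f' (f x) = g x := hg
  replace hg' : ∀ x, f (f' x) = g' x := hg'
  have hbij : Function.Bijective f := by
    constructor
    · intro x y e
      apply g.injective
      rw [← hg, ← hg, e]
    · intro y
      refine ⟨f' (g'.symm y), ?_⟩
      rw [hg']
      exact g'.apply_symm_apply y
  refine ⟨⟨Equiv.ofBijective f hbij, ?_⟩, fun x => rfl⟩
  intro x y
  refine ⟨fun hxy => ?_, fun hxy => f.map_rel hxy⟩
  have h1 : Y.Adj (f' (f x)) (f' (f y)) := f'.map_rel hxy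
  rw [hg, hg] at h1
  exact g.map_rel_iff.1 h1

theorem IsCoveringGroup.surjective_of_comp {φ' : G →g X} {M : Subgroup (G ≃g G)}
    (h : IsCoveringGroup φ K) (h' : IsCoveringGroup φ' M) (hY : Y.Connected) (hG : G.Connected)
    (f : Y →g G) (hf : ∀ x, φ' (f x) = φ x) : Function.Surjective f := by
  obtain ⟨x₀⟩ := hY.nonempty
  refine eq_of_preconnected hG.preconnected (P := fun z => ∃ x, f x = z) ?_ (z₀ := f x₀) ⟨x₀, rfl⟩
  rintro _ z hz ⟨x, rfl⟩
  have h1 : X.Adj (φ x) (φ' z) := by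
    rw [← hf]
    exact φ'.map_rel hz
  obtain ⟨y, hy, e⟩ := h.exists_adj_lift h1
  exact ⟨y, h'.adj_unique (f.map_rel hy) hz (by rw [hf, e])⟩

/-- A morphism between connected regular coverings is a regular covering. -/
theorem IsCoveringGroup.isRegularCovering_of_comp {φ' : G →g X} {M : Subgroup (G ≃g G)}
    (h : IsCoveringGroup φ K) (h' : IsCoveringGroup φ' M) (hY : Y.Connected) (hG : G.Connected)
    (f : Y →g G) (hf : ∀ x, φ' (f x) = φ x) : IsRegularCovering f := by
  have hsurj := h.surjective_of_comp h' hY hG f hf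
  -- The element of `K` carrying `x` to `y` preserves `f` everywhere: `f ∘ g` and `f` lift the same
  -- projection and agree at `x`.
  have key : ∀ x y, f x = f y → ∃ g ∈ K, g x = y ∧ ∀ z, f (g z) = f z := by
    intro x y e
    obtain ⟨g, hg, hgx⟩ := (h.orbit_vertex x y).2 (by rw [← hf, e, hf])
    refine ⟨g, hg, hgx, h'.hom_unique hY.preconnected (f.comp g.toHom) f (fun z => ?_) (z₀ := x) ?_⟩
    · change φ' (f (g z)) = _
      rw [hf, hf, h.proj_apply hg]
    · change f (g x) = f x
      rw [hgx, e]
  -- The covering group of `f` consists of those elements of `K` that preserve its fibres.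
  refine ⟨{ carrier := {g | g ∈ K ∧ ∀ z, f (g z) = f z}
            one_mem' := ⟨K.one_mem, fun _ => rfl⟩
            mul_mem' := ?_
            inv_mem' := ?_ }, hsurj, ?_, ?_, ?_, ?_⟩
  · rintro a b ⟨ha, ha'⟩ ⟨hb, hb'⟩
    exact ⟨K.mul_mem ha hb, fun z => (ha' (b z)).trans (hb' z)⟩
  · rintro a ⟨ha, ha'⟩
    refine ⟨K.inv_mem ha, fun z => ?_⟩
    have h1 := ha' (a⁻¹ z)
    rw [show a (a⁻¹ z) = z from a.apply_symm_apply z] at h1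
    exact h1.symm
  · intro u v huv
    obtain ⟨x, rfl⟩ := hsurj u
    have h1 : X.Adj (φ x) (φ' v) := by
      rw [← hf]
      exact φ'.map_rel huv
    obtain ⟨y, hy, e⟩ := h.exists_adj_lift h1
    exact ⟨x, y, hy, rfl, h'.adj_unique (f.map_rel hy) huv (by rw [hf, e])⟩
  · rintro g ⟨hg, -⟩ x hx
    exact h.semiregular g hg x hx
  · intro x y
    constructor
    · rintro ⟨g, ⟨-, hg⟩, rfl⟩
      exact (hg x).symm
    · intro e
      obtain ⟨g, hg, hx, hz⟩ := key x y e
      exact ⟨g, ⟨hg, hz⟩, hx⟩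
  · intro x x' y y' hx hy
    constructor
    · rintro ⟨g, ⟨-, hg⟩, rfl, rfl⟩
      exact ⟨(hg x).symm, (hg x').symm⟩
    · rintro ⟨e, e'⟩
      obtain ⟨g, hg, hgx, hz⟩ := key x y e
      refine ⟨g, ⟨hg, hz⟩, hgx, ?_⟩
      have h1 : Y.Adj y (g x') := by
        rw [← hgx]
        exact g.map_rel_iff.2 hx
      exact h.adj_unique h1 hy (by rw [← hf, hz, e', hf])

/-- A quotient of an elementary abelian covering is elementary abelian. -/
theorem IsCoveringGroup.elementaryAbelian_of_comp {φ' : G →g X} {M : Subgroup (G ≃g G)} {p : ℕ}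
    (h : IsCoveringGroup φ K) (h' : IsCoveringGroup φ' M) (hY : Y.Connected)
    (f : Y →g G) (hf : ∀ x, φ' (f x) = φ x) (hsurj : Function.Surjective f)
    (hcomm : ∀ g ∈ K, ∀ h ∈ K, g * h = h * g) (hexp : ∀ g ∈ K, g ^ p = 1) :
    IsElementaryAbelianCovering p φ' := by
  -- Every deck transformation of the quotient is induced by an element of `K`, so commutativity and
  -- the exponent descend along `f`.
  have key : ∀ m ∈ M, ∃ g ∈ K, ∀ x, f (g x) = m (f x) := by
    intro m hm
    obtain ⟨x₀⟩ := hY.nonempty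
    obtain ⟨y, hy⟩ := hsurj (m (f x₀))
    obtain ⟨g, hg, hgx⟩ := (h.orbit_vertex x₀ y).2 (by
      rw [← hf, ← hf, hy, h'.proj_apply hm])
    refine ⟨g, hg, h'.hom_unique hY.preconnected (f.comp g.toHom) (m.toHom.comp f) (fun z => ?_)
      (z₀ := x₀) ?_⟩
    · change φ' (f (g z)) = φ' (m (f z))
      rw [h'.proj_apply hm, hf, hf, h.proj_apply hg]
    · change f (g x₀) = m (f x₀)
      rw [hgx, hy]
  refine ⟨M, h', ?_, ?_⟩
  · intro a ha b hb
    obtain ⟨g, hg, hga⟩ := key a ha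
    obtain ⟨k, hk, hkb⟩ := key b hb
    refine RelIso.ext fun z => ?_
    obtain ⟨x, rfl⟩ := hsurj z
    change a (b (f x)) = b (a (f x))
    rw [← hkb, ← hga, ← hga, ← hkb]
    exact congrArg f (DFunLike.congr_fun (hcomm g hg k hk) x)
  · intro a ha
    obtain ⟨g, hg, hga⟩ := key a ha
    have hpow : ∀ n : ℕ, ∀ x, f ((g ^ n) x) = (a ^ n) (f x) := by
      intro n
      induction n with
      | zero => intro x; rfl
      | succ n ih =>
        intro x
        rw [pow_succ', pow_succ']
        change f (g ((g ^ n) x)) = a ((a ^ n) (f x))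
        rw [hga, ih]
    refine RelIso.ext fun z => ?_
    obtain ⟨x, rfl⟩ := hsurj z
    rw [← hpow, hexp g hg]
    rfl

theorem connected_of_surjective (hY : Y.Connected) (f : Y →g G) (hf : Function.Surjective f) :
    G.Connected := by
  refine SimpleGraph.Connected.mk (fun a b => ?_) (nonempty := hY.nonempty.map f)
  obtain ⟨x, rfl⟩ := hf a
  obtain ⟨y, rfl⟩ := hf b
  exact (hY.preconnected x y).map f

end General

end GraphCovering

namespace MobiusKantor

/-! ### Cochains on the Möbius-Kantor graph -/

section Cochains

variable {N N' : Type*} [AddCommGroup N] [AddCommGroup N']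

/-- The cochain that is trivial on the spanning tree and has values `z` on the cotree arcs. -/
def treeVoltage (z : Fin 9 → N) (a b : Vertex) : N :=
  (∑ j, if cotreeArc j = (a, b) then z j else 0) - ∑ j, if cotreeArc j = (b, a) then z j else 0

theorem treeVoltage_neg (z : Fin 9 → N) (a b : Vertex) :
    treeVoltage z b a = -treeVoltage z a b := (neg_sub _ _).symm

theorem treeVoltage_add (z z' : Fin 9 → N) (a b : Vertex) :
    treeVoltage (z + z') a b = treeVoltage z a b + treeVoltage z' a b := by
  have key : ∀ q : Vertex × Vertex, (∑ j, if cotreeArc j = q then (z + z') j else 0) =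
      (∑ j, if cotreeArc j = q then z j else 0) + ∑ j, if cotreeArc j = q then z' j else 0 := by
    intro q
    rw [← Finset.sum_add_distrib]
    refine Finset.sum_congr rfl fun j _ => ?_
    split_ifs <;> simp
  rw [treeVoltage, key, key, treeVoltage, treeVoltage]
  abel

theorem map_treeVoltage {G : Type*} [FunLike G N N'] [AddMonoidHomClass G N N'] (f : G)
    (z : Fin 9 → N) (a b : Vertex) :
    f (treeVoltage z a b) = treeVoltage (fun j => f (z j)) a b := by
  have key : ∀ q : Vertex × Vertex, f (∑ j, if cotreeArc j = q then z j else 0) =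
      ∑ j, if cotreeArc j = q then f (z j) else 0 := by
    intro q
    rw [map_sum]
    refine Finset.sum_congr rfl fun j _ => ?_
    split_ifs <;> simp
  rw [treeVoltage, map_sub, key, key, treeVoltage]

theorem cotreeArc_injective : Function.Injective cotreeArc := by decide +kernel

theorem cotreeArc_ne_swap : ∀ j k, cotreeArc j ≠ (cotreeArc k).swap := by decide +kernel

theorem cotreeArc_ne_spoke :
    ∀ i j, cotreeArc j ≠ (.inr i, .inl i) ∧ cotreeArc j ≠ (.inl i, .inr i) := by decide +kernel

/-- The inner edges form one 8-cycle traversed in steps of 3. Removing $\{16,11\}$, which joins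
inner vertices 0 and 3, leaves the path 3, 6, 1, 4, 7, 2, 5, 0, whose vertices are `3 + 3 * m`. -/
theorem cotreeArc_ne_inner : ∀ (m : Fin 7) j,
    cotreeArc j ≠ (.inr (3 + 3 * m.val), .inr (6 + 3 * m.val)) ∧
    cotreeArc j ≠ (.inr (6 + 3 * m.val), .inr (3 + 3 * m.val)) := by decide +kernel

theorem adj_cotreeArc : ∀ j, MK.Adj (cotreeArc j).1 (cotreeArc j).2 := by decide +kernel

theorem adj_spoke : ∀ i : ZMod 8, MK.Adj (.inr i) (.inl i) := by decide +kernel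

theorem adj_inner : ∀ m : Fin 7, MK.Adj (.inr (3 + 3 * m.val)) (.inr (6 + 3 * m.val)) := by
  decide +kernel

/-- The 24 edges split into 9 cotree edges, 8 spokes and 7 edges of the inner path. -/
theorem adj_cases : ∀ a b, MK.Adj a b →
    ((∃ j, (a, b) = cotreeArc j ∨ (b, a) = cotreeArc j) ∨
      (∃ i, (a, b) = (.inr i, .inl i) ∨ (b, a) = (.inr i, .inl i)) ∨
      ∃ m : Fin 7, (a, b) = (.inr (3 + 3 * m.val), .inr (6 + 3 * m.val)) ∨
        (b, a) = (.inr (3 + 3 * m.val), .inr (6 + 3 * m.val))) := by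
  decide +kernel

theorem treeVoltage_cotreeArc (z : Fin 9 → N) (j : Fin 9) :
    treeVoltage z (cotreeArc j).1 (cotreeArc j).2 = z j := by
  have h2 : ∀ k, ¬ cotreeArc k = ((cotreeArc j).2, (cotreeArc j).1) :=
    fun k => cotreeArc_ne_swap k j
  simp only [treeVoltage, Prod.mk.eta, cotreeArc_injective.eq_iff, h2, if_false]
  simp

theorem treeVoltage_spoke (z : Fin 9 → N) (i : ZMod 8) :
    treeVoltage z (.inr i) (.inl i) = 0 := by
  simp [treeVoltage, cotreeArc_ne_spoke i]

theorem treeVoltage_inner (z : Fin 9 → N) (m : Fin 7) :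
    treeVoltage z (.inr (3 + 3 * m.val)) (.inr (6 + 3 * m.val)) = 0 := by
  simp only [treeVoltage, (cotreeArc_ne_inner m _).1, (cotreeArc_ne_inner m _).2, if_false]
  simp

/-- The sum of a cochain along the path in the spanning tree from the root to a vertex. -/
def potential (η : Vertex → Vertex → N) : Vertex → N
  -- Since 3 is its own inverse modulo 8, `3 * (i - 3)` is the position of the inner vertex `i` on
  -- the path starting at the root 3.
  | .inr i => ∑ m ∈ Finset.range (3 * (i - 3)).val, η (.inr (3 + 3 * m)) (.inr (6 + 3 * m))
  | .inl i => (∑ m ∈ Finset.range (3 * (i - 3)).val, η (.inr (3 + 3 * m)) (.inr (6 + 3 * m))) +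
      η (.inr i) (.inl i)

theorem potential_inl (η : Vertex → Vertex → N) (i : ZMod 8) :
    potential η (.inl i) = potential η (.inr i) + η (.inr i) (.inl i) := rfl

theorem val_inner : ∀ m : Fin 7,
    (3 * ((6 + 3 * (m.val : ZMod 8)) - 3)).val = m.val + 1 ∧
    (3 * ((3 + 3 * (m.val : ZMod 8)) - 3)).val = m.val := by decide +kernel

theorem val_inner_le : ∀ i : ZMod 8, (3 * (i - 3)).val ≤ 7 := by decide +kernel

theorem potential_inner (η : Vertex → Vertex → N) (m : Fin 7) :
    potential η (.inr (6 + 3 * m.val)) = potential η (.inr (3 + 3 * m.val)) +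
      η (.inr (3 + 3 * m.val)) (.inr (6 + 3 * m.val)) := by
  simp only [potential, (val_inner m).1, (val_inner m).2, Finset.sum_range_succ]

/-- The values of a cochain on the fundamental cycles of the spanning tree. -/
def cycleValues (η : Vertex → Vertex → N) (j : Fin 9) : N :=
  potential η (cotreeArc j).1 + η (cotreeArc j).1 (cotreeArc j).2 - potential η (cotreeArc j).2

/-- Subtracting the coboundary of the potential kills a cochain on the tree, so every cohomology
class has a representative that is trivial there. -/
theorem eq_treeVoltage_add (η : Vertex → Vertex → N)
    (hη : ∀ a b, MK.Adj a b → η b a = -η a b) {a b : Vertex} (hab : MK.Adj a b) :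
    η a b = treeVoltage (cycleValues η) a b + potential η b - potential η a := by
  have key : ∀ a b, MK.Adj a b → η a b = treeVoltage (cycleValues η) a b + potential η b -
      potential η a → η b a = treeVoltage (cycleValues η) b a + potential η a - potential η b := by
    intro a b hab e
    rw [hη a b hab, e, treeVoltage_neg _ a b]
    abel
  have tree : ∀ j, η (cotreeArc j).1 (cotreeArc j).2 =
      treeVoltage (cycleValues η) (cotreeArc j).1 (cotreeArc j).2 +
        potential η (cotreeArc j).2 - potential η (cotreeArc j).1 := by
    intro j
    rw [treeVoltage_cotreeArc, cycleValues]
    abel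
  have spoke : ∀ i, η (.inr i) (.inl i) = treeVoltage (cycleValues η) (.inr i) (.inl i) +
      potential η (.inl i) - potential η (.inr i) := by
    intro i
    rw [treeVoltage_spoke, potential_inl]
    abel
  have inner : ∀ m : Fin 7, η (.inr (3 + 3 * m.val)) (.inr (6 + 3 * m.val)) =
      treeVoltage (cycleValues η) (.inr (3 + 3 * m.val)) (.inr (6 + 3 * m.val)) +
      potential η (.inr (6 + 3 * m.val)) - potential η (.inr (3 + 3 * m.val)) := by
    intro m
    rw [treeVoltage_inner, potential_inner]
    abel
  rcases adj_cases a b hab with ⟨j, h | h⟩ | ⟨i, h | h⟩ | ⟨m, h | h⟩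
  · obtain ⟨rfl, rfl⟩ : a = (cotreeArc j).1 ∧ b = (cotreeArc j).2 := by rw [← h]; exact ⟨rfl, rfl⟩
    exact tree j
  · obtain ⟨rfl, rfl⟩ : b = (cotreeArc j).1 ∧ a = (cotreeArc j).2 := by rw [← h]; exact ⟨rfl, rfl⟩
    exact key _ _ hab.symm (tree j)
  · obtain ⟨rfl, rfl⟩ := Prod.mk.inj h
    exact spoke i
  · obtain ⟨rfl, rfl⟩ := Prod.mk.inj h
    exact key _ _ hab.symm (spoke i)
  · obtain ⟨rfl, rfl⟩ := Prod.mk.inj h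
    exact inner m
  · obtain ⟨rfl, rfl⟩ := Prod.mk.inj h
    exact key _ _ hab.symm (inner m)

/-- The tree-normalised representative is unique: summing along the tree forces the potential to be
`g` up to its value at the root. This is the tool for computing `cycleValues` without unfolding the
path sums. -/
theorem cycleValues_eq_of_coboundary (η : Vertex → Vertex → N) (z : Fin 9 → N) (g : Vertex → N)
    (h : ∀ a b, MK.Adj a b → η a b = treeVoltage z a b + g b - g a) : cycleValues η = z := by
  have inner : ∀ n : ℕ, n ≤ 7 →
      ∑ m ∈ Finset.range n, η (.inr (3 + 3 * m)) (.inr (6 + 3 * m)) =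
        g (.inr (3 + 3 * n)) - g (.inr 3) := by
    intro n
    induction n with
    | zero => intro _; simp
    | succ n ih =>
      intro hn
      have h1 := h _ _ (adj_inner ⟨n, hn⟩)
      have h2 := treeVoltage_inner z ⟨n, hn⟩
      simp only at h1 h2
      rw [Finset.sum_range_succ, ih (by omega), h1, h2]
      have h3 : (3 + 3 * ((n + 1 : ℕ) : ZMod 8)) = 6 + 3 * (n : ZMod 8) := by push_cast; ring
      rw [h3]
      abel
  have hinv : ∀ i : ZMod 8, (3 + 3 * (((3 * (i - 3)).val : ℕ) : ZMod 8)) = i := by decide +kernel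
  have hr : ∀ i, potential η (.inr i) = g (.inr i) - g (.inr 3) := by
    intro i
    rw [potential, inner _ (val_inner_le i), hinv]
  have hp : ∀ a, potential η a = g a - g (.inr 3) := by
    rintro (i | i)
    · rw [potential_inl, hr, h _ _ (adj_spoke i), treeVoltage_spoke]
      abel
    · exact hr i
  funext j
  rw [cycleValues, hp, hp, h _ _ (adj_cotreeArc j), treeVoltage_cotreeArc]
  abel

end Cochains

section Pullback

variable {F : Type*} [CommRing F]

theorem treeVoltage_smul (c : F) (z : Fin 9 → F) (a b : Vertex) :
    treeVoltage (c • z) a b = c * treeVoltage z a b :=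
  (map_treeVoltage (AddMonoidHom.mulLeft c) z a b).symm

/-- The action of an automorphism on the first cohomology, by pullback. -/
def pullback (F : Type*) [CommRing F] (a : MK ≃g MK) : (Fin 9 → F) →ₗ[F] (Fin 9 → F) where
  toFun z := cycleValues fun u v => treeVoltage z (a u) (a v)
  map_add' z z' := by
    refine cycleValues_eq_of_coboundary _ _
      (potential (fun u v => treeVoltage z (a u) (a v)) +
        potential fun u v => treeVoltage z' (a u) (a v)) fun u v huv => ?_
    have h1 := eq_treeVoltage_add (fun u v => treeVoltage z (a u) (a v))
      (fun _ _ _ => treeVoltage_neg _ _ _) huv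
    have h2 := eq_treeVoltage_add (fun u v => treeVoltage z' (a u) (a v))
      (fun _ _ _ => treeVoltage_neg _ _ _) huv
    rw [treeVoltage_add, treeVoltage_add, h1, h2, Pi.add_apply, Pi.add_apply]
    abel
  map_smul' c z := by
    refine cycleValues_eq_of_coboundary _ _
      (c • potential (fun u v => treeVoltage z (a u) (a v))) fun u v huv => ?_
    have h1 := eq_treeVoltage_add (fun u v => treeVoltage z (a u) (a v))
      (fun _ _ _ => treeVoltage_neg _ _ _) huv
    rw [RingHom.id_apply, treeVoltage_smul, treeVoltage_smul, h1, Pi.smul_apply, Pi.smul_apply,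
      smul_eq_mul, smul_eq_mul]
    ring

theorem treeVoltage_pullback (a : MK ≃g MK) (z : Fin 9 → F) {u v : Vertex} (huv : MK.Adj u v) :
    treeVoltage z (a u) (a v) = treeVoltage (pullback F a z) u v +
      potential (fun u v => treeVoltage z (a u) (a v)) v -
        potential (fun u v => treeVoltage z (a u) (a v)) u :=
  eq_treeVoltage_add (fun u v => treeVoltage z (a u) (a v)) (fun _ _ _ => treeVoltage_neg _ _ _) huv

theorem pullback_one : pullback F 1 = LinearMap.id := by
  refine LinearMap.ext fun z => ?_
  exact cycleValues_eq_of_coboundary _ z 0 fun u v _ => by simp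

/-- The order is reversed, so taking preimages of subspaces under pullbacks gives a left action. -/
theorem pullback_mul (a b : MK ≃g MK) : pullback F (a * b) = pullback F b ∘ₗ pullback F a := by
  refine LinearMap.ext fun z => ?_
  refine cycleValues_eq_of_coboundary _ _
    (potential (fun u v => treeVoltage (pullback F a z) (b u) (b v)) +
      fun u => potential (fun u v => treeVoltage z (a u) (a v)) (b u)) fun u v huv => ?_
  have h1 := treeVoltage_pullback a z (b.map_rel_iff.2 huv)
  have h2 := treeVoltage_pullback b (pullback F a z) huv
  change treeVoltage z (a (b u)) (a (b v)) = _
  rw [h1, h2, Pi.add_apply, Pi.add_apply, LinearMap.comp_apply]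
  abel

end Pullback

/-! ### The subspace of the cohomology determined by a covering -/

section CobSpace

variable {W W' : Type*} {Y : SimpleGraph W} {Y' : SimpleGraph W'}

/-- The cohomology classes that become trivial on the covering graph. -/
def cobSpace (F : Type*) [CommRing F] (φ : Y →g MK) : Submodule F (Fin 9 → F) where
  carrier := {z | ∃ f : W → F, ∀ x y, Y.Adj x y → f y = f x + treeVoltage z (φ x) (φ y)}
  add_mem' := by
    rintro z z' ⟨f, hf⟩ ⟨f', hf'⟩
    refine ⟨f + f', fun x y h => ?_⟩
    rw [treeVoltage_add, Pi.add_apply, Pi.add_apply, hf x y h, hf' x y h]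
    abel
  zero_mem' := ⟨0, fun x y _ => by simp [treeVoltage]⟩
  smul_mem' := by
    rintro c z ⟨f, hf⟩
    refine ⟨c • f, fun x y h => ?_⟩
    rw [treeVoltage_smul, Pi.smul_apply, Pi.smul_apply, hf x y h, smul_eq_mul, smul_eq_mul]
    ring

variable {F : Type*} [CommRing F]

/-- Being a coboundary upstairs depends only on the cohomology class: primitives for `η` and for its
normal form differ by the potential pulled back along `φ`. -/
theorem cycleValues_mem_cobSpace_iff (φ : Y →g MK) (η : Vertex → Vertex → F)
    (hη : ∀ a b, MK.Adj a b → η b a = -η a b) :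
    cycleValues η ∈ cobSpace F φ ↔
      ∃ f : W → F, ∀ x y, Y.Adj x y → f y = f x + η (φ x) (φ y) := by
  constructor
  · rintro ⟨f, hf⟩
    refine ⟨fun x => f x + potential η (φ x), fun x y h => ?_⟩
    beta_reduce
    rw [hf x y h, eq_treeVoltage_add η hη (φ.map_rel h)]
    abel
  · rintro ⟨f, hf⟩
    refine ⟨fun x => f x - potential η (φ x), fun x y h => ?_⟩
    beta_reduce
    rw [hf x y h, eq_treeVoltage_add η hη (φ.map_rel h)]
    abel

theorem cobSpace_twist (φ : Y →g MK) (a : MK ≃g MK) :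
    cobSpace F (a.toHom.comp φ) = (cobSpace F φ).comap (pullback F a) := by
  ext z
  exact (cycleValues_mem_cobSpace_iff φ (fun u v => treeVoltage z (a u) (a v))
    fun _ _ _ => treeVoltage_neg _ _ _).symm

theorem cobSpace_le_of_hom {φ : Y →g MK} {ψ : Y' →g MK} (f : Y →g Y') (hf : ∀ x, ψ (f x) = φ x) :
    cobSpace F ψ ≤ cobSpace F φ := by
  rintro z ⟨g, hg⟩
  refine ⟨fun x => g (f x), fun x y h => ?_⟩
  have h1 := hg _ _ (f.map_rel h)
  rwa [hf, hf] at h1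

end CobSpace

end MobiusKantor

namespace GraphCovering

/-! ### Voltages of an abstract elementary abelian covering -/

section Voltage

variable {V : Type*} {W : Type w} {X : SimpleGraph V} {Y : SimpleGraph W} {ψ : Y →g X}
  {K : Subgroup (Y ≃g Y)}

/-- An elementary abelian covering is a derived covering with voltages in a vector space. -/
theorem IsCoveringGroup.exists_voltage (p : ℕ) [Fact p.Prime] (h : IsCoveringGroup ψ K)
    (hcomm : ∀ g ∈ K, ∀ h ∈ K, g * h = h * g) (hexp : ∀ g ∈ K, g ^ p = 1) :
    ∃ (N : Type w) (_ : AddCommGroup N) (_ : Module (ZMod p) N) (η : V → V → N) (pos : W → N),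
      (∀ a b, X.Adj a b → η b a = -η a b) ∧
      (∀ x y, Y.Adj x y → pos y = pos x + η (ψ x) (ψ y)) ∧
      (∀ x y, ψ x = ψ y → pos x = pos y → x = y) ∧
      ∀ v n, ∃ x, ψ x = v ∧ pos x = n := by
  classical
  let : CommGroup K := { (inferInstance : Group K) with
    mul_comm := fun a b => Subtype.ext (hcomm a a.2 b b.2) }
  have hmod : ∀ x : Additive K, p • x = 0 := fun x => by
    have : (Additive.toMul x) ^ p = 1 := Subtype.ext (hexp _ (Additive.toMul x).2)
    exact this
  let : Module (ZMod p) (Additive K) := AddCommGroup.zmodModule hmod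
  choose s hs using h.surjective
  -- With a section `s` of the vertex fibres fixed, `pos x` is the unique deck transformation taking
  -- the section point of the fibre to `x`; it serves as the fibre coordinate.
  have hpos : ∀ x, ∃ g : K, (g : Y ≃g Y) (s (ψ x)) = x := fun x => by
    obtain ⟨g, hg, hgx⟩ := (h.orbit_vertex (s (ψ x)) x).2 (hs _)
    exact ⟨⟨g, hg⟩, hgx⟩
  choose pos hpos using hpos
  have huniq : ∀ (g g' : K) (x : W), (g : Y ≃g Y) x = (g' : Y ≃g Y) x → g = g' := by
    intro g g' x e
    have h1 : ((g'⁻¹ * g : K) : Y ≃g Y) x = x := by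
      change (g' : Y ≃g Y).symm ((g : Y ≃g Y) x) = x
      rw [e]
      exact (g' : Y ≃g Y).symm_apply_apply x
    have h2 : (g'⁻¹ * g : K) = 1 := Subtype.ext (h.semiregular _ (g'⁻¹ * g : K).2 x h1)
    exact (inv_mul_eq_one.1 h2).symm
  have hpos_mul : ∀ (g : K) (x : W), pos ((g : Y ≃g Y) x) = g * pos x := by
    intro g x
    apply huniq _ _ (s (ψ x))
    have h1 := hpos ((g : Y ≃g Y) x)
    rw [h.proj_apply g.2] at h1
    rw [h1]
    change _ = (g : Y ≃g Y) ((pos x : Y ≃g Y) (s (ψ x)))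
    rw [hpos x]
  -- The voltage measures by how much the lift of an arc from `s a` misses `s b`. Off the arcs its
  -- value is arbitrary.
  have hη : ∀ a b, ∃ k : K, X.Adj a b → Y.Adj (s a) ((k : Y ≃g Y) (s b)) := by
    intro a b
    by_cases hab : X.Adj a b
    · obtain ⟨y, hy, e⟩ := h.exists_adj_lift (x := s a) (v := b) (by rwa [hs])
      refine ⟨pos y, fun _ => ?_⟩
      have h1 := hpos y
      rw [e] at h1
      rwa [h1]
    · exact ⟨1, fun h => absurd h hab⟩
  choose η hη using hη
  have hstep : ∀ x y, Y.Adj x y → pos y = pos x * η (ψ x) (ψ y) := by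
    intro x y hxy
    have h1 : Y.Adj x ((pos x : Y ≃g Y) ((η (ψ x) (ψ y) : Y ≃g Y) (s (ψ y)))) := by
      have h2 := (pos x : Y ≃g Y).map_rel_iff.2 (hη _ _ (ψ.map_rel hxy))
      rwa [hpos] at h2
    have h2 := h.adj_unique hxy h1 (by
      rw [h.proj_apply (pos x).2, h.proj_apply (η (ψ x) (ψ y)).2, hs])
    apply huniq _ _ (s (ψ y))
    rw [hpos y]
    exact h2
  refine ⟨Additive K, inferInstance, inferInstance, fun a b => Additive.ofMul (η a b),
    fun x => Additive.ofMul (pos x), ?_, hstep, ?_, ?_⟩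
  · intro a b hab
    have h1 := hstep _ _ (hη a b hab)
    have h2 := hstep _ _ (hη a b hab).symm
    have h3 : ψ ((η a b : Y ≃g Y) (s b)) = b := by rw [h.proj_apply (η a b).2, hs]
    rw [h3, hs, h1, h3, hs, mul_assoc] at h2
    exact eq_neg_of_add_eq_zero_right (mul_eq_left.1 h2.symm)
  · intro x y e e'
    have e'' : pos x = pos y := e'
    rw [← hpos x, ← hpos y, e'', e]
  · intro v n
    let k : K := Additive.toMul n * (pos (s v))⁻¹
    refine ⟨(k : Y ≃g Y) (s v), by rw [h.proj_apply k.2, hs], ?_⟩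
    change pos ((k : Y ≃g Y) (s v)) = Additive.toMul n
    rw [hpos_mul, inv_mul_cancel_right]

end Voltage

end GraphCovering

namespace MobiusKantor

/-! ### The subspace of a covering determines morphisms, lifts and isomorphism -/

section Morphisms

variable {W W' : Type*} {Y : SimpleGraph W} {Y' : SimpleGraph W'} {φ : Y →g MK} {ψ : Y' →g MK}
  {p : ℕ}

/-- The coordinates of the voltage of `ψ` are classes that die on `Y'`, hence on `Y`. Their
primitives on `Y` assemble to a fibre coordinate with values in the voltage group, and together with
`φ` it names a vertex of `Y'`. -/
theorem exists_hom_of_cobSpace_le [Fact p.Prime] (hψ : IsElementaryAbelianCovering p ψ)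
    (hY' : Y'.Connected)
    (hle : cobSpace (ZMod p) ψ ≤ cobSpace (ZMod p) φ) : ∃ f : Y →g Y', ∀ x, ψ (f x) = φ x := by
  obtain ⟨K, hK, hcomm, hexp⟩ := hψ
  obtain ⟨N, _, _, η, pos, hη, hstep, hinj, hsurj⟩ := hK.exists_voltage p hcomm hexp
  -- Connectedness makes the finitely many voltages span, so the voltage group has a finite basis
  -- and finitely many coordinates suffice.
  have hspan : Submodule.span (ZMod p) (Set.range fun q : Vertex × Vertex => η q.1 q.2) = ⊤ := by
    obtain ⟨x₀⟩ := hY'.nonempty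
    have key : ∀ x, pos x - pos x₀ ∈
        Submodule.span (ZMod p) (Set.range fun q : Vertex × Vertex => η q.1 q.2) := by
      refine eq_of_preconnected hY'.preconnected (z₀ := x₀) (fun x y hxy hx => ?_) (by simp)
      rw [hstep x y hxy, add_sub_right_comm]
      exact Submodule.add_mem _ hx (Submodule.subset_span ⟨(ψ x, ψ y), rfl⟩)
    refine eq_top_iff.2 fun n _ => ?_
    obtain ⟨x, -, hx⟩ := hsurj (ψ x₀) (n + pos x₀)
    have := key x
    rwa [hx, add_sub_cancel_right] at this
  have : Module.Finite (ZMod p) N :=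
    Module.finite_def.2 (hspan ▸ Submodule.fg_span (Set.finite_range _))
  let B := Module.finBasis (ZMod p) N
  have hcoord : ∀ k, ∃ f : W → ZMod p, ∀ x y, Y.Adj x y →
      f y = f x + B.coord k (η (φ x) (φ y)) := by
    intro k
    have hanti : ∀ a b, MK.Adj a b → B.coord k (η b a) = -B.coord k (η a b) := fun a b hab => by
      rw [hη a b hab, map_neg]
    refine (cycleValues_mem_cobSpace_iff φ (fun a b => B.coord k (η a b)) hanti).1 (hle ?_)
    refine (cycleValues_mem_cobSpace_iff ψ (fun a b => B.coord k (η a b)) hanti).2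
      ⟨fun x => B.coord k (pos x), fun x y hxy => ?_⟩
    beta_reduce
    rw [hstep x y hxy, map_add]
  choose f hf using hcoord
  let n : W → N := fun x => ∑ k, f k x • B k
  have hn : ∀ x y, Y.Adj x y → n y = n x + η (φ x) (φ y) := by
    intro x y hxy
    conv_rhs => rw [← B.sum_repr (η (φ x) (φ y))]
    rw [← Finset.sum_add_distrib]
    refine Finset.sum_congr rfl fun k _ => ?_
    rw [hf k x y hxy, add_smul]
    rfl
  choose g hg hgn using fun x => hsurj (φ x) (n x)
  refine ⟨⟨g, fun {x y} hxy => ?_⟩, hg⟩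
  -- Lift the arc at `g x`. The endpoint has the same projection and the same fibre coordinate as `g
  -- y`, so it is `g y`.
  obtain ⟨y', hy', e⟩ := hK.exists_adj_lift (x := g x) (v := φ y) (by
    rw [hg]
    exact φ.map_rel hxy)
  have h1 := hstep _ _ hy'
  rw [hgn, hg, e, ← hn x y hxy, ← hgn y] at h1
  rwa [hinj y' (g y) (by rw [e, hg]) h1] at hy'

theorem exists_iso_of_cobSpace_eq [Fact p.Prime] (hφ : IsElementaryAbelianCovering p φ)
    (hψ : IsElementaryAbelianCovering p ψ) (hY : Y.Connected) (hY' : Y'.Connected)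
    (h : cobSpace (ZMod p) φ = cobSpace (ZMod p) ψ) : ∃ b : Y ≃g Y', ∀ x, ψ (b x) = φ x := by
  obtain ⟨f, hf⟩ := exists_hom_of_cobSpace_le hψ hY' h.ge
  obtain ⟨f', hf'⟩ := exists_hom_of_cobSpace_le hφ hY h.le
  obtain ⟨K, hK, -⟩ := hφ
  obtain ⟨L, hL, -⟩ := hψ
  obtain ⟨b, hb⟩ := hK.exists_iso hL hY hY' f f' hf hf'
  exact ⟨b, fun x => by rw [hb, hf]⟩

theorem cobSpace_eq_of_iso (b : Y ≃g Y') (hb : ∀ x, ψ (b x) = φ x) :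
    cobSpace (ZMod p) φ = cobSpace (ZMod p) ψ := by
  refine le_antisymm (cobSpace_le_of_hom b.symm.toHom fun x => ?_)
    (cobSpace_le_of_hom b.toHom hb)
  rw [← hb]
  exact congrArg ψ (b.apply_symm_apply x)

theorem isElementaryAbelianCovering_twist (hφ : IsElementaryAbelianCovering p φ) (a : MK ≃g MK) :
    IsElementaryAbelianCovering p (a.toHom.comp φ) := by
  obtain ⟨K, hK, hc⟩ := hφ
  refine ⟨K, ⟨?_, ?_, hK.semiregular, ?_, ?_⟩, hc⟩
  · exact a.surjective.comp hK.surjective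
  · intro u v huv
    obtain ⟨x, y, hxy, hx, hy⟩ := hK.surjective_arc (a.symm u) (a.symm v)
      (a.symm.map_rel_iff.2 huv)
    refine ⟨x, y, hxy, ?_, ?_⟩
    · change a (φ x) = u
      rw [hx, a.apply_symm_apply]
    · change a (φ y) = v
      rw [hy, a.apply_symm_apply]
  · intro x y
    exact (hK.orbit_vertex x y).trans a.injective.eq_iff.symm
  · intro x x' y y' hx hy
    exact (hK.orbit_arc x x' y y' hx hy).trans
      (and_congr a.injective.eq_iff.symm a.injective.eq_iff.symm)

/-- A lift of `a` is an isomorphism over $X$ between the coverings `φ` and `a ∘ φ`, whose subspaces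
are compared by `cobSpace_twist`. -/
theorem lifts_iff [Fact p.Prime] (hφ : IsElementaryAbelianCovering p φ) (hY : Y.Connected)
    (a : MK ≃g MK) :
    Lifts φ a ↔ (cobSpace (ZMod p) φ).comap (pullback (ZMod p) a) = cobSpace (ZMod p) φ := by
  rw [← cobSpace_twist]
  constructor
  · rintro ⟨b, hb⟩
    exact cobSpace_eq_of_iso b fun x => (hb x).symm
  · intro h
    obtain ⟨b, hb⟩ := exists_iso_of_cobSpace_eq (isElementaryAbelianCovering_twist hφ a) hφ hY hY h
    exact ⟨b, fun x => (hb x).symm⟩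

theorem isomorphic_iff [Fact p.Prime] {P : GraphOver.{0, u} MK} {Q : GraphOver.{0, v} MK}
    (hP : IsElementaryAbelianCovering p P.proj) (hQ : IsElementaryAbelianCovering p Q.proj)
    (hP' : P.graph.Connected) (hQ' : Q.graph.Connected) :
    P.Isomorphic Q ↔ ∃ a : MK ≃g MK, cobSpace (ZMod p) Q.proj =
      (cobSpace (ZMod p) P.proj).comap (pullback (ZMod p) a) := by
  simp only [← cobSpace_twist]
  constructor
  · rintro ⟨a, b, hb⟩
    exact ⟨a, (cobSpace_eq_of_iso b fun x => (hb x).symm).symm⟩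
  · rintro ⟨a, h⟩
    obtain ⟨b, hb⟩ := exists_iso_of_cobSpace_eq (isElementaryAbelianCovering_twist hP a) hQ hP' hQ'
      h.symm
    exact ⟨a, b, fun x => (hb x).symm⟩

end Morphisms

end MobiusKantor

namespace GraphCovering

/-! ### Derived graphs and their translation groups -/

section Derived

variable {V : Type v} {N : Type w} [AddCommGroup N] (X : SimpleGraph V) (ζ : V → V → N)
  (hζ : ∀ a b, ζ b a = -ζ a b)

/-- The action of the voltage group on the derived graph by translations. -/
def translation :
    Multiplicative N →* ((derivedCover X ζ hζ).graph ≃g (derivedCover X ζ hζ).graph) where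
  toFun n :=
    { toFun := fun x => (x.1, x.2 + n.toAdd)
      invFun := fun x => (x.1, x.2 - n.toAdd)
      left_inv := fun x => Prod.ext rfl (add_sub_cancel_right _ _)
      right_inv := fun x => Prod.ext rfl (sub_add_cancel _ _)
      map_rel_iff' := by
        intro x y
        change (X.Adj x.1 y.1 ∧ y.2 + n.toAdd = x.2 + n.toAdd + ζ x.1 y.1) ↔
          X.Adj x.1 y.1 ∧ y.2 = x.2 + ζ x.1 y.1
        rw [add_right_comm, add_left_inj] }
  map_one' := RelIso.ext fun x => Prod.ext rfl (add_zero _)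
  map_mul' m n := RelIso.ext fun x => Prod.ext rfl (by
    change x.2 + (m.toAdd + n.toAdd) = x.2 + n.toAdd + m.toAdd
    abel)

theorem translation_injective [Nonempty V] : Function.Injective (translation X ζ hζ) := by
  intro m n h
  obtain ⟨v⟩ := ‹Nonempty V›
  have h1 : ((v, 0 + m.toAdd) : V × N) = (v, 0 + n.toAdd) :=
    DFunLike.congr_fun h ((v, 0) : V × N)
  exact Multiplicative.toAdd.injective (add_left_cancel (Prod.mk.inj h1).2)

theorem isCoveringGroup_translation :
    IsCoveringGroup (derivedCover X ζ hζ).proj (translation X ζ hζ).range where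
  surjective v := ⟨(v, 0), rfl⟩
  surjective_arc u v h := ⟨(u, 0), (v, ζ u v), ⟨h, (zero_add _).symm⟩, rfl, rfl⟩
  semiregular := by
    rintro _ ⟨n, rfl⟩ x hx
    have h1 : x.2 + n.toAdd = x.2 := (Prod.ext_iff.1 hx).2
    have h2 : n = 1 := by simpa using h1
    rw [h2, map_one]
  orbit_vertex x y := by
    constructor
    · rintro ⟨_, ⟨n, rfl⟩, rfl⟩
      rfl
    · intro h
      exact ⟨_, ⟨Multiplicative.ofAdd (y.2 - x.2), rfl⟩, Prod.ext h (add_sub_cancel _ _)⟩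
  orbit_arc x x' y y' hx hy := by
    constructor
    · rintro ⟨_, ⟨n, rfl⟩, rfl, rfl⟩
      exact ⟨rfl, rfl⟩
    · rintro ⟨h, h'⟩
      refine ⟨_, ⟨Multiplicative.ofAdd (y.2 - x.2), rfl⟩, Prod.ext h (add_sub_cancel _ _),
        Prod.ext h' ?_⟩
      have h1 : x'.2 = x.2 + ζ x.1 x'.1 := hx.2
      have h2 : y'.2 = y.2 + ζ y.1 y'.1 := hy.2
      have h3 : x.1 = y.1 := h
      have h4 : x'.1 = y'.1 := h'
      change x'.2 + (y.2 - x.2) = y'.2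
      rw [h1, h2, h3, h4]
      abel

theorem isRegularNCovering_derivedCover [Nonempty V] :
    IsRegularNCovering (derivedCover X ζ hζ).proj (Multiplicative N) :=
  ⟨_, isCoveringGroup_translation X ζ hζ,
    ⟨(MonoidHom.ofInjective (translation_injective X ζ hζ)).symm⟩⟩

theorem isElementaryAbelianCovering_derivedCover {p : ℕ} (hp : ∀ n : N, p • n = 0) :
    IsElementaryAbelianCovering p (derivedCover X ζ hζ).proj := by
  refine ⟨_, isCoveringGroup_translation X ζ hζ, ?_, ?_⟩
  · rintro _ ⟨m, rfl⟩ _ ⟨n, rfl⟩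
    rw [← map_mul, ← map_mul, mul_comm]
  · rintro _ ⟨m, rfl⟩
    have h1 : m ^ p = 1 := hp m.toAdd
    rw [← map_pow, h1, map_one]

end Derived

end GraphCovering

namespace MobiusKantor

/-! ### Connectedness and the subspace of a derived covering -/

section TreeCover

variable {N : Type w} [AddCommGroup N]

/-- The derived covering of a cochain that is trivial on the spanning tree. -/
def treeCover (z : Fin 9 → N) : GraphOver.{0, w} MK :=
  derivedCover MK (treeVoltage z) (treeVoltage_neg z)

theorem treeCover_adj (z : Fin 9 → N) {x y : Vertex × N} :
    (treeCover z).graph.Adj x y ↔ MK.Adj x.1 y.1 ∧ y.2 = x.2 + treeVoltage z x.1 y.1 := Iff.rfl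

variable {p : ℕ} [Fact p.Prime] [Module (ZMod p) N]

/-- The tree lifts to every sheet, and the fundamental cycle of the cotree arc `j` shifts the root
fibre by `z j`. The reachable shifts form an additive subgroup, which is a subspace because the
scalars are $\mathbb Z_p$, so the spanning hypothesis fills the fibre. -/
theorem treeCover_connected (z : Fin 9 → N)
    (hz : Submodule.span (ZMod p) (Set.range z) = ⊤) : (treeCover z).graph.Connected := by
  have step : ∀ (u v : Vertex) (m n : N), MK.Adj u v → n = m + treeVoltage z u v →
      (treeCover z).graph.Reachable (u, m) (v, n) :=
    fun u v m n h e => SimpleGraph.Adj.reachable ((treeCover_adj z).2 ⟨h, e⟩)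
  have inner : ∀ n : ℕ, n ≤ 7 → ∀ m : N,
      (treeCover z).graph.Reachable (.inr 3, m) (.inr (3 + 3 * n), m) := by
    intro n
    induction n with
    | zero =>
      intro _ m
      rw [Nat.cast_zero, mul_zero, add_zero]
      exact SimpleGraph.Reachable.refl _
    | succ n ih =>
      intro hn m
      refine (ih (by omega) m).trans ?_
      have h3 : (3 + 3 * ((n + 1 : ℕ) : ZMod 8)) = 6 + 3 * (n : ZMod 8) := by push_cast; ring
      rw [h3]
      refine step _ _ _ _ (adj_inner ⟨n, hn⟩) ?_
      rw [treeVoltage_inner z ⟨n, hn⟩, add_zero]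
  have hinv : ∀ i : ZMod 8, (3 + 3 * (((3 * (i - 3)).val : ℕ) : ZMod 8)) = i := by decide +kernel
  have tree : ∀ (v : Vertex) (m : N), (treeCover z).graph.Reachable (.inr 3, m) (v, m) := by
    have h1 : ∀ (i : ZMod 8) (m : N), (treeCover z).graph.Reachable (.inr 3, m) (.inr i, m) := by
      intro i m
      have h2 := inner _ (val_inner_le i) m
      rwa [hinv] at h2
    rintro (i | i) m
    · refine (h1 i m).trans (step _ _ _ _ (adj_spoke i) ?_)
      rw [treeVoltage_spoke, add_zero]
    · exact h1 i m
  let S : AddSubgroup N :=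
    { carrier := {n | ∀ m, (treeCover z).graph.Reachable (.inr 3, m) (.inr 3, m + n)}
      zero_mem' := fun m => by
        rw [add_zero]
        exact SimpleGraph.Reachable.refl _
      add_mem' := fun {a b} ha hb m => by
        rw [← add_assoc]
        exact (ha m).trans (hb _)
      neg_mem' := fun {a} ha m => by
        have h1 := ha (m + -a)
        rw [neg_add_cancel_right] at h1
        exact h1.symm }
  have hS : AddSubgroup.toZModSubmodule p S = ⊤ := by
    rw [eq_top_iff, ← hz, Submodule.span_le]
    rintro _ ⟨j, rfl⟩ m
    refine (tree (cotreeArc j).1 m).trans ((step _ (cotreeArc j).2 _ _ (adj_cotreeArc j) ?_).trans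
      (tree _ _).symm)
    rw [treeVoltage_cotreeArc]
  have hS' : ∀ n m, (treeCover z).graph.Reachable (.inr 3, m) (.inr 3, m + n) := fun n =>
    (hS ▸ Submodule.mem_top : n ∈ AddSubgroup.toZModSubmodule p S)
  have : Nonempty (treeCover z).Vert := ⟨((.inr 3, 0) : Vertex × N)⟩
  refine SimpleGraph.Connected.mk ?_
  rintro ⟨u, m⟩ ⟨v, n⟩
  refine (tree u m).symm.trans (SimpleGraph.Reachable.trans ?_ (tree v n))
  have := hS' (n - m) m
  rwa [add_sub_cancel] at this

theorem treeCover_isElementaryAbelian (z : Fin 9 → N) :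
    IsElementaryAbelianCovering p (treeCover z).proj :=
  isElementaryAbelianCovering_derivedCover _ _ _ fun n => by
    rw [← Nat.cast_smul_eq_nsmul (ZMod p), CharP.cast_eq_zero, zero_smul]

/-- A primitive upstairs changes by a constant under each translation, and these constants form a
linear functional. Thus the classes that die are exactly the functionals applied to the voltages. -/
theorem mem_cobSpace_treeCover (z : Fin 9 → N)
    (hz : Submodule.span (ZMod p) (Set.range z) = ⊤) (z' : Fin 9 → ZMod p) :
    z' ∈ cobSpace (ZMod p) (treeCover z).proj ↔
      ∃ l : N →ₗ[ZMod p] ZMod p, (fun j => l (z j)) = z' := by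
  constructor
  · rintro ⟨f, hf⟩
    replace hf : ∀ x y : Vertex × N, MK.Adj x.1 y.1 → y.2 = x.2 + treeVoltage z x.1 y.1 →
      f y = f x + treeVoltage z' x.1 y.1 := fun x y h e => hf x y ⟨h, e⟩
    -- The difference of the primitive and its translate by `n` does not change along edges, hence
    -- is constant on the connected graph; its value is read off at the root.
    have hconst : ∀ (n : N) (x : Vertex × N),
        f (x.1, x.2 + n) - f x = f (.inr 3, n) - f (.inr 3, 0) := by
      intro n x
      refine eq_of_preconnected (treeCover_connected z hz).preconnected
        (P := fun x : Vertex × N => f (x.1, x.2 + n) - f x = f (.inr 3, n) - f (.inr 3, 0))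
        (z₀ := ((.inr 3, 0) : Vertex × N)) ?_ (by rw [zero_add]) x
      intro x y hxy hx
      rw [← hx, hf x y hxy.1 hxy.2, hf (x.1, x.2 + n) (y.1, y.2 + n) hxy.1 (by
        rw [hxy.2]
        exact add_right_comm _ _ _)]
      abel
    let l : N →+ ZMod p := AddMonoidHom.mk' (fun n => f (.inr 3, n) - f (.inr 3, 0)) fun a b => by
      have h1 := hconst b (.inr 3, a)
      simp only at h1
      rw [← h1]
      abel
    have hl : ∀ v n, f (v, n) = f (v, 0) + l n := by
      intro v n
      have h1 := hconst n (v, 0)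
      simp only [zero_add] at h1
      rw [sub_eq_iff_eq_add] at h1
      rw [h1, add_comm]
      rfl
    refine ⟨AddMonoidHom.toZModLinearMap p l, ?_⟩
    change (fun j => l (z j)) = z'
    rw [← cycleValues_eq_of_coboundary (treeVoltage fun j => l (z j)) (fun j => l (z j)) 0
      (fun _ _ _ => by simp)]
    refine cycleValues_eq_of_coboundary _ _ (fun v => -f (v, 0)) fun a b hab => ?_
    have h1 := hf (a, 0) (b, treeVoltage z a b) hab (by simp)
    rw [hl b, map_treeVoltage] at h1
    simp only at h1
    linear_combination h1
  · rintro ⟨l, rfl⟩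
    refine ⟨fun x : Vertex × N => l x.2, ?_⟩
    rintro x y ⟨-, h⟩
    beta_reduce
    rw [← map_treeVoltage l, h, map_add]
    rfl

end TreeCover

/-! ### Voltage matrices and row spaces -/

section Matrices

variable {p : ℕ} [Fact p.Prime] {d : ℕ}

theorem span_col_eq_top (Z : Matrix (Fin d) (Fin 9) (ZMod p))
    (hZ : LinearIndependent (ZMod p) Z.row) :
    Submodule.span (ZMod p) (Set.range Z.col) = ⊤ := by
  apply Submodule.eq_top_of_finrank_eq
  rw [← Matrix.rank_eq_finrank_span_cols, hZ.rank_matrix]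
  simp

/-- A functional on the voltage space applied to the columns is the combination of the rows with the
coefficients of the functional. So the subspace of `cov Z` is the row space of `Z`. -/
theorem exists_dual_iff (Z : Matrix (Fin d) (Fin 9) (ZMod p)) (z' : Fin 9 → ZMod p) :
    (∃ l : (Fin d → ZMod p) →ₗ[ZMod p] ZMod p, (fun j => l (Z.col j)) = z') ↔
      z' ∈ Submodule.span (ZMod p) (Set.range Z.row) := by
  rw [Submodule.mem_span_range_iff_exists_fun]
  constructor
  · rintro ⟨l, rfl⟩
    refine ⟨fun k => l (fun i => if k = i then 1 else 0), ?_⟩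
    funext j
    rw [LinearMap.pi_apply_eq_sum_univ l (Z.col j)]
    simp [Finset.sum_apply, Matrix.col, Matrix.row, mul_comm]
  · rintro ⟨c, rfl⟩
    refine ⟨∑ k, c k • LinearMap.proj k, ?_⟩
    funext j
    simp [Finset.sum_apply, Matrix.col, Matrix.row]

theorem cov_connected (Z : Matrix (Fin d) (Fin 9) (ZMod p))
    (hZ : LinearIndependent (ZMod p) Z.row) : (cov Z).graph.Connected :=
  treeCover_connected _ (span_col_eq_top Z hZ)

theorem cov_isElementaryAbelian (Z : Matrix (Fin d) (Fin 9) (ZMod p)) :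
    IsElementaryAbelianCovering p (cov Z).proj :=
  treeCover_isElementaryAbelian _

theorem cov_isRegularNCovering (Z : Matrix (Fin d) (Fin 9) (ZMod p)) :
    IsRegularNCovering (cov Z).proj (Multiplicative (Fin d → ZMod p)) :=
  isRegularNCovering_derivedCover _ _ _

theorem cobSpace_cov (Z : Matrix (Fin d) (Fin 9) (ZMod p))
    (hZ : LinearIndependent (ZMod p) Z.row) :
    cobSpace (ZMod p) (cov Z).proj = Submodule.span (ZMod p) (Set.range Z.row) :=
  Submodule.ext fun z' =>
    (mem_cobSpace_treeCover _ (span_col_eq_top Z hZ) z').trans (exists_dual_iff Z z')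

/-- Every subspace of the cohomology belongs to a connected elementary abelian covering. -/
theorem exists_cover (U : Submodule (ZMod p) (Fin 9 → ZMod p)) :
    ∃ P : GraphOver.{0, u} MK, P.graph.Connected ∧ IsElementaryAbelianCovering p P.proj ∧
      cobSpace (ZMod p) P.proj = U := by
  let B := Module.finBasis (ZMod p) U
  let Z : Matrix (Fin (Module.finrank (ZMod p) U)) (Fin 9) (ZMod p) :=
    fun k => (B k : Fin 9 → ZMod p)
  have hZ : LinearIndependent (ZMod p) Z.row :=
    B.linearIndependent.map' U.subtype (Submodule.ker_subtype U)
  have hU : Submodule.span (ZMod p) (Set.range Z.row) = U := by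
    have h1 : Set.range Z.row = U.subtype '' Set.range B := by
      rw [← Set.range_comp]
      rfl
    rw [h1, Submodule.span_image, B.span_eq, Submodule.map_top, Submodule.range_subtype]
  -- The voltage group is lifted so that the covering lives in the prescribed universe.
  let e : ULift.{u} (Fin (Module.finrank (ZMod p) U) → ZMod p) ≃ₗ[ZMod p] _ := ULift.moduleEquiv
  have hspan : Submodule.span (ZMod p) (Set.range fun j => e.symm (Z.col j)) = ⊤ := by
    rw [show (fun j => e.symm (Z.col j)) = e.symm ∘ Z.col from rfl, Set.range_comp]
    have h1 := Submodule.span_image (R := ZMod p) (s := Set.range Z.col) e.symm.toLinearMap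
    rw [span_col_eq_top Z hZ, Submodule.map_top, LinearEquiv.range] at h1
    exact h1
  refine ⟨treeCover fun j => e.symm (Z.col j), treeCover_connected _ hspan,
    treeCover_isElementaryAbelian _, ?_⟩
  refine Eq.trans ?_ hU
  ext z'
  rw [mem_cobSpace_treeCover _ hspan, ← exists_dual_iff]
  constructor
  · rintro ⟨l, rfl⟩
    exact ⟨l ∘ₗ e.symm.toLinearMap, rfl⟩
  · rintro ⟨l, rfl⟩
    exact ⟨l ∘ₗ e.toLinearMap, rfl⟩

end Matrices

end MobiusKantor

namespace MobiusKantor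

/-! ### The automorphism group of the Möbius-Kantor graph -/

instance : DecidableEq (MK ≃g MK) := fun a b =>
  decidable_of_iff (∀ v, a v = b v) ⟨fun h => RelIso.ext h, fun h v => by rw [h]⟩

/-- The colour classes of the bipartite graph `GP(8,3)`. -/
def color : Vertex → Bool
  | .inl i => i.val % 2 == 0
  | .inr i => i.val % 2 == 1

theorem color_adj : ∀ a b, MK.Adj a b → color b = !color a := by decide +kernel

/-- The automorphism that fixes the arc `(8, 16)` and interchanges the other two neighbours of
each of its ends. -/
def tau : MK ≃g MK := sigma * omega * sigma * omega * sigma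

/-- An automorphism that reverses the arc `(8, 16)`. -/
def kappa : MK ≃g MK := rho * rho * sigma * rho

/-- The elements of `H`. -/
def elemH (i j k : ℕ) : MK ≃g MK :=
  (rho ^ 2) ^ i * (omega * rho ^ 2 * omega⁻¹) ^ j * omega ^ k

theorem elemH_mem (i j k : ℕ) : elemH i j k ∈ H := by
  have h1 : rho ^ 2 ∈ H := Subgroup.subset_closure (by simp)
  have h2 : omega ∈ H := Subgroup.subset_closure (by simp)
  exact H.mul_mem (H.mul_mem (H.pow_mem h1 _)
    (H.pow_mem (H.mul_mem (H.mul_mem h2 h1) (H.inv_mem h2)) _)) (H.pow_mem h2 _)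

/-- The 24 products `elemH i j k` reach all 24 arcs that leave a vertex of the colour of vertex 8.
Edge-transitivity of $H$ follows at once. -/
theorem exists_elemH_arc : ∀ u v, MK.Adj u v → color u = true →
    ∃ (i : Fin 4) (j : Fin 2) (k : Fin 3),
      elemH i j k (.inl 0) = u ∧ elemH i j k (.inr 0) = v := by
  decide +kernel

theorem tau_eq : tau = sigma * elemH 3 1 0 := by decide +kernel

theorem kappa_eq : kappa = rho * sigma * elemH 3 0 0 := by decide +kernel

theorem kappa_tau_eq : kappa * tau = rho * elemH 1 1 0 := by decide +kernel

theorem tau_sq : tau * tau = 1 := by decide +kernel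

theorem kappa_swap : kappa (.inl 0) = .inr 0 ∧ kappa (.inr 0) = .inl 0 := by decide +kernel

theorem tau_fix : tau (.inl 0) = .inl 0 ∧ tau (.inr 0) = .inr 0 ∧ tau (.inr 5) = .inr 3 := by
  decide +kernel

/-- An edge-transitive group need only meet the cosets of $\omega$ and $\omega^2$ modulo the
stabiliser of the base edge. In each of the 16 cases one of four words in the two elements found
there equals $\omega$. -/
theorem omega_of_edge : ∀ x ∈ [1, tau, kappa, kappa * tau], ∀ y ∈ [1, tau, kappa, kappa * tau],
    (omega * x)⁻¹ * (omega ^ 2 * y) * (omega * x) * (omega ^ 2 * y) = omega ∨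
    (omega * x)⁻¹ * (omega ^ 2 * y)⁻¹ * (omega * x)⁻¹ * (omega ^ 2 * y) = omega ∨
    (omega ^ 2 * y) * (omega * x)⁻¹ = omega ∨
    (omega ^ 2 * y) * (omega * x) * (omega ^ 2 * y)⁻¹ * (omega * x)⁻¹ = omega := by
  decide +kernel

/-- This expresses $\rho^2$ by $\omega$ and one conjugate of it, so a group containing both contains
$H$. -/
theorem rho_sq_eq : rho ^ 2 = omega * (rho ^ 2 * omega * (rho ^ 2)⁻¹) * omega := by decide +kernel

theorem H_preserves_color : ∀ v, color ((rho ^ 2) v) = color v ∧ color (omega v) = color v ∧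
    color (sigma v) = color v := by
  decide +kernel

/-- The second half of the conditions on the images of the vertices in `arc_rigidity`. -/
def RigidTail (o1 o3 o6 o7 i1 i6 : Vertex) : Prop :=
    ∀ i4, MK.Adj i1 i4 → i4 ≠ i6 → i4 ≠ o1 →
    ∀ o2, MK.Adj o1 o2 → MK.Adj o3 o2 →
    ∀ o4, MK.Adj o3 o4 → MK.Adj i4 o4 →
    ∀ o5, MK.Adj o4 o5 → MK.Adj o6 o5 → MK.Adj (.inr 5) o5 →
    ∀ i2, MK.Adj o2 i2 → MK.Adj (.inr 5) i2 →
    ∀ i7, MK.Adj i2 i7 → MK.Adj o7 i7 → MK.Adj i4 i7 →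
    o2 = .inl 2 ∧ o4 = .inl 4 ∧ o5 = .inl 5 ∧ i2 = .inr 2 ∧ i4 = .inr 4 ∧ i7 = .inr 7 ∧
      o1 = .inl 1 ∧ o3 = .inl 3 ∧ o6 = .inl 6 ∧ o7 = .inl 7 ∧ i1 = .inr 1 ∧ i6 = .inr 6

set_option synthInstance.maxSize 100000 in
set_option synthInstance.maxHeartbeats 1000000 in
instance (o1 o3 o6 o7 i1 i6 : Vertex) : Decidable (RigidTail o1 o3 o6 o7 i1 i6) := by
  unfold RigidTail
  infer_instance

-- This is the combinatorial core of the rigidity of a fixed 2-arc, phrased for vertices instead of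
-- automorphisms so that it is decidable. Each new image is confined to neighbours of earlier ones,
-- which keeps the search small; `RigidTail` is split off to keep the decision instance manageable.
set_option synthInstance.maxSize 100000 in
set_option synthInstance.maxHeartbeats 1000000 in
theorem arc_rigidity : ∀ o1, MK.Adj (.inl 0) o1 → o1 ≠ .inr 0 →
    ∀ o7, MK.Adj (.inl 0) o7 → o7 ≠ .inr 0 → o7 ≠ o1 →
    ∀ i6, MK.Adj (.inr 3) i6 → i6 ≠ .inr 0 →
    ∀ o3, MK.Adj (.inr 3) o3 → o3 ≠ .inr 0 → o3 ≠ i6 →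
    ∀ i1, MK.Adj i6 i1 → MK.Adj o1 i1 →
    ∀ o6, MK.Adj i6 o6 → MK.Adj o7 o6 →
    RigidTail o1 o3 o6 o7 i1 i6 := by
  decide +kernel

theorem mul_apply_eq {a b : MK ≃g MK} {u v w : Vertex} (h : b u = v) (h' : a v = w) :
    (a * b) u = w := by
  subst h
  exact h'

theorem inv_apply_eq {a : MK ≃g MK} {u v : Vertex} (h : a u = v) : (a⁻¹ : MK ≃g MK) v = u := by
  subst h
  exact a.symm_apply_apply u

theorem eq_one_of_fix (b : MK ≃g MK) (h0 : b (.inl 0) = .inl 0) (h1 : b (.inr 0) = .inr 0)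
    (h2 : b (.inr 3) = .inr 3) : b = 1 := by
  have adj : ∀ {u v : Vertex}, MK.Adj u v → MK.Adj (b u) (b v) := fun h => b.map_rel_iff.2 h
  have ne : ∀ {u v : Vertex}, u ≠ v → b u ≠ b v := fun h e => h (b.injective e)
  have i5 : ∀ w, MK.Adj (.inr 0) w → w ≠ .inl 0 → w ≠ .inr 3 → w = .inr 5 := by decide +kernel
  have h5 : b (.inr 5) = .inr 5 := by
    refine i5 _ ?_ ?_ ?_
    · rw [← h1]
      exact adj (by decide +kernel)
    · rw [← h0]
      exact ne (by decide +kernel)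
    · rw [← h2]
      exact ne (by decide +kernel)
  have key := arc_rigidity (b (.inl 1)) (by rw [← h0]; exact adj (by decide +kernel))
    (by rw [← h1]; exact ne (by decide +kernel))
    (b (.inl 7)) (by rw [← h0]; exact adj (by decide +kernel))
    (by rw [← h1]; exact ne (by decide +kernel)) (ne (by decide +kernel))
    (b (.inr 6)) (by rw [← h2]; exact adj (by decide +kernel))
    (by rw [← h1]; exact ne (by decide +kernel))
    (b (.inl 3)) (by rw [← h2]; exact adj (by decide +kernel))
    (by rw [← h1]; exact ne (by decide +kernel)) (ne (by decide +kernel))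
    (b (.inr 1)) (adj (by decide +kernel)) (adj (by decide +kernel))
    (b (.inl 6)) (adj (by decide +kernel)) (adj (by decide +kernel))
    (b (.inr 4)) (adj (by decide +kernel)) (ne (by decide +kernel)) (ne (by decide +kernel))
    (b (.inl 2)) (adj (by decide +kernel)) (adj (by decide +kernel))
    (b (.inl 4)) (adj (by decide +kernel)) (adj (by decide +kernel))
    (b (.inl 5)) (adj (by decide +kernel)) (adj (by decide +kernel))
    (by rw [← h5]; exact adj (by decide +kernel))
    (b (.inr 2)) (adj (by decide +kernel)) (by rw [← h5]; exact adj (by decide +kernel))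
    (b (.inr 7)) (adj (by decide +kernel)) (adj (by decide +kernel)) (adj (by decide +kernel))
  obtain ⟨a2, a4, a5, b2, b4, b7, a1, a3, a6, a7, b1, b6⟩ := key
  refine RelIso.ext ?_
  rintro (i | i) <;> fin_cases i
  exacts [h0, a1, a2, a3, a4, a5, a6, a7, h1, b1, b2, h2, b4, h5, b6, b7]

/-- Once the arc $(8,16)$ is fixed, inner vertex 3 can only stay or go to inner vertex 5; `tau`
repairs the second case. The stabiliser of the base edge therefore has at most four elements. -/
theorem eq_one_or_tau_of_fix (b : MK ≃g MK) (h0 : b (.inl 0) = .inl 0)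
    (h1 : b (.inr 0) = .inr 0) : b = 1 ∨ b = tau := by
  have i3 : ∀ w, MK.Adj (.inr 0) w → w ≠ .inl 0 → w = .inr 3 ∨ w = .inr 5 := by decide +kernel
  have h3 : b (.inr 3) = .inr 3 ∨ b (.inr 3) = .inr 5 := by
    refine i3 _ ?_ ?_
    · rw [← h1]
      exact b.map_rel_iff.2 (by decide +kernel)
    · rw [← h0]
      exact fun e => absurd (b.injective e) (by decide)
  rcases h3 with h3 | h3
  · exact Or.inl (eq_one_of_fix b h0 h1 h3)
  · right
    have h4 : tau * b = 1 := by
      refine eq_one_of_fix _ ?_ ?_ ?_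
      · exact mul_apply_eq h0 tau_fix.1
      · exact mul_apply_eq h1 tau_fix.2.1
      · exact mul_apply_eq h3 tau_fix.2.2
    exact mul_left_cancel (h4.trans tau_sq.symm)

theorem mem_stabilizer_of_edge (b : MK ≃g MK)
    (h : Sym2.map b s(.inl 0, .inr 0) = s(.inl 0, .inr 0)) :
    b ∈ [1, tau, kappa, kappa * tau] := by
  rw [Sym2.map_mk, Sym2.eq_iff] at h
  rcases h with ⟨h0, h1⟩ | ⟨h0, h1⟩
  · rcases eq_one_or_tau_of_fix b h0 h1 with rfl | rfl <;> simp
  · have h3 := eq_one_or_tau_of_fix (kappa⁻¹ * b)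
      (mul_apply_eq h0 (inv_apply_eq kappa_swap.1))
      (mul_apply_eq h1 (inv_apply_eq kappa_swap.2))
    rw [inv_mul_eq_one, inv_mul_eq_iff_eq_mul] at h3
    rcases h3 with rfl | rfl <;> simp

theorem exists_H_edge {e : Sym2 Vertex} (he : e ∈ MK.edgeSet) :
    ∃ h ∈ H, Sym2.map h s(.inl 0, .inr 0) = e := by
  induction e with
  | h u v =>
    rw [SimpleGraph.mem_edgeSet] at he
    rcases hu : color u with _ | _
    · have h1 := color_adj _ _ he
      rw [hu] at h1
      obtain ⟨i, j, k, h2, h3⟩ := exists_elemH_arc v u he.symm h1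
      refine ⟨_, elemH_mem i j k, ?_⟩
      rw [Sym2.map_mk, h2, h3, Sym2.eq_swap]
    · obtain ⟨i, j, k, h2, h3⟩ := exists_elemH_arc u v he hu
      refine ⟨_, elemH_mem i j k, ?_⟩
      rw [Sym2.map_mk, h2, h3]

theorem base_mem_edgeSet : s(.inl 0, .inr 0) ∈ MK.edgeSet := (adj_spoke 0).symm

theorem map_mem_edgeSet (a : MK ≃g MK) {e : Sym2 Vertex} (he : e ∈ MK.edgeSet) :
    Sym2.map a e ∈ MK.edgeSet := by
  induction e with
  | h u v => exact a.map_rel_iff.2 he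

theorem map_mul_edge (a b : MK ≃g MK) (e : Sym2 Vertex) :
    Sym2.map (a * b) e = Sym2.map a (Sym2.map b e) := by
  rw [Sym2.map_map]
  rfl

theorem map_inv_edge (a : MK ≃g MK) (e : Sym2 Vertex) :
    Sym2.map (a⁻¹ : MK ≃g MK) (Sym2.map a e) = e := by
  rw [← map_mul_edge, inv_mul_cancel]
  exact congrFun Sym2.map_id e

theorem isEdgeTransitive_H : IsEdgeTransitive H := by
  intro e he f hf
  obtain ⟨h, hh, rfl⟩ := exists_H_edge he
  obtain ⟨k, hk, rfl⟩ := exists_H_edge hf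
  refine ⟨k * h⁻¹, H.mul_mem hk (H.inv_mem hh), ?_⟩
  rw [map_mul_edge, map_inv_edge]

theorem omega_mem_of_isEdgeTransitive {S : Subgroup (MK ≃g MK)} (hS : IsEdgeTransitive S) :
    omega ∈ S := by
  -- Edge-transitivity means that `S` meets every left coset of the stabiliser of the base edge.
  have key : ∀ h : MK ≃g MK, ∃ x ∈ [1, tau, kappa, kappa * tau], h * x ∈ S := by
    intro h
    obtain ⟨g, hg, e⟩ := hS _ base_mem_edgeSet _ (map_mem_edgeSet h base_mem_edgeSet)
    refine ⟨h⁻¹ * g, mem_stabilizer_of_edge _ ?_, by rwa [mul_inv_cancel_left]⟩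
    rw [map_mul_edge, e, map_inv_edge]
  obtain ⟨x, hx, hx'⟩ := key omega
  obtain ⟨y, hy, hy'⟩ := key (omega ^ 2)
  rcases omega_of_edge x hx y hy with h | h | h | h <;> rw [← h]
  · exact S.mul_mem (S.mul_mem (S.mul_mem (S.inv_mem hx') hy') hx') hy'
  · exact S.mul_mem (S.mul_mem (S.mul_mem (S.inv_mem hx') (S.inv_mem hy')) (S.inv_mem hx')) hy'
  · exact S.mul_mem hy' (S.inv_mem hx')
  · exact S.mul_mem (S.mul_mem (S.mul_mem hy' hx') (S.inv_mem hy')) (S.inv_mem hx')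

theorem H_le_iff {S : Subgroup (MK ≃g MK)} : H ≤ S ↔ rho ^ 2 ∈ S ∧ omega ∈ S := by
  rw [H, Subgroup.closure_le, Set.pair_subset_iff]
  rfl

theorem M_le_iff {S : Subgroup (MK ≃g MK)} : M ≤ S ↔ H ≤ S ∧ sigma ∈ S := by
  rw [H_le_iff, M, Subgroup.closure_le]
  simp [Set.insert_subset_iff, and_assoc]

/-- The edge-transitive groups are the groups that contain `H`. -/
theorem isEdgeTransitive_iff {S : Subgroup (MK ≃g MK)} : IsEdgeTransitive S ↔ H ≤ S := by
  constructor
  · intro hS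
    rw [H_le_iff]
    have h1 := omega_mem_of_isEdgeTransitive hS
    -- The same argument applied to a conjugate of `S`, again edge-transitive, puts
    -- $\rho^2\omega\rho^{-2}$ into `S`.
    have h2 : omega ∈ S.map (MulAut.conj (rho ^ 2)⁻¹).toMonoidHom := by
      refine omega_mem_of_isEdgeTransitive fun e he f hf => ?_
      obtain ⟨g, hg, h⟩ := hS _ (map_mem_edgeSet (rho ^ 2) he) _ (map_mem_edgeSet (rho ^ 2) hf)
      refine ⟨_, ⟨g, hg, rfl⟩, ?_⟩
      change Sym2.map ((rho ^ 2)⁻¹ * g * (rho ^ 2)⁻¹⁻¹ : MK ≃g MK) e = f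
      rw [inv_inv, map_mul_edge, map_mul_edge, h, map_inv_edge]
    obtain ⟨g, hg, h⟩ := h2
    have h3 : rho ^ 2 * omega * (rho ^ 2)⁻¹ = g := by
      rw [← h]
      change rho ^ 2 * ((rho ^ 2)⁻¹ * g * (rho ^ 2)⁻¹⁻¹) * (rho ^ 2)⁻¹ = g
      group
    refine ⟨?_, h1⟩
    rw [rho_sq_eq, h3]
    exact S.mul_mem (S.mul_mem h1 hg) h1
  · intro hS e he f hf
    obtain ⟨g, hg, h⟩ := isEdgeTransitive_H e he f hf
    exact ⟨g, hS hg, h⟩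

/-- Coset representatives of `H` in the automorphism group. -/
theorem exists_coset (a : MK ≃g MK) :
    ∃ x ∈ [1, sigma, rho, rho * sigma], ∃ h ∈ H, a = x * h := by
  obtain ⟨h, hh, e⟩ := exists_H_edge (map_mem_edgeSet a⁻¹ base_mem_edgeSet)
  -- Correcting `a` by an element of $H$ puts it in the stabiliser of the base edge, whose four
  -- elements lie in the four cosets.
  have h1 : a * h ∈ [1, tau, kappa, kappa * tau] := by
    refine mem_stabilizer_of_edge _ ?_
    rw [map_mul_edge, e, ← map_mul_edge, mul_inv_cancel]
    exact congrFun Sym2.map_id _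
  have h2 : ∃ x ∈ [1, sigma, rho, rho * sigma], ∃ k ∈ H, a * h = x * k := by
    simp only [List.mem_cons, List.not_mem_nil, or_false] at h1
    rcases h1 with h1 | h1 | h1 | h1 <;> rw [h1]
    · exact ⟨1, by simp, 1, H.one_mem, rfl⟩
    · exact ⟨sigma, by simp, _, elemH_mem _ _ _, tau_eq⟩
    · exact ⟨rho * sigma, by simp, _, elemH_mem _ _ _, kappa_eq⟩
    · exact ⟨rho, by simp, _, elemH_mem _ _ _, kappa_tau_eq⟩
  obtain ⟨x, hx, k, hk, e2⟩ := h2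
  exact ⟨x, hx, k * h⁻¹, H.mul_mem hk (H.inv_mem hh),
    by rw [← mul_assoc, ← e2, mul_inv_cancel_right]⟩

theorem mem_of_mul_mem {S : Subgroup (MK ≃g MK)} (hS : H ≤ S) {x h : MK ≃g MK} (hh : h ∈ H)
    (hx : x * h ∈ S) : x ∈ S :=
  (S.mul_mem_cancel_right (hS hh)).1 hx

theorem le_M_of_not_mem {S : Subgroup (MK ≃g MK)} (hS : H ≤ S) (h1 : rho ∉ S)
    (h2 : rho * sigma ∉ S) : S ≤ M := by
  intro a ha
  have hM := M_le_iff.1 le_rfl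
  obtain ⟨x, hx, h, hh, rfl⟩ := exists_coset a
  have hxS := mem_of_mul_mem hS hh ha
  simp only [List.mem_cons, List.not_mem_nil, or_false] at hx
  rcases hx with rfl | rfl | rfl | rfl
  · exact M.mul_mem M.one_mem (hM.1 hh)
  · exact M.mul_mem hM.2 (hM.1 hh)
  · exact absurd hxS h1
  · exact absurd hxS h2

theorem eq_M {S : Subgroup (MK ≃g MK)} (hS : H ≤ S) (h : sigma ∈ S) (h1 : rho ∉ S)
    (h2 : rho * sigma ∉ S) : S = M :=
  le_antisymm (le_M_of_not_mem hS h1 h2) (M_le_iff.2 ⟨hS, h⟩)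

theorem eq_H {S : Subgroup (MK ≃g MK)} (hS : H ≤ S) (h0 : sigma ∉ S) (h1 : rho ∉ S)
    (h2 : rho * sigma ∉ S) : S = H := by
  refine le_antisymm (fun a ha => ?_) hS
  obtain ⟨x, hx, h, hh, rfl⟩ := exists_coset a
  have hxS := mem_of_mul_mem hS hh ha
  simp only [List.mem_cons, List.not_mem_nil, or_false] at hx
  rcases hx with rfl | rfl | rfl | rfl
  · rwa [one_mul]
  · exact absurd hxS h0
  · exact absurd hxS h1
  · exact absurd hxS h2

theorem color_apply_of_mem_M {a : MK ≃g MK} (ha : a ∈ M) : ∀ v, color (a v) = color v := by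
  induction ha using Subgroup.closure_induction with
  | mem x hx =>
    intro v
    simp only [Set.mem_insert_iff, Set.mem_singleton_iff] at hx
    rcases hx with rfl | rfl | rfl
    · exact (H_preserves_color v).1
    · exact (H_preserves_color v).2.1
    · exact (H_preserves_color v).2.2
  | one => exact fun _ => rfl
  | mul x y _ _ hx hy => exact fun v => (hx (y v)).trans (hy v)
  | inv x _ hx =>
    intro v
    rw [← hx (x⁻¹ v)]
    exact congrArg color (x.apply_symm_apply v)

theorem exists_adj : ∀ v, ∃ w, MK.Adj v w := by decide +kernel

/-- The vertex-transitive groups among the groups that contain `H`. -/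
theorem isVertexTransitive_iff {S : Subgroup (MK ≃g MK)} (hS : H ≤ S) :
    IsVertexTransitive S ↔ rho ∈ S ∨ rho * sigma ∈ S := by
  constructor
  · intro h
    by_contra hc
    rw [not_or] at hc
    obtain ⟨g, hg, e⟩ := h (.inl 0) (.inr 0)
    -- Without $\rho$ and $\rho\sigma$ the group lies in $M$, which preserves the bipartition and
    -- cannot move vertex 8 to its neighbour 16.
    have h1 := color_apply_of_mem_M (le_M_of_not_mem hS hc.1 hc.2 hg) (.inl 0)
    rw [e] at h1
    exact absurd h1 (by decide)
  · intro h
    have hs : ∃ s ∈ S, s (.inl 0) = .inr 0 := by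
      rcases h with h | h
      · refine ⟨kappa * tau, ?_, ?_⟩
        · rw [kappa_tau_eq]
          exact S.mul_mem h (hS (elemH_mem _ _ _))
        · exact mul_apply_eq tau_fix.1 kappa_swap.1
      · refine ⟨kappa, ?_, kappa_swap.1⟩
        rw [kappa_eq]
        exact S.mul_mem h (hS (elemH_mem _ _ _))
    obtain ⟨s, hs, hs'⟩ := hs
    have key : ∀ u, ∃ g ∈ S, g (.inl 0) = u := by
      intro u
      obtain ⟨v, huv⟩ := exists_adj u
      rcases hu : color u with _ | _
      · have h1 := color_adj _ _ huv
        rw [hu] at h1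
        obtain ⟨i, j, k, -, h3⟩ := exists_elemH_arc v u huv.symm h1
        exact ⟨elemH i j k * s, S.mul_mem (hS (elemH_mem _ _ _)) hs, mul_apply_eq hs' h3⟩
      · obtain ⟨i, j, k, h2, -⟩ := exists_elemH_arc u v huv hu
        exact ⟨_, hS (elemH_mem i j k), h2⟩
    intro u v
    obtain ⟨g, hg, rfl⟩ := key u
    obtain ⟨k, hk, rfl⟩ := key v
    refine ⟨k * g⁻¹, S.mul_mem hk (S.inv_mem hg), ?_⟩
    change k (g⁻¹ (g _)) = _
    exact congrArg k (g.symm_apply_apply _)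

end MobiusKantor

namespace MobiusKantor

/-! ### The action of the automorphism group on subspaces of the cohomology -/

section Action

variable {F : Type*} [Field F]

/-- The action of an automorphism on subspaces of the cohomology. -/
def act (a : MK ≃g MK) (U : Submodule F (Fin 9 → F)) : Submodule F (Fin 9 → F) :=
  U.comap (pullback F a)

theorem mem_act {a : MK ≃g MK} {U : Submodule F (Fin 9 → F)} {z : Fin 9 → F} :
    z ∈ act a U ↔ pullback F a z ∈ U := Iff.rfl

theorem act_one (U : Submodule F (Fin 9 → F)) : act 1 U = U := by
  rw [act, pullback_one, Submodule.comap_id]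

theorem act_mul (a b : MK ≃g MK) (U : Submodule F (Fin 9 → F)) :
    act (a * b) U = act a (act b U) := by
  rw [act, pullback_mul, Submodule.comap_comp]
  rfl

theorem act_inv_act (a : MK ≃g MK) (U : Submodule F (Fin 9 → F)) : act a⁻¹ (act a U) = U := by
  rw [← act_mul, inv_mul_cancel, act_one]

theorem act_act_inv (a : MK ≃g MK) (U : Submodule F (Fin 9 → F)) : act a (act a⁻¹ U) = U := by
  rw [← act_mul, mul_inv_cancel, act_one]

theorem act_injective (a : MK ≃g MK) :
    Function.Injective (act a : Submodule F (Fin 9 → F) → Submodule F (Fin 9 → F)) :=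
  fun U U' h => by rw [← act_inv_act a U, h, act_inv_act]

theorem act_mono (a : MK ≃g MK) {U U' : Submodule F (Fin 9 → F)} (h : U ≤ U') :
    act a U ≤ act a U' := Submodule.comap_mono h

theorem act_lt (a : MK ≃g MK) {U U' : Submodule F (Fin 9 → F)} (h : U < U') :
    act a U < act a U' :=
  lt_of_le_of_ne (act_mono a h.le) fun e => h.ne (act_injective a e)

/-- The stabiliser of a subspace of the cohomology. -/
def stab (U : Submodule F (Fin 9 → F)) : Subgroup (MK ≃g MK) where
  carrier := {a | act a U = U}
  one_mem' := act_one U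
  mul_mem' := by
    intro a b ha hb
    change act (a * b) U = U
    rw [act_mul, show act b U = U from hb, show act a U = U from ha]
  inv_mem' := by
    intro a ha
    change act a⁻¹ U = U
    conv_lhs => rw [← show act a U = U from ha]
    exact act_inv_act a U

theorem mem_stab {a : MK ≃g MK} {U : Submodule F (Fin 9 → F)} : a ∈ stab U ↔ act a U = U := Iff.rfl

instance : Finite (MK ≃g MK) := Finite.of_injective (fun a : MK ≃g MK => (a : Vertex → Vertex))
  DFunLike.coe_injective

/-- Inclusion suffices because `a` has finite order: going once around the powers of `a` reverses
it. -/
theorem mem_stab_of_le {a : MK ≃g MK} {U : Submodule F (Fin 9 → F)}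
    (h : ∀ z ∈ U, pullback F a z ∈ U) : a ∈ stab U := by
  have h1 : ∀ n : ℕ, U ≤ act (a ^ n) U := by
    intro n
    induction n with
    | zero => rw [pow_zero, act_one]
    | succ n ih =>
      rw [pow_succ, act_mul]
      exact ih.trans (act_mono _ h)
  obtain ⟨n, hn, hn'⟩ := isOfFinOrder_iff_pow_eq_one.1 (isOfFinOrder_of_finite a)
  refine le_antisymm ?_ h
  have h2 := act_mono a (h1 (n - 1))
  rwa [← act_mul, mul_pow_sub_one hn.ne', hn', act_one] at h2

theorem stab_act (a : MK ≃g MK) (U : Submodule F (Fin 9 → F)) (g : MK ≃g MK) :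
    g ∈ stab (act a U) ↔ a⁻¹ * g * a ∈ stab U := by
  rw [mem_stab, mem_stab, act_mul, act_mul]
  constructor
  · intro h
    rw [h, act_inv_act]
  · intro h
    conv_rhs => rw [← h]
    rw [act_act_inv]

/-- The stabiliser is edge- but not vertex-transitive. -/
def IsSemi (U : Submodule F (Fin 9 → F)) : Prop :=
  H ≤ stab U ∧ rho ∉ stab U ∧ rho * sigma ∉ stab U

theorem isSemi_iff (U : Submodule F (Fin 9 → F)) :
    IsSemi U ↔ IsEdgeTransitive (stab U) ∧ ¬ IsVertexTransitive (stab U) := by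
  rw [isEdgeTransitive_iff, IsSemi]
  refine and_congr_right fun h => ?_
  rw [isVertexTransitive_iff h, not_or]

/-- Minimal subspaces with an edge- but not vertex-transitive stabiliser. -/
def IsMinSemi (U : Submodule F (Fin 9 → F)) : Prop :=
  IsSemi U ∧ ∀ U' < U, ¬ IsSemi U'

/-- Minimal nonzero subspaces with an edge-transitive stabiliser. -/
def IsMinEdge (U : Submodule F (Fin 9 → F)) : Prop :=
  H ≤ stab U ∧ ∀ U' < U, U' ≠ ⊥ → ¬ H ≤ stab U'

theorem act_bot (a : MK ≃g MK) : act a (⊥ : Submodule F (Fin 9 → F)) = ⊥ := by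
  have h1 : act a ⊥ ≤ act a (act a⁻¹ (⊥ : Submodule F (Fin 9 → F))) := act_mono a bot_le
  rwa [act_act_inv, le_bot_iff] at h1

/-- The zero subspace is stable under everything. Hence `IsMinSemi` needs no exclusion of `⊥`,
whereas `IsMinEdge` does. -/
theorem not_isSemi_bot : ¬ IsSemi (⊥ : Submodule F (Fin 9 → F)) := fun h => h.2.1 (act_bot _)

/-- A conjugate of an edge-transitive group is edge-transitive and so contains $H$ again; normality
of $H$ need not be proved separately. -/
theorem H_le_stab_act {U : Submodule F (Fin 9 → F)} (hU : H ≤ stab U) (a : MK ≃g MK) :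
    H ≤ stab (act a U) := by
  rw [← isEdgeTransitive_iff] at hU ⊢
  intro e he f hf
  obtain ⟨g, hg, h⟩ := hU _ (map_mem_edgeSet a⁻¹ he) _ (map_mem_edgeSet a⁻¹ hf)
  refine ⟨a * g * a⁻¹, ?_, ?_⟩
  · rw [stab_act]
    convert hg using 1
    group
  · rw [map_mul_edge, map_mul_edge, h, ← map_mul_edge, mul_inv_cancel]
    exact congrFun Sym2.map_id f

theorem isSemi_act_iff (a : MK ≃g MK) (U : Submodule F (Fin 9 → F)) :
    IsSemi (act a U) ↔ IsSemi U := by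
  have key : ∀ (a : MK ≃g MK) (U : Submodule F (Fin 9 → F)), IsSemi U → IsSemi (act a U) := by
    intro a U hU
    rw [isSemi_iff] at hU ⊢
    refine ⟨isEdgeTransitive_iff.2 (H_le_stab_act (isEdgeTransitive_iff.1 hU.1) a),
      fun h => hU.2 fun x y => ?_⟩
    obtain ⟨g, hg, h⟩ := h (a x) (a y)
    refine ⟨a⁻¹ * g * a, (stab_act a U g).1 hg, ?_⟩
    exact mul_apply_eq rfl (mul_apply_eq h (inv_apply_eq rfl))
  refine ⟨fun h => ?_, key a U⟩
  have h1 := key a⁻¹ _ h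
  rwa [act_inv_act] at h1

theorem isMinSemi_act_iff (a : MK ≃g MK) (U : Submodule F (Fin 9 → F)) :
    IsMinSemi (act a U) ↔ IsMinSemi U := by
  refine and_congr (isSemi_act_iff a U) ⟨fun h U' hU' hs => ?_, fun h U' hU' hs => ?_⟩
  · exact h _ (act_lt a hU') ((isSemi_act_iff a U').2 hs)
  · refine h (act a⁻¹ U') ?_ ((isSemi_act_iff _ _).2 hs)
    have h1 := act_lt a⁻¹ hU'
    rwa [act_inv_act] at h1

theorem exists_act_iff {U : Submodule F (Fin 9 → F)} (hU : H ≤ stab U)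
    (U' : Submodule F (Fin 9 → F)) : (∃ a, U' = act a U) ↔
      U' = U ∨ U' = act sigma U ∨ U' = act rho U ∨ U' = act (rho * sigma) U := by
  constructor
  · rintro ⟨a, rfl⟩
    obtain ⟨x, hx, h, hh, rfl⟩ := exists_coset a
    rw [act_mul, mem_stab.1 (hU hh)]
    simp only [List.mem_cons, List.not_mem_nil, or_false] at hx
    rcases hx with rfl | rfl | rfl | rfl
    · exact Or.inl (act_one U)
    · exact Or.inr (Or.inl rfl)
    · exact Or.inr (Or.inr (Or.inl rfl))
    · exact Or.inr (Or.inr (Or.inr rfl))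
  · rintro (h | h | h | h)
    · exact ⟨1, h.trans (act_one U).symm⟩
    · exact ⟨_, h⟩
    · exact ⟨_, h⟩
    · exact ⟨_, h⟩

end Action

/-! ### Coverings and subspaces -/

section Decomposition

variable {p : ℕ} {W : Type w} {Y : SimpleGraph W} {φ : Y →g MK}

theorem cobSpace_le_of_injective {Z : Type*} {G : SimpleGraph Z} {φ : Y →g MK} {φ' : G →g MK}
    (f : Y →g G) (hf : IsRegularCovering f) (hinj : Function.Injective f)
    (h : ∀ x, φ' (f x) = φ x) : cobSpace (ZMod p) φ ≤ cobSpace (ZMod p) φ' := by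
  obtain ⟨K, hK⟩ := hf
  rintro z ⟨g, hg⟩
  choose s hs using hK.surjective
  refine ⟨fun x => g (s x), fun x y hxy => ?_⟩
  obtain ⟨x', y', hxy', rfl, rfl⟩ := hK.surjective_arc x y hxy
  have hs' : ∀ x, s (f x) = x := fun x => hinj (hs _)
  simp only [hs', h]
  exact hg x' y' hxy'

theorem cobSpace_id : cobSpace (ZMod p) (SimpleGraph.Hom.id : MK →g MK) = ⊥ := by
  rw [eq_bot_iff]
  rintro z ⟨g, hg⟩
  rw [Submodule.mem_bot, ← cycleValues_eq_of_coboundary (treeVoltage z) z 0 (fun _ _ _ => by simp)]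
  refine cycleValues_eq_of_coboundary _ _ g fun a b hab => ?_
  have h1 := hg a b hab
  change g b = g a + treeVoltage z a b at h1
  rw [h1]
  simp [treeVoltage]

variable [Fact p.Prime]

/-- A zero subspace allows a morphism from $X$ back to the covering. Its composite with `φ` is a
deck transformation, so `φ` is injective. -/
theorem injective_of_cobSpace_eq_bot (hφ : IsElementaryAbelianCovering p φ) (hY : Y.Connected)
    (h : cobSpace (ZMod p) φ = ⊥) : Function.Injective φ := by
  obtain ⟨s, hs⟩ := exists_hom_of_cobSpace_le (φ := (SimpleGraph.Hom.id : MK →g MK)) hφ hY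
    (h ▸ bot_le)
  obtain ⟨K, hK, -⟩ := hφ
  obtain ⟨g, -, hg⟩ := hK.exists_deck hY (s.comp φ) (fun x => hs (φ x))
  intro x y e
  apply g.injective
  rw [← hg, ← hg]
  exact congrArg s e

/-- Intermediate coverings are subspaces of `cobSpace φ`. Noninjectivity of the lower map means that
the subspace is nonzero, and noninjectivity of the upper map that it is proper. The property
demanded of the lower map is left abstract so that both notions of minimality are covered. -/
theorem exists_decomposition_iff (hφ : IsElementaryAbelianCovering p φ) (hY : Y.Connected)
    (Q' : ∀ {Z : Type w} {G : SimpleGraph Z}, (G →g MK) → Prop)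
    (Q : Submodule (ZMod p) (Fin 9 → ZMod p) → Prop)
    (hQ : ∀ {Z : Type w} {G : SimpleGraph Z} (φ' : G →g MK), G.Connected →
      IsElementaryAbelianCovering p φ' → (Q' φ' ↔ Q (cobSpace (ZMod p) φ'))) :
    (∃ (Z : Type w) (G : SimpleGraph Z) (φ' : G →g MK) (φ'' : Y →g G),
      φ = φ'.comp φ'' ∧ IsRegularCovering φ' ∧ IsRegularCovering φ'' ∧
      ¬ Function.Injective φ' ∧ ¬ Function.Injective φ'' ∧ Q' φ') ↔
    ∃ U < cobSpace (ZMod p) φ, U ≠ ⊥ ∧ Q U := by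
  constructor
  · rintro ⟨Z, G, φ', f, hcomp, ⟨L, hL⟩, ⟨L', hf⟩, hi', hi, hq⟩
    have hf' : ∀ x, φ' (f x) = φ x := fun x => by rw [hcomp]; rfl
    have hG : G.Connected := connected_of_surjective hY f hf.surjective
    obtain ⟨K, hK, hcomm, hexp⟩ := hφ
    have hφ' := hK.elementaryAbelian_of_comp hL hY f hf' hf.surjective hcomm hexp
    refine ⟨cobSpace (ZMod p) φ', lt_of_le_of_ne (cobSpace_le_of_hom f hf') fun e => hi ?_,
      fun h => hi' (injective_of_cobSpace_eq_bot hφ' hG h), (hQ φ' hG hφ').1 hq⟩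
    obtain ⟨s, hs⟩ := exists_hom_of_cobSpace_le (φ := φ') ⟨K, hK, hcomm, hexp⟩ hY e.ge
    obtain ⟨g, -, hg⟩ := hK.exists_deck hY (s.comp f) (fun x => (hs (f x)).trans (hf' x))
    intro x y e
    apply g.injective
    rw [← hg, ← hg]
    exact congrArg s e
  · rintro ⟨U, hU, hU', hq⟩
    obtain ⟨P, hP, hP', rfl⟩ := exists_cover.{w} U
    obtain ⟨f, hf⟩ := exists_hom_of_cobSpace_le hP' hP hU.le
    have hP'' := hP'
    obtain ⟨K, hK, -⟩ := hφ
    obtain ⟨L, hL, -⟩ := hP'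
    have hfc := hK.isRegularCovering_of_comp hL hY hP f hf
    refine ⟨P.Vert, P.graph, P.proj, f, RelHom.ext fun x => (hf x).symm, ⟨L, hL⟩, hfc,
      fun hi => hU' ?_, fun hi => ?_, (hQ _ hP hP'').2 hq⟩
    · rw [eq_bot_iff, ← cobSpace_id]
      exact cobSpace_le_of_injective P.proj ⟨L, hL⟩ hi fun _ => rfl
    · exact hU.not_ge (cobSpace_le_of_injective f hfc hi hf)

theorem liftGroup_eq (hφ : IsElementaryAbelianCovering p φ) (hY : Y.Connected) :
    liftGroup φ = stab (cobSpace (ZMod p) φ) :=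
  Subgroup.ext fun a => lifts_iff hφ hY a

theorem isEdgeTransitiveProj_iff (hφ : IsElementaryAbelianCovering p φ) (hY : Y.Connected) :
    IsEdgeTransitiveProj φ ↔ H ≤ stab (cobSpace (ZMod p) φ) := by
  rw [← liftGroup_eq hφ hY, ← isEdgeTransitive_iff]
  constructor
  · rintro ⟨G, hG, h⟩ e he f hf
    obtain ⟨g, hg, hgf⟩ := hG e he f hf
    exact ⟨g, h g hg, hgf⟩
  · exact fun h => ⟨_, h, fun a ha => ha⟩

theorem isVertexTransitiveProj_iff (hφ : IsElementaryAbelianCovering p φ) (hY : Y.Connected) :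
    IsVertexTransitiveProj φ ↔ IsVertexTransitive (stab (cobSpace (ZMod p) φ)) := by
  rw [← liftGroup_eq hφ hY]
  constructor
  · rintro ⟨G, hG, h⟩ x y
    obtain ⟨g, hg, hgf⟩ := hG x y
    exact ⟨g, h g hg, hgf⟩
  · exact fun h => ⟨_, h, fun a ha => ha⟩

theorem isSemisymmetricProj_iff (hφ : IsElementaryAbelianCovering p φ) (hY : Y.Connected) :
    IsSemisymmetricProj φ ↔ IsSemi (cobSpace (ZMod p) φ) := by
  rw [IsSemisymmetricProj, isEdgeTransitiveProj_iff hφ hY, isVertexTransitiveProj_iff hφ hY,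
    isSemi_iff, isEdgeTransitive_iff]

theorem isMinimalSemisymmetricProj_iff (hφ : IsElementaryAbelianCovering p φ)
    (hY : Y.Connected) : IsMinimalSemisymmetricProj φ ↔ IsMinSemi (cobSpace (ZMod p) φ) := by
  rw [IsMinimalSemisymmetricProj, IsMinSemi, isSemisymmetricProj_iff hφ hY,
    exists_decomposition_iff hφ hY (fun φ' => IsSemisymmetricProj φ') IsSemi
      (fun φ' hG h' => isSemisymmetricProj_iff h' hG)]
  refine and_congr_right fun _ => ⟨fun h U hU hs => h ⟨U, hU, ?_, hs⟩, ?_⟩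
  · rintro rfl
    exact not_isSemi_bot hs
  · rintro h ⟨U, hU, -, hs⟩
    exact h U hU hs

theorem isMinimalEdgeTransitiveProj_iff (hφ : IsElementaryAbelianCovering p φ)
    (hY : Y.Connected) : IsMinimalEdgeTransitiveProj φ ↔ IsMinEdge (cobSpace (ZMod p) φ) := by
  rw [IsMinimalEdgeTransitiveProj, IsMinEdge, isEdgeTransitiveProj_iff hφ hY,
    exists_decomposition_iff hφ hY (fun φ' => IsEdgeTransitiveProj φ') (fun U => H ≤ stab U)
      (fun φ' hG h' => isEdgeTransitiveProj_iff h' hG)]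
  refine and_congr_right fun _ => ⟨fun h U hU hb hs => h ⟨U, hU, hb, hs⟩, ?_⟩
  rintro h ⟨U, hU, hb, hs⟩
  exact h U hU hb hs

theorem isMinSemisymCover_iff {P : GraphOver.{0, u} MK} : IsMinSemisymCover p P ↔
    P.graph.Connected ∧ IsElementaryAbelianCovering p P.proj ∧
      IsMinSemi (cobSpace (ZMod p) P.proj) :=
  and_congr_right fun hY => and_congr_right fun hφ => isMinimalSemisymmetricProj_iff hφ hY

theorem isomorphic_iff_act {P : GraphOver.{0, u} MK} {Q : GraphOver.{0, v} MK}
    (hP : IsMinSemisymCover p P) (hQ : IsMinSemisymCover p Q) : P.Isomorphic Q ↔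
      ∃ a, cobSpace (ZMod p) Q.proj = act a (cobSpace (ZMod p) P.proj) :=
  isomorphic_iff hP.2.1 hQ.2.1 hP.1 hQ.1

end Decomposition

/-! ### Isomorphism classes as orbits of minimal subspaces -/

section Classes

variable {p : ℕ} [Fact p.Prime]

/-- Equivalence of minimal subspaces under the automorphism group. -/
def actSetoid (F : Type) [Field F] : Setoid {U : Submodule F (Fin 9 → F) // IsMinSemi U} where
  r U U' := ∃ a, U'.1 = act a U.1
  iseqv :=
    { refl := fun U => ⟨1, (act_one _).symm⟩
      symm := by
        rintro U U' ⟨a, h⟩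
        exact ⟨a⁻¹, by rw [h, act_inv_act]⟩
      trans := by
        rintro U U' U'' ⟨a, h⟩ ⟨b, h'⟩
        exact ⟨b * a, by rw [h', h, act_mul]⟩ }

theorem numClasses_eq : numClasses.{u} p = ENat.card (Quotient (actSetoid (ZMod p))) := by
  let f : {P : GraphOver.{0, u} MK // IsMinSemisymCover p P} →
      {U : Submodule (ZMod p) (Fin 9 → ZMod p) // IsMinSemi U} :=
    fun P => ⟨cobSpace (ZMod p) P.1.proj, (isMinSemisymCover_iff.1 P.2).2.2⟩
  have hf : ∀ P Q, (isoSetoid p).r P Q ↔ (actSetoid (ZMod p)).r (f P) (f Q) :=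
    fun P Q => isomorphic_iff_act P.2 Q.2
  refine ENat.card_congr (Equiv.ofBijective
    (Quotient.map f fun P Q h => (hf P Q).1 h) ⟨?_, ?_⟩)
  · intro x y
    induction x using Quotient.inductionOn with
    | h P =>
    induction y using Quotient.inductionOn with
    | h Q => exact fun h => Quotient.sound ((hf P Q).2 (Quotient.exact h))
  · intro y
    induction y using Quotient.inductionOn with
    | h U =>
      obtain ⟨P, h1, h2, h3⟩ := exists_cover.{u} U.1
      refine ⟨Quotient.mk _ ⟨P, isMinSemisymCover_iff.2 ⟨h1, h2, h3 ▸ U.2⟩⟩, ?_⟩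
      exact congrArg (Quotient.mk _) (Subtype.ext h3)

end Classes

end MobiusKantor

namespace MobiusKantor

/-! ### Explicit matrices -/

section Explicit

variable {F : Type*} [CommRing F]

theorem map_potential {N N' : Type*} [AddCommGroup N] [AddCommGroup N'] (f : N →+ N')
    (η : Vertex → Vertex → N) (v : Vertex) :
    f (potential η v) = potential (fun a b => f (η a b)) v := by
  rcases v with i | i <;> simp [potential, map_sum]

theorem map_cycleValues {N N' : Type*} [AddCommGroup N] [AddCommGroup N'] (f : N →+ N')
    (η : Vertex → Vertex → N) (j : Fin 9) :
    f (cycleValues η j) = cycleValues (fun a b => f (η a b)) j := by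
  rw [cycleValues, map_sub, map_add, map_potential, map_potential]
  rfl

theorem pullback_eq_of_matrix {a : MK ≃g MK} {A : Fin 9 → Fin 9 → F}
    (h : ∀ j k, cycleValues (fun u v => treeVoltage (Pi.single k (1 : F)) (a u) (a v)) j = A j k)
    (z : Fin 9 → F) : pullback F a z = fun j => ∑ k, A j k * z k := by
  have key : ∀ k : Fin 9, pullback F a (Pi.single k 1) = fun j => A j k :=
    fun k => funext fun j => h j k
  conv_lhs => rw [← Finset.univ_sum_single z]
  rw [map_sum]
  funext j
  rw [Finset.sum_apply]
  refine Finset.sum_congr rfl fun k _ => ?_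
  have h1 : (Pi.single k (z k) : Fin 9 → F) = z k • Pi.single k 1 := by
    rw [← Pi.single_smul, smul_eq_mul, mul_one]
  rw [h1, map_smul, key]
  exact mul_comm _ _

/-- The matrix of a pullback is defined over the integers, so one finite computation there serves
every field. -/
theorem pullback_eq_of_int {a : MK ≃g MK} {A : Fin 9 → Fin 9 → ℤ}
    (h : ∀ j k, cycleValues (fun u v => treeVoltage (Pi.single k (1 : ℤ)) (a u) (a v)) j = A j k)
    (z : Fin 9 → F) : pullback F a z = fun j => ∑ k, (A j k : F) * z k := by
  refine pullback_eq_of_matrix (fun j k => ?_) z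
  rw [← h j k]
  change _ = (Int.castAddHom F) (cycleValues _ j)
  rw [map_cycleValues]
  simp only [map_treeVoltage]
  have : (fun i : Fin 9 => (Int.castAddHom F) ((Pi.single k 1 : Fin 9 → ℤ) i)) = Pi.single k 1 := by
    funext i
    by_cases hik : i = k
    · subst hik
      simp
    · simp [hik]
  rw [this]

/-- The matrix of `rho` on the first cohomology. -/
def rhoMatrix : Fin 9 → Fin 9 → ℤ :=
  ![![1, 0, 0, 0, 0, 0, 0, 0, 0],
    ![-1, 0, 1, 0, 0, 0, 0, 0, 0],
    ![1, 0, 0, 1, 0, 0, 0, 0, 0],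
    ![0, 0, 0, 0, 1, 0, 0, 0, 0],
    ![-1, 0, 0, 0, 0, 1, 0, 0, 0],
    ![1, 0, 0, 0, 0, 0, 1, 0, 0],
    ![0, 0, 0, 0, 0, 0, 0, 1, 0],
    ![-1, 0, 0, 0, 0, 0, 0, 0, 1],
    ![1, 1, 0, 0, 0, 0, 0, 0, 0]]

theorem rhoMatrix_apply : ∀ j k : Fin 9,
    cycleValues (fun u v => treeVoltage (Pi.single k (1 : ℤ)) (rho u) (rho v)) j =
      rhoMatrix j k := by
  decide +kernel

theorem pullback_rho (z : Fin 9 → F) : pullback F rho z =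
    ![z 0, -z 0 + z 2, z 0 + z 3, z 4, -z 0 + z 5, z 0 + z 6, z 7, -z 0 + z 8, z 0 + z 1] := by
  rw [pullback_eq_of_int rhoMatrix_apply]
  funext j
  fin_cases j <;> simp [rhoMatrix, Fin.sum_univ_succ]

/-- The matrix of `sigma` on the first cohomology. -/
def sigmaMatrix : Fin 9 → Fin 9 → ℤ :=
  ![![0, -1, -1, -1, -1, -1, -1, -1, -1],
    ![0, 0, 0, 1, 1, 1, 0, 0, 0],
    ![-1, 0, 0, -1, -1, -1, -1, -1, 0],
    ![0, 0, 0, 0, 0, 1, 1, 1, 0],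
    ![0, 0, 1, 1, 1, 0, 0, 0, 0],
    ![0, 0, -1, -1, -1, -1, -1, 0, 0],
    ![0, 0, 0, 0, 1, 1, 1, 0, 0],
    ![0, 1, 1, 1, 0, 0, 0, 0, 0],
    ![0, -1, -1, -1, -1, -1, 0, 0, 0]]

theorem sigmaMatrix_apply : ∀ j k : Fin 9,
    cycleValues (fun u v => treeVoltage (Pi.single k (1 : ℤ)) (sigma u) (sigma v)) j =
      sigmaMatrix j k := by
  decide +kernel

theorem pullback_sigma (z : Fin 9 → F) : pullback F sigma z =
    ![-z 1 - z 2 - z 3 - z 4 - z 5 - z 6 - z 7 - z 8, z 3 + z 4 + z 5,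
      -z 0 - z 3 - z 4 - z 5 - z 6 - z 7, z 5 + z 6 + z 7, z 2 + z 3 + z 4,
      -z 2 - z 3 - z 4 - z 5 - z 6, z 4 + z 5 + z 6, z 1 + z 2 + z 3,
      -z 1 - z 2 - z 3 - z 4 - z 5] := by
  rw [pullback_eq_of_int sigmaMatrix_apply]
  funext j
  fin_cases j <;> simp [sigmaMatrix, Fin.sum_univ_succ] <;> ring

/-- The matrix of `omega` on the first cohomology. -/
def omegaMatrix : Fin 9 → Fin 9 → ℤ :=
  ![![0, 0, -1, 0, 0, 0, -1, 0, 0],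
    ![0, -1, 0, 0, 0, 0, 0, -1, -1],
    ![1, 0, -1, 0, 0, 0, 0, 1, 0],
    ![-1, 0, 1, 0, 0, 0, 0, 0, 0],
    ![0, 0, 0, 0, 0, 1, 1, 0, 0],
    ![0, 0, -1, -1, -1, -1, -1, 0, 0],
    ![0, 0, 1, 1, 0, 0, 0, 0, 0],
    ![0, 0, 0, 0, 0, 0, 1, 0, 0],
    ![0, 1, 0, 0, 0, 0, -1, 0, 0]]

theorem omegaMatrix_apply : ∀ j k : Fin 9,
    cycleValues (fun u v => treeVoltage (Pi.single k (1 : ℤ)) (omega u) (omega v)) j =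
      omegaMatrix j k := by
  decide +kernel

theorem pullback_omega (z : Fin 9 → F) : pullback F omega z =
    ![-z 2 - z 6, -z 1 - z 7 - z 8, z 0 - z 2 + z 7, -z 0 + z 2, z 5 + z 6,
      -z 2 - z 3 - z 4 - z 5 - z 6, z 2 + z 3, z 6, z 1 - z 6] := by
  rw [pullback_eq_of_int omegaMatrix_apply]
  funext j
  fin_cases j <;> simp [omegaMatrix, Fin.sum_univ_succ] <;> ring

end Explicit

end MobiusKantor

namespace MobiusKantor

/-! ### The prime two -/

/-- The elements of the quaternion subgroup of `H`. -/
def quaternion : Fin 8 → (MK ≃g MK) :=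
  ![1, rho ^ 2, rho ^ 2 * rho ^ 2, rho ^ 2 * rho ^ 2 * rho ^ 2, omega * rho ^ 2 * omega⁻¹,
    omega⁻¹ * rho ^ 2 * omega, rho ^ 2 * omega * rho ^ 2 * omega⁻¹,
    omega⁻¹ * rho ^ 2 * omega * rho ^ 2]

/-- The matrices of the quaternion subgroup over the field with two elements. -/
def quaternionMatrix : Fin 8 → Fin 9 → Fin 9 → ZMod 2 :=
  ![![![1, 0, 0, 0, 0, 0, 0, 0, 0],
      ![0, 1, 0, 0, 0, 0, 0, 0, 0],
      ![0, 0, 1, 0, 0, 0, 0, 0, 0],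
      ![0, 0, 0, 1, 0, 0, 0, 0, 0],
      ![0, 0, 0, 0, 1, 0, 0, 0, 0],
      ![0, 0, 0, 0, 0, 1, 0, 0, 0],
      ![0, 0, 0, 0, 0, 0, 1, 0, 0],
      ![0, 0, 0, 0, 0, 0, 0, 1, 0],
      ![0, 0, 0, 0, 0, 0, 0, 0, 1]],
    ![![1, 0, 0, 0, 0, 0, 0, 0, 0],
      ![0, 0, 0, 1, 0, 0, 0, 0, 0],
      ![1, 0, 0, 0, 1, 0, 0, 0, 0],
      ![1, 0, 0, 0, 0, 1, 0, 0, 0],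
      ![0, 0, 0, 0, 0, 0, 1, 0, 0],
      ![1, 0, 0, 0, 0, 0, 0, 1, 0],
      ![1, 0, 0, 0, 0, 0, 0, 0, 1],
      ![0, 1, 0, 0, 0, 0, 0, 0, 0],
      ![0, 0, 1, 0, 0, 0, 0, 0, 0]],
    ![![1, 0, 0, 0, 0, 0, 0, 0, 0],
      ![1, 0, 0, 0, 0, 1, 0, 0, 0],
      ![1, 0, 0, 0, 0, 0, 1, 0, 0],
      ![0, 0, 0, 0, 0, 0, 0, 1, 0],
      ![1, 0, 0, 0, 0, 0, 0, 0, 1],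
      ![1, 1, 0, 0, 0, 0, 0, 0, 0],
      ![1, 0, 1, 0, 0, 0, 0, 0, 0],
      ![0, 0, 0, 1, 0, 0, 0, 0, 0],
      ![1, 0, 0, 0, 1, 0, 0, 0, 0]],
    ![![1, 0, 0, 0, 0, 0, 0, 0, 0],
      ![0, 0, 0, 0, 0, 0, 0, 1, 0],
      ![0, 0, 0, 0, 0, 0, 0, 0, 1],
      ![0, 1, 0, 0, 0, 0, 0, 0, 0],
      ![1, 0, 1, 0, 0, 0, 0, 0, 0],
      ![1, 0, 0, 1, 0, 0, 0, 0, 0],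
      ![0, 0, 0, 0, 1, 0, 0, 0, 0],
      ![1, 0, 0, 0, 0, 1, 0, 0, 0],
      ![1, 0, 0, 0, 0, 0, 1, 0, 0]],
    ![![0, 1, 1, 1, 1, 1, 1, 1, 1],
      ![1, 1, 1, 0, 0, 0, 0, 0, 1],
      ![0, 1, 1, 0, 0, 0, 1, 1, 1],
      ![0, 0, 0, 0, 0, 0, 1, 1, 1],
      ![0, 1, 1, 1, 0, 0, 0, 0, 0],
      ![0, 1, 1, 1, 0, 0, 0, 1, 1],
      ![0, 1, 0, 0, 0, 0, 0, 1, 1],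
      ![0, 0, 1, 1, 1, 0, 0, 0, 0],
      ![0, 1, 1, 1, 1, 0, 0, 0, 1]],
    ![![0, 1, 1, 1, 1, 1, 1, 1, 1],
      ![0, 0, 0, 0, 0, 0, 1, 1, 1],
      ![0, 0, 0, 0, 1, 1, 1, 1, 1],
      ![0, 0, 0, 0, 1, 1, 1, 0, 0],
      ![0, 1, 0, 0, 0, 0, 0, 1, 1],
      ![0, 1, 0, 0, 0, 1, 1, 1, 1],
      ![0, 0, 0, 0, 0, 1, 1, 1, 0],
      ![1, 1, 1, 0, 0, 0, 0, 0, 1],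
      ![0, 1, 1, 0, 0, 0, 1, 1, 1]],
    ![![0, 1, 1, 1, 1, 1, 1, 1, 1],
      ![0, 0, 1, 1, 1, 0, 0, 0, 0],
      ![0, 1, 1, 1, 1, 0, 0, 0, 1],
      ![1, 1, 1, 0, 0, 0, 0, 0, 1],
      ![0, 0, 0, 1, 1, 1, 0, 0, 0],
      ![0, 1, 1, 1, 1, 1, 0, 0, 0],
      ![0, 1, 1, 1, 0, 0, 0, 0, 0],
      ![0, 0, 0, 0, 1, 1, 1, 0, 0],
      ![0, 0, 1, 1, 1, 1, 1, 0, 0]],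
    ![![0, 1, 1, 1, 1, 1, 1, 1, 1],
      ![0, 0, 0, 0, 1, 1, 1, 0, 0],
      ![0, 0, 1, 1, 1, 1, 1, 0, 0],
      ![0, 0, 1, 1, 1, 0, 0, 0, 0],
      ![0, 0, 0, 0, 0, 1, 1, 1, 0],
      ![1, 0, 0, 1, 1, 1, 1, 1, 0],
      ![0, 0, 0, 1, 1, 1, 0, 0, 0],
      ![0, 0, 0, 0, 0, 0, 1, 1, 1],
      ![0, 0, 0, 0, 1, 1, 1, 1, 1]]]

/-- The matrix of `rho * sigma` over the field with two elements. -/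
def rhoSigmaMatrix : Fin 9 → Fin 9 → ZMod 2 :=
  ![![0, 1, 1, 1, 1, 1, 1, 1, 1],
    ![0, 0, 0, 0, 1, 1, 1, 0, 0],
    ![0, 0, 0, 0, 1, 1, 1, 1, 1],
    ![0, 0, 0, 0, 0, 0, 1, 1, 1],
    ![0, 0, 0, 1, 1, 1, 0, 0, 0],
    ![1, 0, 0, 1, 1, 1, 1, 1, 0],
    ![0, 0, 0, 0, 0, 1, 1, 1, 0],
    ![0, 0, 1, 1, 1, 0, 0, 0, 0],
    ![0, 0, 1, 1, 1, 1, 1, 0, 0]]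

theorem quaternionMatrix_apply : ∀ (m : Fin 8) (j k : Fin 9),
    cycleValues (fun u v => treeVoltage (Pi.single k (1 : ZMod 2)) (quaternion m u)
      (quaternion m v)) j = quaternionMatrix m j k := by
  decide +kernel

theorem rhoSigmaMatrix_apply : ∀ j k : Fin 9,
    cycleValues (fun u v => treeVoltage (Pi.single k (1 : ZMod 2)) ((rho * sigma) u)
      ((rho * sigma) v)) j = rhoSigmaMatrix j k := by
  decide +kernel

/-- For each of the 512 vectors, $\rho\sigma$ acts either as some quaternion element $q$ or as
$1+\rho^4+q$, with $q$ depending on the vector. Therefore every $H$-stable subspace is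
$\rho\sigma$-stable in characteristic two. -/
theorem exists_quaternion_eq : ∀ z0 z1 z2 z3 z4 z5 z6 z7 z8 : ZMod 2, ∃ m : Fin 8,
    (∀ j, ∑ k, rhoSigmaMatrix j k * ![z0, z1, z2, z3, z4, z5, z6, z7, z8] k =
      ∑ k, quaternionMatrix m j k * ![z0, z1, z2, z3, z4, z5, z6, z7, z8] k) ∨
    ∀ j, ∑ k, rhoSigmaMatrix j k * ![z0, z1, z2, z3, z4, z5, z6, z7, z8] k =
      ∑ k, (quaternionMatrix 0 j k + quaternionMatrix 2 j k + quaternionMatrix m j k) *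
        ![z0, z1, z2, z3, z4, z5, z6, z7, z8] k := by
  decide +kernel

theorem quaternion_mem (m : Fin 8) : quaternion m ∈ H := by
  have h1 : rho ^ 2 ∈ H := Subgroup.subset_closure (by simp)
  have h2 : omega ∈ H := Subgroup.subset_closure (by simp)
  have h3 := H.inv_mem h2
  have h4 := H.mul_mem h1 h1
  fin_cases m
  exacts [H.one_mem, h1, h4, H.mul_mem h4 h1, H.mul_mem (H.mul_mem h2 h1) h3,
    H.mul_mem (H.mul_mem h3 h1) h2, H.mul_mem (H.mul_mem (H.mul_mem h1 h2) h1) h3,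
    H.mul_mem (H.mul_mem (H.mul_mem h3 h1) h2) h1]

theorem not_isSemi_two (U : Submodule (ZMod 2) (Fin 9 → ZMod 2)) : ¬ IsSemi U := by
  rintro ⟨hU, -, h⟩
  refine h (mem_stab_of_le fun z hz => ?_)
  have hq : ∀ m, (fun j => ∑ k, quaternionMatrix m j k * z k) ∈ U := fun m => by
    rw [← pullback_eq_of_matrix (quaternionMatrix_apply m)]
    have h1 := mem_stab.1 (hU (quaternion_mem m))
    rw [← h1] at hz
    exact hz
  rw [pullback_eq_of_matrix rhoSigmaMatrix_apply]
  have hz' : z = ![z 0, z 1, z 2, z 3, z 4, z 5, z 6, z 7, z 8] := by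
    funext j
    fin_cases j <;> rfl
  obtain ⟨m, hm | hm⟩ :=
    exists_quaternion_eq (z 0) (z 1) (z 2) (z 3) (z 4) (z 5) (z 6) (z 7) (z 8)
  · rw [← hz'] at hm
    rw [funext hm]
    exact hq m
  · rw [← hz'] at hm
    rw [funext hm]
    convert U.add_mem (U.add_mem (hq 0) (hq 2)) (hq m) using 1
    funext j
    simp only [Pi.add_apply, ← Finset.sum_add_distrib, add_mul]

end MobiusKantor

namespace MobiusKantor

/-! ### Decomposition of the cohomology in odd characteristic -/

section Coordinates

variable {F : Type*} [Field F]

/-- Vectors fixed by the quaternion subgroup. -/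
def vf (x y : F) : Fin 9 → F :=
  ![-4 * x, x + y, -3 * x - y, x + y, x - y, -3 * x + y, x - y, x + y, -3 * x - y]

/-- Vectors of the three-dimensional irreducible part. -/
def v3 (x y z : F) : Fin 9 → F :=
  ![2 * x, -x - z, x - y, -x + z, -x + y, x - z, -x - y, -x + z, x + y]

/-- Vectors on which `ρ⁴` acts as `-1`. -/
def vm (a b c d : F) : Fin 9 → F := ![0, a, b, c, d, -a, -b, -c, -d]

theorem vf_add (x y x' y' : F) : vf x y + vf x' y' = vf (x + x') (y + y') := by
  funext j
  fin_cases j <;> simp [vf] <;> ring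

theorem vf_smul (c x y : F) : c • vf x y = vf (c * x) (c * y) := by
  funext j
  fin_cases j <;> simp [vf] <;> ring

theorem v3_add (x y z x' y' z' : F) : v3 x y z + v3 x' y' z' = v3 (x + x') (y + y') (z + z') := by
  funext j
  fin_cases j <;> simp [v3] <;> ring

theorem v3_smul (c x y z : F) : c • v3 x y z = v3 (c * x) (c * y) (c * z) := by
  funext j
  fin_cases j <;> simp [v3] <;> ring

theorem vm_add (a b c d a' b' c' d' : F) :
    vm a b c d + vm a' b' c' d' = vm (a + a') (b + b') (c + c') (d + d') := by
  funext j
  fin_cases j <;> simp [vm] <;> ring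

theorem vm_smul (x a b c d : F) : x • vm a b c d = vm (x * a) (x * b) (x * c) (x * d) := by
  funext j
  fin_cases j <;> simp [vm]

theorem vf_zero : vf (0 : F) 0 = 0 := by
  funext j
  fin_cases j <;> simp [vf]

theorem v3_zero : v3 (0 : F) 0 0 = 0 := by
  funext j
  fin_cases j <;> simp [v3]

theorem vm_zero : vm (0 : F) 0 0 0 = 0 := by
  funext j
  fin_cases j <;> simp [vm]

theorem pullback_rho_vf (x y : F) : pullback F rho (vf x y) = vf x (-y) := by
  rw [pullback_rho]
  funext j
  fin_cases j <;> simp [vf] <;> ring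

theorem pullback_rho_v3 (x y z : F) : pullback F rho (v3 x y z) = v3 x (-z) y := by
  rw [pullback_rho]
  funext j
  fin_cases j <;> simp [v3] <;> ring

theorem pullback_rho_vm (a b c d : F) : pullback F rho (vm a b c d) = vm b c d (-a) := by
  rw [pullback_rho]
  funext j
  fin_cases j <;> simp [vm]

theorem pullback_sigma_vf (x y : F) : pullback F sigma (vf x y) = vf (-x) y := by
  rw [pullback_sigma]
  funext j
  fin_cases j <;> simp [vf] <;> ring

theorem pullback_sigma_v3 (x y z : F) : pullback F sigma (v3 x y z) = v3 x z (-y) := by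
  rw [pullback_sigma]
  funext j
  fin_cases j <;> simp [v3] <;> ring

theorem pullback_sigma_vm (a b c d : F) : pullback F sigma (vm a b c d) =
    vm (-a + c + d) (a + b - d) (-a - b - c) (b + c + d) := by
  rw [pullback_sigma]
  funext j
  fin_cases j <;> simp [vm] <;> ring

theorem pullback_omega_vf (h2 : (2 : F) ≠ 0) (x y : F) :
    pullback F omega (vf x y) = vf (-(x + y) / 2) ((3 * x - y) / 2) := by
  rw [pullback_omega]
  funext j
  fin_cases j <;> simp [vf] <;> field_simp <;> ring

theorem pullback_omega_v3 (x y z : F) : pullback F omega (v3 x y z) = v3 y (-z) (-x) := by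
  rw [pullback_omega]
  funext j
  fin_cases j <;> simp [v3] <;> ring

theorem pullback_omega_vm (a b c d : F) : pullback F omega (vm a b c d) =
    vm (-a + c + d) (-b - c) b (-a - b) := by
  rw [pullback_omega]
  funext j
  fin_cases j <;> simp [vm] <;> ring

theorem exists_coordinates (h2 : (2 : F) ≠ 0) (v : Fin 9 → F) :
    ∃ x y p q r a b c d : F, v = vf x y + v3 p q r + vm a b c d := by
  have h4 : (4 : F) ≠ 0 := by
    rw [show (4 : F) = 2 * 2 by norm_num]
    exact mul_ne_zero h2 h2
  have h8 : (8 : F) ≠ 0 := by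
    rw [show (8 : F) = 4 * 2 by norm_num]
    exact mul_ne_zero h4 h2
  -- These are the entries of the inverse of the $9\times9$ change of coordinates; only powers of
  -- two occur as denominators.
  refine ⟨-(v 0 + v 1 + v 2 + v 3 + v 4 + v 5 + v 6 + v 7 + v 8) / 8,
    (v 0 + v 1 - v 2 + v 3 - v 4 + v 5 - v 6 + v 7 - v 8) / 8,
    (v 0 - v 1 - v 2 - v 3 - v 4 - v 5 - v 6 - v 7 - v 8) / 4,
    (-v 2 + v 4 - v 6 + v 8) / 4, (v 0 - v 1 + v 3 - v 5 + v 7) / 4,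
    (v 0 + v 1 - v 5) / 2, (-v 0 + v 2 - v 6) / 2, (v 3 - v 7) / 2, (v 0 + v 4 - v 8) / 2, ?_⟩
  funext j
  fin_cases j <;> simp [vf, v3, vm] <;> field_simp <;> ring

theorem eq_zero_of_coordinates (h2 : (2 : F) ≠ 0) {x y p q r a b c d : F}
    (h : vf x y + v3 p q r + vm a b c d = 0) :
    (x = 0 ∧ y = 0) ∧ (p = 0 ∧ q = 0 ∧ r = 0) ∧ a = 0 ∧ b = 0 ∧ c = 0 ∧ d = 0 := by
  have h8 : (8 : F) ≠ 0 := by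
    rw [show (8 : F) = 2 * 2 * 2 by norm_num]
    exact mul_ne_zero (mul_ne_zero h2 h2) h2
  have e : ∀ j, (vf x y + v3 p q r + vm a b c d) j = 0 := fun j => by rw [h]; rfl
  have e0 := e 0
  have e1 := e 1
  have e2 := e 2
  have e3 := e 3
  have e4 := e 4
  have e5 := e 5
  have e6 := e 6
  have e7 := e 7
  have e8 := e 8
  simp [vf, v3, vm] at e0 e1 e2 e3 e4 e5 e6 e7 e8
  refine ⟨⟨?_, ?_⟩, ⟨?_, ?_, ?_⟩, ?_, ?_, ?_, ?_⟩ <;> apply mul_left_cancel₀ h8 <;>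
    rw [mul_zero]
  · linear_combination -(e0 + e1 + e2 + e3 + e4 + e5 + e6 + e7 + e8)
  · linear_combination e0 + e1 - e2 + e3 - e4 + e5 - e6 + e7 - e8
  · linear_combination 2 * (e0 - e1 - e2 - e3 - e4 - e5 - e6 - e7 - e8)
  · linear_combination 2 * (-e2 + e4 - e6 + e8)
  · linear_combination 2 * (e0 - e1 + e3 - e5 + e7)
  · linear_combination 4 * (e0 + e1 - e5)
  · linear_combination 4 * (-e0 + e2 - e6)
  · linear_combination 4 * (e3 - e7)
  · linear_combination 4 * (e0 + e4 - e8)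

theorem vf_injective (h2 : (2 : F) ≠ 0) {x y x' y' : F} (h : vf x y = vf x' y') :
    x = x' ∧ y = y' := by
  have h1 : vf (x - x') (y - y') + v3 0 0 0 + vm 0 0 0 0 = 0 := by
    rw [v3_zero, vm_zero, add_zero, add_zero, sub_eq_add_neg, sub_eq_add_neg, ← vf_add, h, vf_add,
      add_neg_cancel, add_neg_cancel, vf_zero]
  have h3 := eq_zero_of_coordinates h2 h1
  exact ⟨sub_eq_zero.1 h3.1.1, sub_eq_zero.1 h3.1.2⟩

theorem vm_injective {a b c d a' b' c' d' : F} (h : vm a b c d = vm a' b' c' d') :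
    a = a' ∧ b = b' ∧ c = c' ∧ d = d' :=
  ⟨congrFun h 1, congrFun h 2, congrFun h 3, congrFun h 4⟩

end Coordinates

section Parts

variable (F : Type*) [Field F]

/-- The subspace fixed by the quaternion subgroup. -/
def Ef : Submodule F (Fin 9 → F) where
  carrier := {z | ∃ x y, z = vf x y}
  add_mem' := by
    rintro _ _ ⟨x, y, rfl⟩ ⟨x', y', rfl⟩
    exact ⟨_, _, vf_add _ _ _ _⟩
  zero_mem' := ⟨0, 0, vf_zero.symm⟩
  smul_mem' := by
    rintro c _ ⟨x, y, rfl⟩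
    exact ⟨_, _, vf_smul _ _ _⟩

/-- The three-dimensional irreducible part. -/
def E3 : Submodule F (Fin 9 → F) where
  carrier := {z | ∃ x y r, z = v3 x y r}
  add_mem' := by
    rintro _ _ ⟨x, y, r, rfl⟩ ⟨x', y', r', rfl⟩
    exact ⟨_, _, _, v3_add _ _ _ _ _ _⟩
  zero_mem' := ⟨0, 0, 0, v3_zero.symm⟩
  smul_mem' := by
    rintro c _ ⟨x, y, r, rfl⟩
    exact ⟨_, _, _, v3_smul _ _ _ _⟩

/-- The subspace on which `ρ⁴` acts as `-1`. -/
def Em : Submodule F (Fin 9 → F) where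
  carrier := {z | ∃ a b c d, z = vm a b c d}
  add_mem' := by
    rintro _ _ ⟨a, b, c, d, rfl⟩ ⟨a', b', c', d', rfl⟩
    exact ⟨_, _, _, _, vm_add _ _ _ _ _ _ _ _⟩
  zero_mem' := ⟨0, 0, 0, 0, vm_zero.symm⟩
  smul_mem' := by
    rintro x _ ⟨a, b, c, d, rfl⟩
    exact ⟨_, _, _, _, vm_smul _ _ _ _ _⟩

variable {F}

theorem vf_mem_Ef (x y : F) : vf x y ∈ Ef F := ⟨x, y, rfl⟩
theorem vm_mem_Em (a b c d : F) : vm a b c d ∈ Em F := ⟨a, b, c, d, rfl⟩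

/-- By the coset representatives, $\rho$, $\sigma$ and $\omega$ generate the full automorphism
group. -/
theorem stab_eq_top {U : Submodule F (Fin 9 → F)} (h1 : rho ∈ stab U) (h2 : sigma ∈ stab U)
    (h3 : omega ∈ stab U) : stab U = ⊤ := by
  refine eq_top_iff.2 fun a _ => ?_
  obtain ⟨x, hx, h, hh, rfl⟩ := exists_coset a
  refine (stab U).mul_mem ?_ (H_le_iff.2 ⟨(stab U).pow_mem h1 2, h3⟩ hh)
  simp only [List.mem_cons, List.not_mem_nil, or_false] at hx
  rcases hx with rfl | rfl | rfl | rfl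
  · exact one_mem _
  · exact h2
  · exact h1
  · exact (stab U).mul_mem h1 h2

theorem stab_Ef (h2 : (2 : F) ≠ 0) : stab (Ef F) = ⊤ := by
  refine stab_eq_top ?_ ?_ ?_ <;> refine mem_stab_of_le ?_ <;> rintro _ ⟨x, y, rfl⟩
  · exact ⟨_, _, pullback_rho_vf _ _⟩
  · exact ⟨_, _, pullback_sigma_vf _ _⟩
  · exact ⟨_, _, pullback_omega_vf h2 _ _⟩

theorem stab_Em : stab (Em F) = ⊤ := by
  refine stab_eq_top ?_ ?_ ?_ <;> refine mem_stab_of_le ?_ <;> rintro _ ⟨a, b, c, d, rfl⟩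
  · exact ⟨_, _, _, _, pullback_rho_vm _ _ _ _⟩
  · exact ⟨_, _, _, _, pullback_sigma_vm _ _ _ _⟩
  · exact ⟨_, _, _, _, pullback_omega_vm _ _ _ _⟩

theorem act_inf (a : MK ≃g MK) (U V : Submodule F (Fin 9 → F)) :
    act a (U ⊓ V) = act a U ⊓ act a V := Submodule.comap_inf _ _ _

theorem act_sup (a : MK ≃g MK) (U V : Submodule F (Fin 9 → F)) :
    act a (U ⊔ V) = act a U ⊔ act a V := by
  refine le_antisymm ?_ (sup_le (act_mono a le_sup_left) (act_mono a le_sup_right))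
  have h1 : U ⊔ V ≤ act a⁻¹ (act a U ⊔ act a V) := by
    refine sup_le ?_ ?_
    · have h2 := act_mono a⁻¹ (le_sup_left : act a U ≤ act a U ⊔ act a V)
      rwa [act_inv_act] at h2
    · have h2 := act_mono a⁻¹ (le_sup_right : act a V ≤ act a U ⊔ act a V)
      rwa [act_inv_act] at h2
  have h2 := act_mono a h1
  rwa [act_act_inv] at h2

theorem mem_stab_inf {a : MK ≃g MK} {U V : Submodule F (Fin 9 → F)} (hU : a ∈ stab U)
    (hV : a ∈ stab V) : a ∈ stab (U ⊓ V) := by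
  rw [mem_stab] at *
  rw [act_inf, hU, hV]

theorem mem_stab_sup {a : MK ≃g MK} {U V : Submodule F (Fin 9 → F)} (hU : a ∈ stab U)
    (hV : a ∈ stab V) : a ∈ stab (U ⊔ V) := by
  rw [mem_stab] at *
  rw [act_sup, hU, hV]

theorem pullback_mem {a : MK ≃g MK} {U : Submodule F (Fin 9 → F)} (h : a ∈ stab U)
    {z : Fin 9 → F} (hz : z ∈ U) : pullback F a z ∈ U := by
  rw [← mem_stab.1 h] at hz
  exact hz

variable {U : Submodule F (Fin 9 → F)}

theorem rho_rho_mem (hU : H ≤ stab U) {z : Fin 9 → F} (hz : z ∈ U) :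
    pullback F rho (pullback F rho z) ∈ U := by
  have h1 := pullback_mem (H_le_iff.1 hU).1 hz
  rw [pow_two, pullback_mul] at h1
  exact h1

theorem omega_mem (hU : H ≤ stab U) {z : Fin 9 → F} (hz : z ∈ U) : pullback F omega z ∈ U :=
  pullback_mem (H_le_iff.1 hU).2 hz

theorem vm_I_mem (hU : H ≤ stab U) {a b c d : F} (h : vm a b c d ∈ U) : vm c d (-a) (-b) ∈ U := by
  have h1 := rho_rho_mem hU h
  rwa [pullback_rho_vm, pullback_rho_vm] at h1

theorem vm_omega_mem (hU : H ≤ stab U) {a b c d : F} (h : vm a b c d ∈ U) :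
    vm (-a + c + d) (-b - c) b (-a - b) ∈ U := by
  have h1 := omega_mem hU h
  rwa [pullback_omega_vm] at h1

/-- This is the conjugate of $\rho^2$ by $\omega$, a second quaternion generator $J$. On `Em` it
anticommutes with the action $I$ of $\rho^2$, so it interchanges the eigenspaces of $I$. -/
theorem vm_J_mem (hU : H ≤ stab U) {a b c d : F} (h : vm a b c d ∈ U) :
    vm (-a - b + d) (a - c - d) (b + c + d) (-a - b - c) ∈ U := by
  have h1 := vm_omega_mem hU (vm_omega_mem hU (vm_I_mem hU (vm_omega_mem hU h)))
  convert h1 using 2 <;> ring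

/-- Averaging over quaternion elements separates the parts. The element $\rho^4$ is $-1$ on `Em` and
$1$ elsewhere; $\rho^2$ fixes `Ef` and has signs $1,-1,-1$ on `E3`; its conjugate by $\omega$
changes the sign of the remaining coordinate of `E3`. -/
theorem mem_parts (h2 : (2 : F) ≠ 0) (hU : H ≤ stab U) {x y p q r a b c d : F}
    (h : vf x y + v3 p q r + vm a b c d ∈ U) : vf x y ∈ U ∧ v3 p q r ∈ U ∧ vm a b c d ∈ U := by
  have half : ∀ {z : Fin 9 → F}, (2 : F) • z ∈ U → z ∈ U := fun {z} hz =>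
    (U.smul_mem_iff h2).1 hz
  have h4 := rho_rho_mem hU (rho_rho_mem hU h)
  simp only [map_add, pullback_rho_vf, pullback_rho_v3, pullback_rho_vm, neg_neg] at h4
  have hm : vm a b c d ∈ U := half (by
    convert U.sub_mem h h4 using 1
    rw [show vm (-a) (-b) (-c) (-d) = (-1 : F) • vm a b c d by rw [vm_smul]; simp]
    module)
  have hw : vf x y + v3 p q r ∈ U := (U.add_mem_iff_left hm).1 h
  have hw2 := rho_rho_mem hU hw
  simp only [map_add, pullback_rho_vf, pullback_rho_v3, neg_neg] at hw2
  have hu : vf x y + v3 p 0 0 ∈ U := half (by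
    convert U.add_mem hw hw2 using 1
    rw [smul_add, vf_smul, v3_smul, add_add_add_comm, vf_add, v3_add]
    congr 2 <;> ring)
  have hJ := omega_mem hU (omega_mem hU (rho_rho_mem hU (omega_mem hU hu)))
  simp only [map_add, pullback_rho_vf, pullback_rho_v3, pullback_omega_vf h2, pullback_omega_v3,
    neg_neg, neg_zero] at hJ
  have hf : vf x y ∈ U := half (by
    convert U.add_mem hu hJ using 1
    rw [vf_smul, add_add_add_comm, vf_add, v3_add]
    conv_lhs => rw [← add_zero (vf (2 * x) (2 * y)), ← v3_zero]
    congr 2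
    · field_simp
      ring
    · field_simp
      ring
    · ring
    · ring
    · ring)
  exact ⟨hf, (U.add_mem_iff_right hf).1 hw, hm⟩

theorem eq_sup_parts (h2 : (2 : F) ≠ 0) (hU : H ≤ stab U) : U = U ⊓ Ef F ⊔ U ⊓ E3 F ⊔ U ⊓ Em F := by
  refine le_antisymm (fun z hz => ?_) (sup_le (sup_le inf_le_left inf_le_left) inf_le_left)
  obtain ⟨x, y, p, q, r, a, b, c, d, rfl⟩ := exists_coordinates h2 z
  obtain ⟨h3, h4, h5⟩ := mem_parts h2 hU hz
  exact Submodule.add_mem_sup (Submodule.add_mem_sup ⟨h3, x, y, rfl⟩ ⟨h4, p, q, r, rfl⟩)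
    ⟨h5, a, b, c, d, rfl⟩

/-- Sign changes and the cyclic action of $\omega$ show that `v3 x y z` lies in `U` iff `v3 x 0 0`,
`v3 y 0 0` and `v3 z 0 0` do. Since $\rho$ and $\sigma$ act by signed permutations of the
coordinates, they preserve this condition. -/
theorem stab_inf_E3 (h2 : (2 : F) ≠ 0) (hU : H ≤ stab U) : stab (U ⊓ E3 F) = ⊤ := by
  have half : ∀ {z : Fin 9 → F}, (2 : F) • z ∈ U → z ∈ U := fun {z} hz =>
    (U.smul_mem_iff h2).1 hz
  have cyc : ∀ {x y z : F}, v3 x y z ∈ U → v3 y (-z) (-x) ∈ U := fun {x y z} h => by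
    have h1 := omega_mem hU h
    rwa [pullback_omega_v3] at h1
  have fst : ∀ {x y z : F}, v3 x y z ∈ U → v3 x 0 0 ∈ U := fun {x y z} h => half (by
    have h1 := rho_rho_mem hU h
    rw [pullback_rho_v3, pullback_rho_v3] at h1
    convert U.add_mem h h1 using 1
    rw [v3_smul, v3_add]
    congr 1 <;> ring)
  have key : ∀ {x y z : F}, v3 x y z ∈ U → v3 x 0 0 ∈ U ∧ v3 y 0 0 ∈ U ∧ v3 z 0 0 ∈ U :=
    fun {x y z} h => ⟨fst h, fst (cyc h), by
      have h1 := U.neg_mem (fst (cyc (cyc h)))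
      rw [← neg_one_smul F, v3_smul] at h1
      simpa using h1⟩
  have back : ∀ {x y z : F}, v3 x 0 0 ∈ U → v3 y 0 0 ∈ U → v3 z 0 0 ∈ U → v3 x y z ∈ U := by
    intro x y z hx hy hz
    have hy' := cyc (cyc hy)
    have hz' := U.neg_mem (cyc hz)
    rw [← neg_one_smul F, v3_smul] at hz'
    convert U.add_mem (U.add_mem hx hy') hz' using 1
    rw [v3_add, v3_add]
    congr 1 <;> ring
  have neg : ∀ {x : F}, v3 x 0 0 ∈ U → v3 (-x) 0 0 ∈ U := fun {x} h => by
    have h1 := U.neg_mem h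
    rw [← neg_one_smul F, v3_smul] at h1
    simpa using h1
  refine stab_eq_top ?_ ?_ ?_ <;> refine mem_stab_of_le ?_ <;> rintro _ ⟨hz, x, y, z, rfl⟩ <;>
    obtain ⟨h3, h4, h5⟩ := key hz
  · rw [pullback_rho_v3]
    exact ⟨back h3 (neg h5) h4, _, _, _, rfl⟩
  · rw [pullback_sigma_v3]
    exact ⟨back h3 h5 (neg h4), _, _, _, rfl⟩
  · rw [pullback_omega_v3]
    exact ⟨back h4 (neg h5) (neg h3), _, _, _, rfl⟩

theorem rho_sigma_mem_stab_of_le_Ef {U : Submodule F (Fin 9 → F)} (hU : U ≤ Ef F) :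
    rho * sigma ∈ stab U := by
  refine mem_stab_of_le fun z hz => ?_
  obtain ⟨x, y, rfl⟩ := hU hz
  rw [pullback_mul, LinearMap.comp_apply, pullback_rho_vf, pullback_sigma_vf]
  have h1 := U.neg_mem hz
  rw [← neg_one_smul F, vf_smul] at h1
  simpa using h1

/-- The line in the fixed space with parameter `c`. -/
def fixedLine (c : F) : Submodule F (Fin 9 → F) := Submodule.span F {vf 1 c}

theorem vf_mem_fixedLine (h2 : (2 : F) ≠ 0) {c x y : F} : vf x y ∈ fixedLine c ↔ y = c * x := by
  rw [fixedLine, Submodule.mem_span_singleton]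
  constructor
  · rintro ⟨t, h⟩
    rw [vf_smul] at h
    obtain ⟨h3, h4⟩ := vf_injective h2 h
    rw [← h3, ← h4]
    ring
  · rintro rfl
    exact ⟨x, by rw [vf_smul, mul_one, mul_comm]⟩

theorem fixedLine_le (c : F) : fixedLine c ≤ Ef F :=
  (Submodule.span_singleton_le_iff_mem _ _).2 ⟨1, c, rfl⟩

/-- The quaternion group acts trivially here, and $c^2=-3$ is the condition for `vf 1 c` to be an
eigenvector of $\omega$. -/
theorem H_le_stab_fixedLine (h2 : (2 : F) ≠ 0) {c : F} (hc : c ^ 2 = -3) :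
    H ≤ stab (fixedLine c) := by
  rw [H_le_iff]
  constructor <;> refine mem_stab_of_le fun z hz => ?_ <;>
    obtain ⟨x, y, rfl⟩ := fixedLine_le c hz <;> rw [vf_mem_fixedLine h2] at hz
  · rw [pow_two, pullback_mul, LinearMap.comp_apply, pullback_rho_vf, pullback_rho_vf, neg_neg,
      vf_mem_fixedLine h2, hz]
  · rw [pullback_omega_vf h2, vf_mem_fixedLine h2, hz]
    field_simp
    linear_combination x * hc

theorem act_fixedLine (h2 : (2 : F) ≠ 0) {a : MK ≃g MK} {c c' : F}
    (h : ∀ x y : F, pullback F a (vf x y) ∈ fixedLine c ↔ vf x y ∈ fixedLine c') :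
    act a (fixedLine c) = fixedLine c' := by
  have h1 : a ∈ stab (Ef F) := stab_Ef h2 ▸ Subgroup.mem_top _
  ext z
  constructor
  · intro hz
    obtain ⟨x, y, rfl⟩ := mem_stab.1 h1 ▸ act_mono a (fixedLine_le c) hz
    exact (h x y).1 hz
  · intro hz
    obtain ⟨x, y, rfl⟩ := fixedLine_le _ hz
    exact (h x y).2 hz

theorem act_rho_fixedLine (h2 : (2 : F) ≠ 0) (c : F) : act rho (fixedLine c) = fixedLine (-c) :=
  act_fixedLine h2 fun x y => by
    rw [pullback_rho_vf, vf_mem_fixedLine h2, vf_mem_fixedLine h2, neg_eq_iff_eq_neg, neg_mul]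

theorem act_sigma_fixedLine (h2 : (2 : F) ≠ 0) (c : F) :
    act sigma (fixedLine c) = fixedLine (-c) :=
  act_fixedLine h2 fun x y => by
    rw [pullback_sigma_vf, vf_mem_fixedLine h2, vf_mem_fixedLine h2, neg_mul, mul_neg]

end Parts

end MobiusKantor

namespace MobiusKantor

/-! ### Minimal subspaces in odd characteristic -/

section Minimal

variable {F : Type*} [Field F] {U : Submodule F (Fin 9 → F)}

theorem H_le_stab_inf {V : Submodule F (Fin 9 → F)} (hU : H ≤ stab U) (hV : stab V = ⊤) :
    H ≤ stab (U ⊓ V) := fun _ ha => mem_stab_inf (hU ha) (hV ▸ Subgroup.mem_top _)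

theorem Ef_inf_Em (h2 : (2 : F) ≠ 0) : Ef F ⊓ Em F = ⊥ := by
  refine eq_bot_iff.2 ?_
  rintro _ ⟨⟨x, y, rfl⟩, a, b, c, d, h⟩
  have h1 : vf x y + v3 0 0 0 + vm (-a) (-b) (-c) (-d) = 0 := by
    rw [h, v3_zero, add_zero, vm_add]
    simp [vm_zero]
  obtain ⟨⟨rfl, rfl⟩, -⟩ := eq_zero_of_coordinates h2 h1
  exact vf_zero

theorem sup_inf_Ef (h2 : (2 : F) ≠ 0) {A C : Submodule F (Fin 9 → F)} (hA : A ≤ Ef F)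
    (hC : C ≤ Em F) : (A ⊔ C) ⊓ Ef F = A := by
  rw [sup_inf_assoc_of_le _ hA, sup_eq_left]
  refine le_trans ?_ bot_le
  rw [← Ef_inf_Em h2, inf_comm]
  exact inf_le_inf_left _ hC

theorem sup_inf_Em (h2 : (2 : F) ≠ 0) {A C : Submodule F (Fin 9 → F)} (hA : A ≤ Ef F)
    (hC : C ≤ Em F) : (A ⊔ C) ⊓ Em F = C := by
  rw [sup_comm, sup_inf_assoc_of_le _ hC, sup_eq_left]
  refine le_trans ?_ bot_le
  rw [← Ef_inf_Em h2]
  exact inf_le_inf_right _ hA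

theorem stab_sup_inf {A C : Submodule F (Fin 9 → F)} (h2 : (2 : F) ≠ 0) (hA : A ≤ Ef F)
    (hC : C ≤ Em F) {a : MK ≃g MK} : a ∈ stab (A ⊔ C) ↔ a ∈ stab A ∧ a ∈ stab C := by
  refine ⟨fun h => ⟨?_, ?_⟩, fun h => mem_stab_sup h.1 h.2⟩
  · have h1 := mem_stab_inf h ((stab_Ef h2).symm ▸ Subgroup.mem_top a : a ∈ stab (Ef F))
    rwa [sup_inf_Ef h2 hA hC] at h1
  · have h1 := mem_stab_inf h ((stab_Em (F := F)).symm ▸ Subgroup.mem_top a : a ∈ stab (Em F))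
    rwa [sup_inf_Em h2 hA hC] at h1

/-- The `E3` part is stable under everything and the `Ef` part under $\rho\sigma$, so $\rho\sigma$
must fail in `Em`. If the `Em` part does not suffice, it is $\rho$-stable, and then only the `Ef`
part can break $\rho$. -/
theorem IsSemi.parts (h2 : (2 : F) ≠ 0) (hU : IsSemi U) : IsSemi (U ⊓ Em F) ∨
    rho ∈ stab (U ⊓ Em F) ∧ rho * sigma ∉ stab (U ⊓ Em F) ∧ rho ∉ stab (U ⊓ Ef F) := by
  by_cases hC : IsSemi (U ⊓ Em F)
  · exact Or.inl hC
  right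
  have key : ∀ {a}, a ∈ stab (U ⊓ Ef F) → a ∈ stab (U ⊓ Em F) → a ∈ stab U := by
    intro a h h'
    rw [eq_sup_parts h2 hU.1]
    exact mem_stab_sup (mem_stab_sup h (stab_inf_E3 h2 hU.1 ▸ Subgroup.mem_top a)) h'
  have h3 : rho * sigma ∉ stab (U ⊓ Em F) := fun h =>
    hU.2.2 (key (rho_sigma_mem_stab_of_le_Ef inf_le_right) h)
  have h4 : rho ∈ stab (U ⊓ Em F) := by
    by_contra h
    exact hC ⟨H_le_stab_inf hU.1 stab_Em, h, h3⟩
  exact ⟨h4, h3, fun h => hU.2.1 (key h h4)⟩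

/-- A subspace of the fixed space that is stable under `H`, but not under `ρ`, is a line. -/
theorem exists_eq_fixedLine (h2 : (2 : F) ≠ 0) {A : Submodule F (Fin 9 → F)} (hA : A ≤ Ef F)
    (hH : H ≤ stab A) (hr : rho ∉ stab A) : ∃ c : F, c ^ 2 = -3 ∧ c ≠ 0 ∧ A = fixedLine c := by
  -- Up to the factor 2 this form is the determinant of `vf x y` and its image under $\omega$. If it
  -- is nonzero the two span `Ef`, which is $\rho$-stable.
  have key : ∀ x y : F, vf x y ∈ A → 3 * x ^ 2 + y ^ 2 = 0 := by
    intro x y h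
    by_contra hd
    have h1 := omega_mem hH h
    rw [pullback_omega_vf h2] at h1
    have hE : A = Ef F := by
      refine le_antisymm hA ?_
      rintro _ ⟨s, t, rfl⟩
      have h3 := A.add_mem (A.smul_mem ((s * (3 * x - y) + t * (x + y)) / (3 * x ^ 2 + y ^ 2)) h)
        (A.smul_mem (2 * (x * t - y * s) / (3 * x ^ 2 + y ^ 2)) h1)
      rw [vf_smul, vf_smul, vf_add] at h3
      convert h3 using 2 <;> field_simp <;> ring
    exact hr (by rw [hE, stab_Ef h2]; trivial)
  -- Otherwise $\rho$, which only changes the sign of `y`, would fix `A` pointwise.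
  have hex : ∃ x y : F, vf x y ∈ A ∧ y ≠ 0 := by
    by_contra! hcon
    refine hr (mem_stab_of_le fun z hz => ?_)
    obtain ⟨x, y, rfl⟩ := hA hz
    rw [pullback_rho_vf, hcon x y hz, neg_zero]
    rwa [hcon x y hz] at hz
  obtain ⟨x, y, h, hy⟩ := hex
  have hx : x ≠ 0 := by
    rintro rfl
    have h1 := key _ _ h
    simp [hy] at h1
  have hc : (y / x) ^ 2 = -3 := by
    field_simp
    linear_combination key _ _ h
  have h1 : vf 1 (y / x) ∈ A := by
    have h3 := A.smul_mem x⁻¹ h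
    rw [vf_smul, inv_mul_cancel₀ hx] at h3
    rwa [div_eq_inv_mul]
  refine ⟨y / x, hc, div_ne_zero hy hx, le_antisymm (fun z hz => ?_)
    ((Submodule.span_singleton_le_iff_mem _ _).2 h1)⟩
  obtain ⟨s, t, rfl⟩ := hA hz
  rw [vf_mem_fixedLine h2]
  -- The difference has first coordinate zero, so the quadratic condition reduces to the square of
  -- its second coordinate.
  have h3 := A.sub_mem hz (A.smul_mem s h1)
  rw [vf_smul, sub_eq_add_neg, ← neg_one_smul F, vf_smul, vf_add] at h3
  have h4 := key _ _ h3
  have h5 : (t - y / x * s) ^ 2 = 0 := by linear_combination h4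
  exact sub_eq_zero.1 (pow_eq_zero_iff two_ne_zero |>.1 h5)

theorem fixedLine_ne_bot (h2 : (2 : F) ≠ 0) (c : F) : fixedLine c ≠ ⊥ := by
  intro h
  rw [fixedLine, Submodule.span_singleton_eq_bot, ← vf_zero] at h
  exact one_ne_zero (vf_injective h2 h).1

theorem fixedLine_injective (h2 : (2 : F) ≠ 0) {c c' : F} (h : fixedLine c = fixedLine c') :
    c = c' := by
  have h1 : vf 1 c ∈ fixedLine c' := h ▸ Submodule.mem_span_singleton_self _
  rw [vf_mem_fixedLine h2] at h1
  rw [h1, mul_one]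

theorem not_mem_stab_fixedLine (h2 : (2 : F) ≠ 0) {c : F} (hc : c ≠ 0) :
    rho ∉ stab (fixedLine c) ∧ sigma ∉ stab (fixedLine c) := by
  rw [mem_stab, mem_stab, act_rho_fixedLine h2, act_sigma_fixedLine h2, and_self]
  intro h
  have h1 := fixedLine_injective h2 h
  exact mul_ne_zero h2 hc (by linear_combination -h1)

/-- Proper nonzero `H`-stable subspaces of the part on which `ρ⁴` acts as `-1`. -/
structure IsLine (C : Submodule F (Fin 9 → F)) : Prop where
  le : C ≤ Em F
  stable : H ≤ stab C
  ne_bot : C ≠ ⊥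
  ne_top : C ≠ Em F

/-- By minimality `U` equals whichever of `U ⊓ Em F` and `U ⊓ Ef F ⊔ U ⊓ Em F` already has an edge-
but not vertex-transitive stabiliser. -/
theorem IsMinSemi.classify (h2 : (2 : F) ≠ 0) (hU : IsMinSemi U) : IsLine U ∨
    ∃ (c : F) (C : Submodule F (Fin 9 → F)), c ^ 2 = -3 ∧ c ≠ 0 ∧ IsLine C ∧ rho ∈ stab C ∧
      rho * sigma ∉ stab C ∧ U = fixedLine c ⊔ C := by
  have min : ∀ U' ≤ U, IsSemi U' → U' = U := fun U' h h' => by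
    by_contra hne
    exact hU.2 U' (lt_of_le_of_ne h hne) h'
  rcases hU.1.parts h2 with h | ⟨h3, h4, h5⟩
  · left
    have h6 := min _ inf_le_left h
    refine ⟨inf_eq_left.1 h6, hU.1.1, ?_, ?_⟩
    · rintro rfl
      exact not_isSemi_bot hU.1
    · rintro rfl
      exact hU.1.2.1 ((stab_Em (F := F)).symm ▸ Subgroup.mem_top _)
  · right
    have hA := H_le_stab_inf hU.1.1 (stab_Ef h2)
    have hC : H ≤ stab (U ⊓ Em F) := H_le_stab_inf hU.1.1 stab_Em
    obtain ⟨c, hc, hc0, e⟩ := exists_eq_fixedLine h2 inf_le_right hA h5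
    have h6 : IsSemi (U ⊓ Ef F ⊔ U ⊓ Em F) := by
      refine ⟨fun a ha => mem_stab_sup (hA ha) (hC ha), fun h => h5 ?_, fun h => h4 ?_⟩
      · exact ((stab_sup_inf h2 inf_le_right inf_le_right).1 h).1
      · exact ((stab_sup_inf h2 inf_le_right inf_le_right).1 h).2
    refine ⟨c, U ⊓ Em F, hc, hc0, ⟨inf_le_right, hC, ?_, ?_⟩, h3, h4, ?_⟩
    · intro h
      rw [h] at h4
      exact h4 (act_bot _)
    · intro h
      rw [h] at h4
      exact h4 ((stab_Em (F := F)).symm ▸ Subgroup.mem_top _)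
    · rw [← e, min _ (sup_le inf_le_left inf_le_left) h6]

/-- The lines are pairwise incomparable. -/
def LinesIncomparable (F : Type*) [Field F] : Prop :=
  ∀ C C' : Submodule F (Fin 9 → F), IsLine C → IsLine C' → C ≤ C' → C = C'

theorem IsLine.eq_of_le (hF : LinesIncomparable F) {C : Submodule F (Fin 9 → F)} (hC : IsLine C)
    {U' : Submodule F (Fin 9 → F)} (h : U' ≤ C) (hb : U' ≠ ⊥) (hs : H ≤ stab U') : U' = C := by
  refine hF _ _ ⟨h.trans hC.le, hs, hb, ?_⟩ hC h
  rintro rfl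
  exact hC.ne_top (le_antisymm hC.le h)

theorem IsLine.isMinEdge (hF : LinesIncomparable F) {C : Submodule F (Fin 9 → F)}
    (hC : IsLine C) : IsMinEdge C :=
  ⟨hC.stable, fun _ h hb hs => h.ne (hC.eq_of_le hF h.le hb hs)⟩

theorem IsLine.isMinSemi (hF : LinesIncomparable F) {C : Submodule F (Fin 9 → F)}
    (hC : IsLine C) (h1 : rho ∉ stab C) (h2 : rho * sigma ∉ stab C) : IsMinSemi C := by
  refine ⟨⟨hC.stable, h1, h2⟩, fun U' h hs => h.ne (hC.eq_of_le hF h.le ?_ hs.1)⟩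
  rintro rfl
  exact not_isSemi_bot hs

variable {c : F} {C : Submodule F (Fin 9 → F)}

theorem IsLine.isSemi_sup (h2 : (2 : F) ≠ 0) (hc : c ^ 2 = -3) (hc0 : c ≠ 0) (hC : IsLine C)
    (hrs : rho * sigma ∉ stab C) : IsSemi (fixedLine c ⊔ C) := by
  refine ⟨fun a ha => mem_stab_sup (H_le_stab_fixedLine h2 hc ha) (hC.stable ha), fun h => ?_,
    fun h => hrs ?_⟩
  · exact (not_mem_stab_fixedLine h2 hc0).1 ((stab_sup_inf h2 (fixedLine_le c) hC.le).1 h).1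
  · exact ((stab_sup_inf h2 (fixedLine_le c) hC.le).1 h).2

/-- A smaller subspace with the same property would again have one of two forms. The first would
make $C$ itself break $\rho$; the second recovers both $C$ and the fixed line, hence the whole sum.
-/
theorem IsLine.isMinSemi_sup (h2 : (2 : F) ≠ 0) (hF : LinesIncomparable F) (hc : c ^ 2 = -3)
    (hc0 : c ≠ 0) (hC : IsLine C) (hr : rho ∈ stab C) (hrs : rho * sigma ∉ stab C) :
    IsMinSemi (fixedLine c ⊔ C) := by
  refine ⟨hC.isSemi_sup h2 hc hc0 hrs, fun U' h hs => ?_⟩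
  have hA' : U' ⊓ Ef F ≤ fixedLine c := by
    rw [← sup_inf_Ef h2 (fixedLine_le c) hC.le]
    exact inf_le_inf_right _ h.le
  have hC' : U' ⊓ Em F ≤ C := by
    conv_rhs => rw [← sup_inf_Em h2 (fixedLine_le c) hC.le]
    exact inf_le_inf_right _ h.le
  have hst : H ≤ stab (U' ⊓ Em F) := H_le_stab_inf hs.1 stab_Em
  rcases hs.parts h2 with h3 | ⟨h3, h4, h5⟩
  · refine h3.2.1 ?_
    rwa [hC.eq_of_le hF hC' (fun hb => not_isSemi_bot (hb ▸ h3)) hst]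
  · have h6 : U' ⊓ Em F = C := hC.eq_of_le hF hC' (fun hb => h4 (by rw [hb]; exact act_bot _)) hst
    have h7 : fixedLine c ≤ U' := by
      obtain ⟨c', -, -, e⟩ := exists_eq_fixedLine h2 inf_le_right
        (H_le_stab_inf hs.1 (stab_Ef h2)) h5
      have h8 : vf 1 c' ∈ fixedLine c := hA' (e ▸ Submodule.mem_span_singleton_self _)
      rw [vf_mem_fixedLine h2, mul_one] at h8
      rw [← h8, ← e]
      exact inf_le_left
    exact h.not_ge (sup_le h7 (h6 ▸ inf_le_left))

theorem IsLine.not_isMinEdge_sup (h2 : (2 : F) ≠ 0) (hC : IsLine C) :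
    ¬ IsMinEdge (fixedLine c ⊔ C) := by
  intro h
  refine h.2 C (lt_of_le_of_ne le_sup_right fun e => ?_) hC.ne_bot hC.stable
  have h1 := sup_inf_Ef h2 (fixedLine_le c) hC.le
  rw [← e] at h1
  refine fixedLine_ne_bot h2 c (h1 ▸ ?_)
  rw [eq_bot_iff, ← Ef_inf_Em h2, inf_comm]
  exact inf_le_inf_left _ hC.le

theorem fixedLine_sup_injective (h2 : (2 : F) ≠ 0) {c' : F} {C' : Submodule F (Fin 9 → F)}
    (hC : C ≤ Em F) (hC' : C' ≤ Em F) (h : fixedLine c ⊔ C = fixedLine c' ⊔ C') :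
    c = c' ∧ C = C' := by
  constructor
  · apply fixedLine_injective h2
    rw [← sup_inf_Ef h2 (fixedLine_le c) hC, h, sup_inf_Ef h2 (fixedLine_le c') hC']
  · rw [← sup_inf_Em h2 (fixedLine_le c) hC, h, sup_inf_Em h2 (fixedLine_le c') hC']

theorem fixedLine_sup_not_le (h2 : (2 : F) ≠ 0) : ¬ fixedLine c ⊔ C ≤ Em F := by
  intro h
  refine fixedLine_ne_bot h2 c ?_
  rw [eq_bot_iff, ← Ef_inf_Em h2]
  exact le_inf (fixedLine_le c) (le_sup_left.trans h)

theorem IsLine.act {C : Submodule F (Fin 9 → F)} (hC : IsLine C) (a : MK ≃g MK) :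
    IsLine (act a C) := by
  have hs := H_le_stab_act hC.stable a
  have h1 : MobiusKantor.act a (Em F) = Em F :=
    mem_stab.1 ((stab_Em (F := F)).symm ▸ Subgroup.mem_top a)
  refine ⟨?_, hs, fun h => hC.ne_bot ?_, fun h => hC.ne_top ?_⟩
  · rw [← h1]
    exact act_mono a hC.le
  · rw [← act_bot a] at h
    exact act_injective a h
  · rw [← h1] at h
    exact act_injective a h

end Minimal

end MobiusKantor

namespace MobiusKantor

/-! ### Lines when `-1` is a square -/

section SquareRoot

variable {F : Type*} [Field F]

/-- The line of eigenvectors `x, y` of `ρ²` with eigenvalue `i`, together with its image under a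
quaternion element. -/
def LS (i x y : F) : Submodule F (Fin 9 → F) where
  -- Twice the $\pm i$-components of `vm a b c d` under $\rho^2$ have first coordinates `(a ∓ i * c,
  -- b ∓ i * d)`. The first must be parallel to `(x, y)`, the second to the image of `(x, y)` under
  -- $J$.
  carrier := {z | ∃ a b c d, z = vm a b c d ∧ (a - i * c) * y = (b - i * d) * x ∧
    (a + i * c) * (x + y + x * i) + (b + i * d) * (y + (x + y) * i) = 0}
  add_mem' := by
    rintro _ _ ⟨a, b, c, d, rfl, h1, h2⟩ ⟨a', b', c', d', rfl, h1', h2'⟩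
    refine ⟨_, _, _, _, vm_add _ _ _ _ _ _ _ _, ?_, ?_⟩
    · linear_combination h1 + h1'
    · linear_combination h2 + h2'
  zero_mem' := ⟨0, 0, 0, 0, vm_zero.symm, by ring, by ring⟩
  smul_mem' := by
    rintro t _ ⟨a, b, c, d, rfl, h1, h2⟩
    refine ⟨_, _, _, _, vm_smul _ _ _ _ _, ?_, ?_⟩
    · linear_combination t * h1
    · linear_combination t * h2

variable {i x y x' y' : F}

theorem vm_mem_LS {a b c d : F} : vm a b c d ∈ LS i x y ↔ (a - i * c) * y = (b - i * d) * x ∧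
    (a + i * c) * (x + y + x * i) + (b + i * d) * (y + (x + y) * i) = 0 := by
  constructor
  · rintro ⟨a', b', c', d', h, h1⟩
    obtain ⟨rfl, rfl, rfl, rfl⟩ := vm_injective h
    exact h1
  · exact fun h => ⟨a, b, c, d, rfl, h⟩

theorem LS_le (i x y : F) : LS i x y ≤ Em F := by
  rintro _ ⟨a, b, c, d, rfl, -⟩
  exact ⟨a, b, c, d, rfl⟩

theorem vm_fst_mem_LS (hi : i ^ 2 = -1) (x y : F) : vm x y (x * i) (y * i) ∈ LS i x y := by
  rw [vm_mem_LS]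
  constructor
  · ring
  · linear_combination (x * (x + y + x * i) + y * (y + (x + y) * i)) * hi

theorem vm_snd_mem_LS (hi : i ^ 2 = -1) (x y : F) :
    vm (y + (x + y) * i) (-y - x - x * i) (y + x - y * i) (-x + (x + y) * i) ∈ LS i x y := by
  rw [vm_mem_LS]
  constructor
  · grind
  · grind

theorem H_le_stab_LS (h2 : (2 : F) ≠ 0) (hi : i ^ 2 = -1) (x y : F) : H ≤ stab (LS i x y) := by
  rw [H_le_iff]
  constructor <;> refine mem_stab_of_le ?_ <;> rintro _ ⟨a, b, c, d, rfl, h1, h3⟩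
  · rw [pow_two, pullback_mul, LinearMap.comp_apply, pullback_rho_vm, pullback_rho_vm, vm_mem_LS]
    constructor
    · grind
    · grind
  · rw [pullback_omega_vm, vm_mem_LS]
    constructor <;> apply mul_left_cancel₀ h2 <;> grind

theorem exists_smul_of_det_eq_zero {a b : F} (h : x ≠ 0 ∨ y ≠ 0) (hd : a * y = b * x) :
    ∃ t, a = t * x ∧ b = t * y := by
  rcases h with h | h
  · exact ⟨a / x, by field_simp, by field_simp; exact hd.symm⟩
  · exact ⟨b / y, by field_simp; exact hd, by field_simp⟩

theorem snd_ne_zero (hi : i ^ 2 = -1) (h : x ≠ 0 ∨ y ≠ 0) :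
    y + (x + y) * i ≠ 0 ∨ -y - x - x * i ≠ 0 := by
  by_contra! hcon
  obtain ⟨h1, h3⟩ := hcon
  have hi0 : i ≠ 0 := by
    rintro rfl
    simp at hi
  have hy : y = 0 := by grind
  have hx : x = 0 := by
    subst hy
    have h4 : x * i = 0 := by linear_combination h1
    exact (mul_eq_zero.1 h4).resolve_right hi0
  simp [hx, hy] at h

theorem LS_eq_span (h2 : (2 : F) ≠ 0) (hi : i ^ 2 = -1) (h : x ≠ 0 ∨ y ≠ 0) :
    LS i x y = Submodule.span F {vm x y (x * i) (y * i),
      vm (y + (x + y) * i) (-y - x - x * i) (y + x - y * i) (-x + (x + y) * i)} := by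
  apply le_antisymm
  · rintro _ ⟨a, b, c, d, rfl, h1, h3⟩
    obtain ⟨s, hs, hs'⟩ := exists_smul_of_det_eq_zero (a := (a - i * c) / 2)
      (b := (b - i * d) / 2) h (by linear_combination h1 / 2)
    obtain ⟨t, ht, ht'⟩ := exists_smul_of_det_eq_zero (a := (a + i * c) / 2)
      (b := (b + i * d) / 2) (snd_ne_zero hi h) (by linear_combination -h3 / 2)
    rw [Submodule.mem_span_pair]
    refine ⟨s, t, ?_⟩
    rw [vm_smul, vm_smul, vm_add]
    field_simp at hs hs' ht ht'
    congr 1 <;> apply mul_left_cancel₀ h2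
    · linear_combination -hs - ht
    · linear_combination -hs' - ht'
    · grind
    · grind
  · rw [Submodule.span_le]
    rintro _ (rfl | rfl)
    · exact vm_fst_mem_LS hi x y
    · exact vm_snd_mem_LS hi x y

theorem isLine_LS (h2 : (2 : F) ≠ 0) (hi : i ^ 2 = -1) (h : x ≠ 0 ∨ y ≠ 0) : IsLine (LS i x y) := by
  refine ⟨LS_le i x y, H_le_stab_LS h2 hi x y, fun hb => ?_, fun ht => ?_⟩
  · have h1 := vm_fst_mem_LS hi x y
    rw [hb, Submodule.mem_bot, ← vm_zero] at h1
    obtain ⟨hx, hy, -⟩ := vm_injective h1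
    simp [hx, hy] at h
  · have h1 : vm 1 0 0 0 ∈ LS i x y := ht ▸ vm_mem_Em _ _ _ _
    have h3 : vm 0 1 0 0 ∈ LS i x y := ht ▸ vm_mem_Em _ _ _ _
    have h4 := (vm_mem_LS.1 h1).1
    have h5 := (vm_mem_LS.1 h3).1
    simp at h4 h5
    simp [h4, ← h5] at h

/-- A line is determined by an eigenvector of `ρ²` in it. -/
theorem IsLine.eq_LS (h2 : (2 : F) ≠ 0) (hi : i ^ 2 = -1) (h : x ≠ 0 ∨ y ≠ 0)
    {C : Submodule F (Fin 9 → F)} (hC : IsLine C) (hm : vm x y (x * i) (y * i) ∈ C) :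
    C = LS i x y := by
  have hle : LS i x y ≤ C := by
    rw [LS_eq_span h2 hi h, Submodule.span_le]
    rintro _ (rfl | rfl)
    · exact hm
    -- The second spanning vector is $-i$ times the image of the first under $J$.
    · have h1 := C.smul_mem (-i) (vm_J_mem hC.stable hm)
      rw [vm_smul] at h1
      rw [SetLike.mem_coe]
      convert h1 using 2 <;> grind
  refine (le_antisymm hle ?_).symm
  -- A second independent $i$-eigenvector would give the whole $i$-eigenspace; $J$ carries it onto
  -- the other one, and `C` would be all of `Em`.
  have eig : ∀ {a b c d}, vm a b c d ∈ C → c = a * i → d = b * i → a * y = b * x := by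
    rintro a b _ _ hab rfl rfl
    by_contra hne
    obtain ⟨e, he⟩ : ∃ e, e * (a * y - b * x) = 1 := ⟨_, inv_mul_cancel₀ (sub_ne_zero.2 hne)⟩
    have all : ∀ s t, vm s t (s * i) (t * i) ∈ C := by
      intro s t
      have h1 := C.add_mem (C.smul_mem (e * (s * y - t * x)) hab)
        (C.smul_mem (e * (a * t - b * s)) hm)
      rw [vm_smul, vm_smul, vm_add] at h1
      convert h1 using 2 <;> grind
    have all' : ∀ s t, vm s t (-(s * i)) (-(t * i)) ∈ C := by
      intro s t
      have h1 := C.smul_mem (-i)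
        -- These coordinates invert $J$ between the eigenspaces, up to the factor $-i$ applied
        -- outside.
        (vm_J_mem hC.stable (all (i * s - (1 - i) * t) ((1 - i) * s + t)))
      rw [vm_smul] at h1
      convert h1 using 2 <;> grind
    refine hC.ne_top (le_antisymm hC.le ?_)
    rintro _ ⟨a, b, c, d, rfl⟩
    have h1 := C.add_mem (all (a - i * c) (b - i * d)) (all' (a + i * c) (b + i * d))
    rw [vm_add] at h1
    rw [← C.smul_mem_iff h2, vm_smul]
    convert h1 using 2 <;> grind
  intro z hz
  obtain ⟨a, b, c, d, rfl⟩ := hC.le hz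
  -- Subtracting or adding $i$ times the image under $\rho^2$ gives twice the $i$- or
  -- $(-i)$-component. The latter is moved by $J$ into the $i$-eigenspace, where `eig` applies.
  have hI := C.smul_mem i (vm_I_mem hC.stable hz)
  rw [vm_smul] at hI
  have h3 := C.sub_mem hz hI
  rw [sub_eq_add_neg, ← neg_one_smul F, vm_smul, vm_add] at h3
  have h4 := C.add_mem hz hI
  rw [vm_add] at h4
  have h5 := eig h3 (by grind) (by grind)
  have h6 := eig (vm_J_mem hC.stable h4) (by grind) (by grind)
  rw [vm_mem_LS]
  constructor <;> grind

/-- A line without an $i$-eigenvector would have no $(-i)$-eigenvector either, since $J$ exchanges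
the eigenspaces, and would be zero. -/
theorem IsLine.exists_eq_LS (h2 : (2 : F) ≠ 0) (hi : i ^ 2 = -1) {C : Submodule F (Fin 9 → F)}
    (hC : IsLine C) : ∃ x y, (x ≠ 0 ∨ y ≠ 0) ∧ C = LS i x y := by
  by_contra! hcon
  have eig : ∀ {a b c d}, vm a b c d ∈ C → c = a * i → d = b * i → a = 0 ∧ b = 0 := by
    rintro a b _ _ hab rfl rfl
    by_contra hne
    have h0 : a ≠ 0 ∨ b ≠ 0 := not_and_or.1 hne
    exact hcon a b h0 (hC.eq_LS h2 hi h0 hab)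
  refine hC.ne_bot (eq_bot_iff.2 fun z hz => ?_)
  obtain ⟨a, b, c, d, rfl⟩ := hC.le hz
  have hI := C.smul_mem i (vm_I_mem hC.stable hz)
  rw [vm_smul] at hI
  have h3 := C.sub_mem hz hI
  rw [sub_eq_add_neg, ← neg_one_smul F, vm_smul, vm_add] at h3
  have h4 := C.add_mem hz hI
  rw [vm_add] at h4
  obtain ⟨h5, h5'⟩ := eig h3 (by grind) (by grind)
  obtain ⟨h6, h6'⟩ := eig (vm_J_mem hC.stable h4) (by grind) (by grind)
  have ha : a = 0 := by
    apply mul_left_cancel₀ h2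
    grind
  have hb : b = 0 := by
    apply mul_left_cancel₀ h2
    grind
  have hc : c = 0 := by
    apply mul_left_cancel₀ h2
    grind
  have hd : d = 0 := by
    apply mul_left_cancel₀ h2
    grind
  rw [ha, hb, hc, hd, vm_zero]
  exact Submodule.zero_mem _

theorem LS_eq_iff (h2 : (2 : F) ≠ 0) (hi : i ^ 2 = -1) (h : x ≠ 0 ∨ y ≠ 0)
    (h' : x' ≠ 0 ∨ y' ≠ 0) : LS i x y = LS i x' y' ↔ x * y' = y * x' := by
  constructor
  · intro e
    have h1 := e ▸ vm_fst_mem_LS hi x y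
    apply mul_left_cancel₀ h2
    grind [vm_mem_LS]
  · intro e
    refine (isLine_LS h2 hi h).eq_LS h2 hi h' ?_
    obtain ⟨t, rfl, rfl⟩ := exists_smul_of_det_eq_zero h
      (show x' * y = y' * x by rw [mul_comm x', ← e, mul_comm])
    have h1 := (LS i x y).smul_mem t (vm_fst_mem_LS hi x y)
    rw [vm_smul] at h1
    convert h1 using 2 <;> ring

theorem linesIncomparable_of_sq (h2 : (2 : F) ≠ 0) (hi : i ^ 2 = -1) : LinesIncomparable F := by
  intro C C' hC hC' hle
  obtain ⟨x, y, h, rfl⟩ := hC.exists_eq_LS h2 hi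
  exact (hC'.eq_LS h2 hi h (hle (vm_fst_mem_LS hi x y))).symm

/-- The image of a line is a line, so it is identified as soon as one $i$-eigenvector is found in
it. The formula for $\sigma$ is obtained in the same way. -/
theorem act_rho_LS (h2 : (2 : F) ≠ 0) (hi : i ^ 2 = -1) (h : x ≠ 0 ∨ y ≠ 0) :
    act rho (LS i x y) = LS i (-i * y) x := by
  have hi0 : i ≠ 0 := by
    rintro rfl
    simp at hi
  refine ((isLine_LS h2 hi h).act rho).eq_LS h2 hi ?_ ?_
  · rcases h with h | h
    · exact Or.inr h
    · exact Or.inl (mul_ne_zero (neg_ne_zero.2 hi0) h)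
  · rw [mem_act, pullback_rho_vm, vm_mem_LS]
    constructor <;> grind

theorem act_sigma_LS (h2 : (2 : F) ≠ 0) (hi : i ^ 2 = -1) (h : x ≠ 0 ∨ y ≠ 0) :
    act sigma (LS i x y) = LS i ((i - 1) * x + i * y) (x - (i - 1) * y) := by
  have hi0 : i ≠ 0 := by
    rintro rfl
    simp at hi
  refine ((isLine_LS h2 hi h).act sigma).eq_LS h2 hi ?_ ?_
  · by_contra! hcon
    obtain ⟨h3, h4⟩ := hcon
    have hy : y = 0 := by grind
    have hx : x = 0 := by grind
    simp [hx, hy] at h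
  · rw [mem_act, pullback_sigma_vm, vm_mem_LS]
    constructor <;> grind

end SquareRoot

end MobiusKantor

namespace MobiusKantor

section SquareRootStabilizers

variable {F : Type*} [Field F] {i x y : F}

theorem act_rho_sigma_LS (h2 : (2 : F) ≠ 0) (hi : i ^ 2 = -1) (h : x ≠ 0 ∨ y ≠ 0) :
    act (rho * sigma) (LS i x y) = LS i (-i * (x - (i - 1) * y)) ((i - 1) * x + i * y) := by
  rw [act_mul, act_sigma_LS h2 hi h, act_rho_LS h2 hi]
  by_contra! hcon
  obtain ⟨h3, h4⟩ := hcon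
  have hy : y = 0 := by grind
  have hx : x = 0 := by grind
  simp [hx, hy] at h

theorem rho_mem_stab_LS (h2 : (2 : F) ≠ 0) (hi : i ^ 2 = -1) (h : x ≠ 0 ∨ y ≠ 0) :
    rho ∈ stab (LS i x y) ↔ x ^ 2 = -i * y ^ 2 := by
  rw [mem_stab, act_rho_LS h2 hi h, LS_eq_iff h2 hi _ h]
  · constructor <;> intro h3 <;> grind
  · by_contra! hcon
    grind

theorem sigma_mem_stab_LS (h2 : (2 : F) ≠ 0) (hi : i ^ 2 = -1) (h : x ≠ 0 ∨ y ≠ 0) :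
    sigma ∈ stab (LS i x y) ↔ (x + (1 - i) * y) ^ 2 = -i * y ^ 2 := by
  rw [mem_stab, act_sigma_LS h2 hi h, LS_eq_iff h2 hi _ h]
  · constructor <;> intro h3 <;> grind
  · by_contra! hcon
    grind

theorem rho_sigma_mem_stab_LS (h2 : (2 : F) ≠ 0) (hi : i ^ 2 = -1) (h : x ≠ 0 ∨ y ≠ 0) :
    rho * sigma ∈ stab (LS i x y) ↔ (x + y) * (x - i * y) = 0 := by
  rw [mem_stab, act_rho_sigma_LS h2 hi h, LS_eq_iff h2 hi _ h]
  · constructor <;> intro h3 <;> grind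
  · by_contra! hcon
    grind

end SquareRootStabilizers

/-! ### Lines as points of the projective line, with the fractional linear action -/

section Projective

variable {F : Type} [Field F] {i : F}

/-- The lines, parametrised by the projective line. -/
def lineS (i : F) (s : OnePoint F) : Submodule F (Fin 9 → F) :=
  s.elim (LS i 1 0) fun t => LS i t 1

theorem lineS_coe (i t : F) : lineS i (t : OnePoint F) = LS i t 1 := rfl

theorem lineS_infty (i : F) : lineS i OnePoint.infty = LS i 1 0 := rfl

theorem isLine_lineS (h2 : (2 : F) ≠ 0) (hi : i ^ 2 = -1) (s : OnePoint F) :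
    IsLine (lineS i s) := by
  induction s using OnePoint.rec with
  | infty => exact isLine_LS h2 hi (Or.inl one_ne_zero)
  | coe t => exact isLine_LS h2 hi (Or.inr one_ne_zero)

theorem lineS_injective (h2 : (2 : F) ≠ 0) (hi : i ^ 2 = -1) : Function.Injective (lineS i) := by
  intro s t h
  induction s using OnePoint.rec with
  | infty =>
    induction t using OnePoint.rec with
    | infty => rfl
    | coe t =>
      rw [lineS_infty, lineS_coe, LS_eq_iff h2 hi (Or.inl one_ne_zero) (Or.inr one_ne_zero)] at h
      simp at h
  | coe s =>
    induction t using OnePoint.rec with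
    | infty =>
      rw [lineS_infty, lineS_coe, LS_eq_iff h2 hi (Or.inr one_ne_zero) (Or.inl one_ne_zero)] at h
      simp at h
    | coe t =>
      rw [lineS_coe, lineS_coe, LS_eq_iff h2 hi (Or.inr one_ne_zero) (Or.inr one_ne_zero)] at h
      simpa using h

theorem LS_eq_lineS_div (h2 : (2 : F) ≠ 0) (hi : i ^ 2 = -1) (x : F) {y : F} (hy : y ≠ 0) :
    LS i x y = lineS i ((x / y : F) : OnePoint F) := by
  rw [lineS_coe, LS_eq_iff h2 hi (Or.inr hy) (Or.inr one_ne_zero)]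
  field_simp

theorem LS_eq_lineS_infty (h2 : (2 : F) ≠ 0) (hi : i ^ 2 = -1) {x : F} (hx : x ≠ 0) :
    LS i x 0 = lineS i OnePoint.infty := by
  rw [lineS_infty, LS_eq_iff h2 hi (Or.inl hx) (Or.inl one_ne_zero)]
  simp

theorem IsLine.exists_eq_lineS (h2 : (2 : F) ≠ 0) (hi : i ^ 2 = -1)
    {C : Submodule F (Fin 9 → F)} (hC : IsLine C) : ∃ s, C = lineS i s := by
  obtain ⟨x, y, h, rfl⟩ := hC.exists_eq_LS h2 hi
  by_cases hy : y = 0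
  · subst hy
    exact ⟨_, LS_eq_lineS_infty h2 hi (by simpa using h)⟩
  · exact ⟨_, LS_eq_lineS_div h2 hi x hy⟩

/-- In homogeneous coordinates the map is linear; a nonzero determinant prevents numerator and
denominator from vanishing together, which settles the cases involving infinity. -/
theorem lineS_moebius (h2 : (2 : F) ≠ 0) (hi : i ^ 2 = -1) {a b c d : F}
    (hdet : a * d - b * c ≠ 0) (s : OnePoint F) : lineS i (moebius a b c d s) =
      s.elim (LS i a c) fun t => LS i (a * t + b) (c * t + d) := by
  classical
  induction s using OnePoint.rec with
  | infty =>
    change lineS i (if c = 0 then _ else _) = LS i a c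
    split_ifs with h
    · subst h
      rw [LS_eq_lineS_infty h2 hi]
      rintro rfl
      simp at hdet
    · exact (LS_eq_lineS_div h2 hi a h).symm
  | coe t =>
    change lineS i (if c * t + d = 0 then _ else _) = LS i (a * t + b) (c * t + d)
    split_ifs with h
    · rw [h, LS_eq_lineS_infty h2 hi]
      intro h'
      grind
    · exact (LS_eq_lineS_div h2 hi _ h).symm

theorem I_ne_zero (hi : i ^ 2 = -1) : i ≠ 0 := by
  rintro rfl
  simp at hi

theorem act_rho_lineS (h2 : (2 : F) ≠ 0) (hi : i ^ 2 = -1) (s : OnePoint F) :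
    act rho (lineS i s) = lineS i (moebius 0 (-i) 1 0 s) := by
  have hi0 := I_ne_zero hi
  rw [lineS_moebius h2 hi (by simpa using hi0)]
  induction s using OnePoint.rec with
  | infty =>
    rw [lineS_infty, act_rho_LS h2 hi (Or.inl one_ne_zero), mul_zero]
    rfl
  | coe t =>
    rw [lineS_coe, act_rho_LS h2 hi (Or.inr one_ne_zero)]
    change _ = LS i (0 * t + -i) (1 * t + 0)
    congr 1 <;> ring

theorem act_sigma_lineS (h2 : (2 : F) ≠ 0) (hi : i ^ 2 = -1) (s : OnePoint F) :
    act sigma (lineS i s) = lineS i (moebius (i - 1) i 1 (-(i - 1)) s) := by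
  have hi0 := I_ne_zero hi
  rw [lineS_moebius h2 hi (by grind)]
  induction s using OnePoint.rec with
  | infty =>
    rw [lineS_infty, act_sigma_LS h2 hi (Or.inl one_ne_zero)]
    change _ = LS i (i - 1) 1
    congr 1 <;> ring
  | coe t =>
    rw [lineS_coe, act_sigma_LS h2 hi (Or.inr one_ne_zero)]
    change _ = LS i ((i - 1) * t + i) (1 * t + -(i - 1))
    congr 1 <;> ring

theorem act_rho_sigma_lineS (h2 : (2 : F) ≠ 0) (hi : i ^ 2 = -1) (s : OnePoint F) :
    act (rho * sigma) (lineS i s) = lineS i (moebius ((i - 1) / 2) i 1 (-((i - 1) / 2)) s) := by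
  have hi0 := I_ne_zero hi
  -- Naming the half removes the division; the normalised formula differs from the composite of the
  -- formulas for $\rho$ and $\sigma$ by a common scalar.
  obtain ⟨j, hj, hj2⟩ : ∃ j, (i - 1) / 2 = j ∧ 2 * j = i - 1 := ⟨_, rfl, by field_simp⟩
  rw [hj]
  have hdet : j * -j - i * 1 ≠ 0 := by
    intro h
    apply mul_ne_zero h2 hi0
    grind
  rw [lineS_moebius h2 hi hdet]
  induction s using OnePoint.rec with
  | infty =>
    rw [lineS_infty, act_rho_sigma_LS h2 hi (Or.inl one_ne_zero)]
    change _ = LS i j 1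
    rw [LS_eq_iff h2 hi _ (Or.inr one_ne_zero)]
    · apply mul_left_cancel₀ h2
      grind
    · left
      simpa using hi0
  | coe t =>
    rw [lineS_coe, act_rho_sigma_LS h2 hi (Or.inr one_ne_zero)]
    change _ = LS i (j * t + i) (1 * t + -j)
    rw [LS_eq_iff h2 hi]
    · apply mul_left_cancel₀ h2
      grind
    · by_contra! hcon
      grind
    · by_contra! hcon
      grind

theorem rho_mem_stab_lineS (h2 : (2 : F) ≠ 0) (hi : i ^ 2 = -1) (t : F) :
    rho ∈ stab (lineS i (t : OnePoint F)) ↔ t ^ 2 = -i := by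
  rw [lineS_coe, rho_mem_stab_LS h2 hi (Or.inr one_ne_zero), one_pow, mul_one]

theorem sigma_mem_stab_lineS (h2 : (2 : F) ≠ 0) (hi : i ^ 2 = -1) (t : F) :
    sigma ∈ stab (lineS i (t : OnePoint F)) ↔ (t + 1 - i) ^ 2 = -i := by
  rw [lineS_coe, sigma_mem_stab_LS h2 hi (Or.inr one_ne_zero), one_pow, mul_one, mul_one,
    add_sub_assoc]

theorem rho_sigma_mem_stab_lineS (h2 : (2 : F) ≠ 0) (hi : i ^ 2 = -1) (t : F) :
    rho * sigma ∈ stab (lineS i (t : OnePoint F)) ↔ t = -1 ∨ t = i := by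
  rw [lineS_coe, rho_sigma_mem_stab_LS h2 hi (Or.inr one_ne_zero), mul_eq_zero, mul_one,
    add_eq_zero_iff_eq_neg, sub_eq_zero]

theorem not_mem_stab_lineS_infty (h2 : (2 : F) ≠ 0) (hi : i ^ 2 = -1) :
    rho ∉ stab (lineS i OnePoint.infty) ∧ sigma ∉ stab (lineS i OnePoint.infty) ∧
      rho * sigma ∉ stab (lineS i OnePoint.infty) := by
  have h : (1 : F) ≠ 0 ∨ (0 : F) ≠ 0 := Or.inl one_ne_zero
  rw [lineS_infty, rho_mem_stab_LS h2 hi h, sigma_mem_stab_LS h2 hi h,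
    rho_sigma_mem_stab_LS h2 hi h]
  simp

theorem image_lineS_orbitS (h2 : (2 : F) ≠ 0) (hi : i ^ 2 = -1) (s : OnePoint F) :
    lineS i '' orbitS i s = {lineS i s, act rho (lineS i s), act (rho * sigma) (lineS i s),
      act sigma (lineS i s)} := by
  rw [orbitS, Set.image_insert_eq, Set.image_insert_eq, Set.image_insert_eq, Set.image_singleton,
    act_rho_lineS h2 hi, act_rho_sigma_lineS h2 hi, act_sigma_lineS h2 hi]

end Projective

end MobiusKantor

namespace MobiusKantor

/-! ### Lines when `-1` is not a square -/

section NonSquare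

variable {F : Type*} [Field F]

/-- The line spanned by the two rows with parameters `α, β`. -/
def LAB (α β : F) : Submodule F (Fin 9 → F) where
  -- The second and fourth coordinates `b, d` of a combination of the two rows determine its
  -- coefficients as `(d - b) / 2` and `(b + d) / 2`; the equations state what the other two
  -- coordinates must then be.
  carrier := {z | ∃ a b c d, z = vm a b c d ∧ 2 * a = (d - b) * (α + 1) + (b + d) * β ∧
    2 * c = (d - b) * β - (b + d) * (α + 1)}
  add_mem' := by
    rintro _ _ ⟨a, b, c, d, rfl, h1, h2⟩ ⟨a', b', c', d', rfl, h1', h2'⟩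
    refine ⟨_, _, _, _, vm_add _ _ _ _ _ _ _ _, ?_, ?_⟩
    · linear_combination h1 + h1'
    · linear_combination h2 + h2'
  zero_mem' := ⟨0, 0, 0, 0, vm_zero.symm, by ring, by ring⟩
  smul_mem' := by
    rintro t _ ⟨a, b, c, d, rfl, h1, h2⟩
    refine ⟨_, _, _, _, vm_smul _ _ _ _ _, ?_, ?_⟩
    · linear_combination t * h1
    · linear_combination t * h2

variable {α β α' β' : F}

theorem vm_mem_LAB {a b c d : F} : vm a b c d ∈ LAB α β ↔
    2 * a = (d - b) * (α + 1) + (b + d) * β ∧ 2 * c = (d - b) * β - (b + d) * (α + 1) := by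
  constructor
  · rintro ⟨a', b', c', d', h, h1⟩
    obtain ⟨rfl, rfl, rfl, rfl⟩ := vm_injective h
    exact h1
  · exact fun h => ⟨a, b, c, d, rfl, h⟩

theorem LAB_le (α β : F) : LAB α β ≤ Em F := by
  rintro _ ⟨a, b, c, d, rfl, -⟩
  exact ⟨a, b, c, d, rfl⟩

theorem vm_fst_mem_LAB (α β : F) : vm (α + 1) (-1) β 1 ∈ LAB α β := by
  rw [vm_mem_LAB]
  constructor <;> ring

theorem vm_snd_mem_LAB (α β : F) : vm β 1 (-(α + 1)) 1 ∈ LAB α β := by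
  rw [vm_mem_LAB]
  constructor <;> ring

theorem LAB_eq_span (h2 : (2 : F) ≠ 0) (α β : F) : LAB α β =
    Submodule.span F {vm (α + 1) (-1) β 1, vm β 1 (-(α + 1)) 1} := by
  apply le_antisymm
  · rintro _ ⟨a, b, c, d, rfl, h1, h3⟩
    rw [← Submodule.smul_mem_iff _ h2, Submodule.mem_span_pair]
    refine ⟨d - b, b + d, ?_⟩
    rw [vm_smul, vm_smul, vm_smul, vm_add]
    congr 1 <;> grind
  · rw [Submodule.span_le]
    rintro _ (rfl | rfl)
    · exact vm_fst_mem_LAB α β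
    · exact vm_snd_mem_LAB α β

theorem H_le_stab_LAB (h2 : (2 : F) ≠ 0) (h : α ^ 2 + β ^ 2 = -1) : H ≤ stab (LAB α β) := by
  rw [H_le_iff]
  constructor <;> refine mem_stab_of_le ?_ <;> rintro _ ⟨a, b, c, d, rfl, h1, h3⟩
  · rw [pow_two, pullback_mul, LinearMap.comp_apply, pullback_rho_vm, pullback_rho_vm, vm_mem_LAB]
    constructor <;> apply mul_left_cancel₀ h2 <;> grind
  · rw [pullback_omega_vm, vm_mem_LAB]
    constructor <;> apply mul_left_cancel₀ h2 <;> grind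

theorem isLine_LAB (h2 : (2 : F) ≠ 0) (h : α ^ 2 + β ^ 2 = -1) : IsLine (LAB α β) := by
  refine ⟨LAB_le α β, H_le_stab_LAB h2 h, fun hb => ?_, fun ht => ?_⟩
  · have h1 := vm_fst_mem_LAB α β
    rw [hb, Submodule.mem_bot, ← vm_zero] at h1
    exact one_ne_zero (vm_injective h1).2.2.2
  · have h1 : vm 1 0 0 0 ∈ LAB α β := ht ▸ vm_mem_Em _ _ _ _
    have h4 := (vm_mem_LAB.1 h1).1
    simp [h2] at h4

theorem eq_zero_of_sq_add_sq (hn : ∀ t : F, t ^ 2 ≠ -1) {a b : F} (h : a ^ 2 + b ^ 2 = 0) :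
    a = 0 ∧ b = 0 := by
  have hb : b = 0 := by
    by_contra hb
    apply hn (a / b)
    field_simp
    linear_combination h
  subst hb
  simpa using h

/-- On these vectors $\rho^2$ sends $(a,c)$ to $(c,-a)$, and $a^2+c^2$ vanishes only at zero. So one
nonzero vector would give all `vm s 0 t 0`, and their images under $\omega$ would fill `Em`. -/
theorem IsLine.eq_zero_of_mem (hn : ∀ t : F, t ^ 2 ≠ -1) {C : Submodule F (Fin 9 → F)}
    (hC : IsLine C) {a c : F} (h : vm a 0 c 0 ∈ C) : a = 0 ∧ c = 0 := by
  by_contra hne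
  have h0 : a ^ 2 + c ^ 2 ≠ 0 := fun h0 => hne (eq_zero_of_sq_add_sq hn h0)
  refine hC.ne_top (le_antisymm hC.le ?_)
  have hI := vm_I_mem hC.stable h
  obtain ⟨e, he⟩ : ∃ e, e * (a ^ 2 + c ^ 2) = 1 := ⟨_, inv_mul_cancel₀ h0⟩
  have all : ∀ s t, vm s 0 t 0 ∈ C := by
    intro s t
    have h1 := C.add_mem (C.smul_mem (e * (s * a + t * c)) h)
      (C.smul_mem (e * (s * c - t * a)) hI)
    rw [vm_smul, vm_smul, vm_add] at h1
    convert h1 using 2 <;> grind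
  rintro _ ⟨s, b, t, d, rfl⟩
  -- The two images under $\omega$ are `vm d 0 0 d` and `vm (-b) b 0 0`; they supply the second and
  -- fourth coordinates, and the last summand corrects the others.
  have h1 := C.add_mem (C.add_mem (vm_omega_mem hC.stable (all (-d) 0))
    (vm_omega_mem hC.stable (all 0 (-b)))) (all (s + b - d) t)
  rw [vm_add, vm_add] at h1
  convert h1 using 2 <;> ring

theorem IsLine.eq_LAB (h2 : (2 : F) ≠ 0) (hn : ∀ t : F, t ^ 2 ≠ -1) {C : Submodule F (Fin 9 → F)}
    (hC : IsLine C) (hm : vm (α + 1) (-1) β 1 ∈ C) : C = LAB α β := by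
  have hm' : vm β 1 (-(α + 1)) 1 ∈ C := by
    have h1 := vm_I_mem hC.stable hm
    rwa [neg_neg] at h1
  have hle : LAB α β ≤ C := by
    rw [LAB_eq_span h2, Submodule.span_le]
    rintro _ (rfl | rfl)
    · exact hm
    · exact hm'
  refine (le_antisymm hle fun z hz => ?_).symm
  obtain ⟨a, b, c, d, rfl⟩ := hC.le hz
  have h1 := C.add_mem (C.add_mem (C.smul_mem 2 hz) (C.smul_mem (b - d) hm))
    (C.smul_mem (-(b + d)) hm')
  rw [vm_smul, vm_smul, vm_smul, vm_add, vm_add,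
    show 2 * b + (b - d) * -1 + -(b + d) * 1 = 0 by ring,
    show 2 * d + (b - d) * 1 + -(b + d) * 1 = 0 by ring] at h1
  obtain ⟨h3, h4⟩ := hC.eq_zero_of_mem hn h1
  rw [vm_mem_LAB]
  constructor
  · linear_combination h3
  · linear_combination h4

theorem IsLine.exists_eq_LAB (h2 : (2 : F) ≠ 0) (hn : ∀ t : F, t ^ 2 ≠ -1)
    {C : Submodule F (Fin 9 → F)} (hC : IsLine C) :
    ∃ α β, α ^ 2 + β ^ 2 = -1 ∧ C = LAB α β := by
  obtain ⟨z, hz, hz0⟩ := C.ne_bot_iff.1 hC.ne_bot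
  obtain ⟨a, b, c, d, rfl⟩ := hC.le hz
  have hbd : b ^ 2 + d ^ 2 ≠ 0 := by
    intro h
    obtain ⟨rfl, rfl⟩ := eq_zero_of_sq_add_sq hn h
    obtain ⟨rfl, rfl⟩ := hC.eq_zero_of_mem hn hz
    exact hz0 vm_zero
  -- Since $\rho^2$ also rotates $(b,d)$, a combination of the vector and its image can be
  -- normalised to have second and fourth coordinates $-1$ and $1$.
  have h1 := C.add_mem (C.smul_mem ((d - b) / (b ^ 2 + d ^ 2)) hz)
    (C.smul_mem (-(b + d) / (b ^ 2 + d ^ 2)) (vm_I_mem hC.stable hz))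
  rw [vm_smul, vm_smul, vm_add] at h1
  obtain ⟨A, B, hm⟩ : ∃ A B, vm (A + 1) (-1) B 1 ∈ C := by
    refine ⟨(d - b) / (b ^ 2 + d ^ 2) * a + -(b + d) / (b ^ 2 + d ^ 2) * c - 1,
      (d - b) / (b ^ 2 + d ^ 2) * c + -(b + d) / (b ^ 2 + d ^ 2) * -a, ?_⟩
    convert h1 using 2
    · exact sub_add_cancel _ _
    · field_simp
      ring
    · field_simp
      ring
  have hm' := vm_I_mem hC.stable hm
  -- This combination cancels every coordinate except the first, which becomes $A^2+B^2+1$ and must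
  -- vanish. Stability under $J$ is thus what puts the parameters on the conic.
  have h3 := C.add_mem (C.add_mem (vm_J_mem hC.stable hm) (C.smul_mem A hm)) (C.smul_mem B hm')
  rw [vm_smul, vm_smul, vm_add, vm_add] at h3
  have h4 : vm (A ^ 2 + B ^ 2 + 1) 0 0 0 ∈ C := by
    convert h3 using 2 <;> ring
  refine ⟨A, B, ?_, hC.eq_LAB h2 hn hm⟩
  linear_combination (hC.eq_zero_of_mem hn h4).1

theorem LAB_injective (h2 : (2 : F) ≠ 0) (h : LAB α β = LAB α' β') : α = α' ∧ β = β' := by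
  have h1 := h ▸ vm_fst_mem_LAB α β
  rw [vm_mem_LAB] at h1
  constructor <;> apply mul_left_cancel₀ h2
  · linear_combination h1.1
  · linear_combination h1.2

theorem linesIncomparable_of_not_sq (h2 : (2 : F) ≠ 0) (hn : ∀ t : F, t ^ 2 ≠ -1) :
    LinesIncomparable F := by
  intro C C' hC hC' hle
  obtain ⟨α, β, h, rfl⟩ := hC.exists_eq_LAB h2 hn
  exact (hC'.eq_LAB h2 hn (hle (vm_fst_mem_LAB α β))).symm

theorem fst_ne_zero (hn : ∀ t : F, t ^ 2 ≠ -1) (h : α ^ 2 + β ^ 2 = -1) : α ≠ 0 := by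
  rintro rfl
  exact hn β (by linear_combination h)

theorem ordinate_ne_zero (hn : ∀ t : F, t ^ 2 ≠ -1) (h : α ^ 2 + β ^ 2 = -1) : β ≠ 0 := by
  rintro rfl
  exact hn α (by linear_combination h)

theorem act_rho_LAB (h2 : (2 : F) ≠ 0) (hn : ∀ t : F, t ^ 2 ≠ -1) (h : α ^ 2 + β ^ 2 = -1) :
    act rho (LAB α β) = LAB (1 / α) (-β / α) := by
  have h0 := fst_ne_zero hn h
  refine ((isLine_LAB h2 h).act rho).eq_LAB h2 hn ?_
  rw [mem_act, pullback_rho_vm, vm_mem_LAB]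
  constructor <;> field_simp <;> grind

theorem act_sigma_LAB (h2 : (2 : F) ≠ 0) (hn : ∀ t : F, t ^ 2 ≠ -1) (h : α ^ 2 + β ^ 2 = -1) :
    act sigma (LAB α β) = LAB (1 / α) (β / α) := by
  have h0 := fst_ne_zero hn h
  refine ((isLine_LAB h2 h).act sigma).eq_LAB h2 hn ?_
  rw [mem_act, pullback_sigma_vm, vm_mem_LAB]
  constructor <;> field_simp <;> grind

theorem act_rho_sigma_LAB (h2 : (2 : F) ≠ 0) (hn : ∀ t : F, t ^ 2 ≠ -1)
    (h : α ^ 2 + β ^ 2 = -1) : act (rho * sigma) (LAB α β) = LAB α (-β) := by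
  have h0 := fst_ne_zero hn h
  rw [act_mul, act_sigma_LAB h2 hn h, act_rho_LAB h2 hn]
  · congr 1 <;> field_simp
  · field_simp
    linear_combination h

theorem rho_mem_stab_LAB (h2 : (2 : F) ≠ 0) (hn : ∀ t : F, t ^ 2 ≠ -1) (h : α ^ 2 + β ^ 2 = -1) :
    rho ∈ stab (LAB α β) ↔ α = -1 := by
  have h0 := fst_ne_zero hn h
  have h1 := ordinate_ne_zero hn h
  rw [mem_stab, act_rho_LAB h2 hn h]
  constructor
  · intro e
    have h3 := (LAB_injective h2 e).2
    field_simp at h3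
    exact h3.symm
  · rintro rfl
    congr 1 <;> simp

theorem sigma_mem_stab_LAB (h2 : (2 : F) ≠ 0) (hn : ∀ t : F, t ^ 2 ≠ -1)
    (h : α ^ 2 + β ^ 2 = -1) : sigma ∈ stab (LAB α β) ↔ α = 1 := by
  have h0 := fst_ne_zero hn h
  have h1 := ordinate_ne_zero hn h
  rw [mem_stab, act_sigma_LAB h2 hn h]
  constructor
  · intro e
    have h3 := (LAB_injective h2 e).2
    field_simp at h3
    exact h3.symm
  · rintro rfl
    congr 1 <;> simp

theorem rho_sigma_not_mem_stab_LAB (h2 : (2 : F) ≠ 0) (hn : ∀ t : F, t ^ 2 ≠ -1)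
    (h : α ^ 2 + β ^ 2 = -1) : rho * sigma ∉ stab (LAB α β) := by
  rw [mem_stab, act_rho_sigma_LAB h2 hn h]
  intro e
  refine ordinate_ne_zero hn h (mul_left_cancel₀ h2 ?_)
  linear_combination -(LAB_injective h2 e).2

end NonSquare

section Conic

variable {F : Type} [Field F] {α β : F}

theorem image_LAB_orbitAB (h2 : (2 : F) ≠ 0) (hn : ∀ t : F, t ^ 2 ≠ -1) (h : α ^ 2 + β ^ 2 = -1) :
    (fun q : F × F => LAB q.1 q.2) '' orbitAB (α, β) = {LAB α β, act rho (LAB α β),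
      act (rho * sigma) (LAB α β), act sigma (LAB α β)} := by
  rw [orbitAB, Set.image_insert_eq, Set.image_insert_eq, Set.image_insert_eq, Set.image_singleton,
    act_rho_LAB h2 hn h, act_rho_sigma_LAB h2 hn h, act_sigma_LAB h2 hn h]

end Conic

end MobiusKantor

namespace MobiusKantor

/-! ### Orbits of subspaces -/

section Orbits

variable {F : Type*} [Field F] {U : Submodule F (Fin 9 → F)}

/-- Modulo $H$ the elements $\rho$ and $\sigma$ commute, so on $H$-stable subspaces they act as
commuting maps. -/
theorem exists_sigma_mul_rho : ∃ h ∈ H, sigma * rho = rho * sigma * h := by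
  have h : ∃ i < 4, ∃ j < 3, ∃ k < 4, sigma * rho = rho * sigma * elemH i j k := by decide +kernel
  obtain ⟨i, -, j, -, k, -, e⟩ := h
  exact ⟨_, elemH_mem i j k, e⟩

theorem act_rho_rho (hU : H ≤ stab U) : act rho (act rho U) = U := by
  rw [← act_mul, ← pow_two]
  exact (H_le_iff.1 hU).1

theorem act_sigma_rho (hU : H ≤ stab U) : act sigma (act rho U) = act rho (act sigma U) := by
  obtain ⟨h, hh, e⟩ := exists_sigma_mul_rho
  rw [← act_mul, e, act_mul, mem_stab.1 (hU hh), act_mul]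

/-- The orbit of an `H`-stable subspace. -/
def orbit (U : Submodule F (Fin 9 → F)) : Set (Submodule F (Fin 9 → F)) :=
  {U, act rho U, act (rho * sigma) U, act sigma U}

theorem mem_orbit_iff (hU : H ≤ stab U) {V : Submodule F (Fin 9 → F)} :
    V ∈ orbit U ↔ ∃ a, V = act a U := by
  rw [exists_act_iff hU]
  exact or_congr_right (or_assoc.symm.trans or_comm)

theorem ncard_orbit (hU : H ≤ stab U) (h0 : sigma ∉ stab U) (h1 : rho ∉ stab U)
    (h2 : rho * sigma ∉ stab U) : (orbit U).ncard = 4 := by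
  rw [mem_stab] at h0 h1 h2
  rw [act_mul] at h2
  have h3 : act rho U ≠ act sigma U := fun h => h2 (by rw [← h, act_rho_rho hU])
  have h4 : act rho (act sigma U) ≠ act sigma U := fun h =>
    h1 (act_injective sigma (by rw [act_sigma_rho hU, h]))
  have h5 : act rho U ≠ act rho (act sigma U) := fun h => h0 (act_injective rho h).symm
  rw [orbit, act_mul, Set.ncard_insert_of_notMem, Set.ncard_insert_of_notMem, Set.ncard_pair h4]
  · simp only [Set.mem_insert_iff, Set.mem_singleton_iff, not_or]
    exact ⟨h5, h3⟩
  · simp only [Set.mem_insert_iff, Set.mem_singleton_iff, not_or]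
    exact ⟨fun h => h1 h.symm, fun h => h2 h.symm, fun h => h0 h.symm⟩

theorem orbit_eq_pair (h0 : sigma ∈ stab U) : orbit U = {U, act rho U} := by
  rw [mem_stab] at h0
  rw [orbit, act_mul, h0]
  ext V
  simp only [Set.mem_insert_iff, Set.mem_singleton_iff]
  tauto

theorem sigma_mem_stab_of_mem_orbit (hU : H ≤ stab U) {V : Submodule F (Fin 9 → F)}
    (hV : V ∈ orbit U) : sigma ∈ stab V ↔ sigma ∈ stab U := by
  rw [mem_stab, mem_stab]
  have key : act sigma (act rho U) = act rho U ↔ act sigma U = U := by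
    rw [act_sigma_rho hU]
    exact (act_injective rho).eq_iff
  rcases hV with rfl | rfl | rfl | rfl
  · rfl
  · exact key
  · rw [act_mul, ← act_sigma_rho hU, (act_injective sigma).eq_iff, key]
  · exact (act_injective sigma).eq_iff

/-- Stability under $\sigma$ is constant on an orbit. The orbit has two elements, counted twice, if
$\sigma$ stabilises it pointwise; otherwise all four images are distinct. -/
theorem ncard_orbit_add (hU : IsSemi U) :
    (orbit U).ncard + {V ∈ orbit U | sigma ∈ stab V}.ncard = 4 := by
  by_cases h : sigma ∈ stab U
  · have h1 : {V ∈ orbit U | sigma ∈ stab V} = orbit U :=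
      Set.sep_eq_self_iff_mem_true.2 fun V hV => (sigma_mem_stab_of_mem_orbit hU.1 hV).2 h
    rw [h1, orbit_eq_pair h, Set.ncard_pair fun e => hU.2.1 e.symm]
  · have h1 : {V ∈ orbit U | sigma ∈ stab V} = ∅ :=
      Set.sep_eq_empty_iff_mem_false.2 fun V hV h' => h ((sigma_mem_stab_of_mem_orbit hU.1 hV).1 h')
    rw [h1, Set.ncard_empty, ncard_orbit hU.1 h hU.2.1 hU.2.2]

end Orbits

/-! ### Counting orbits by minimal subspaces and fixed points of $\sigma$ -/

section Counting

variable {F : Type} [Field F] [Finite F]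

theorem four_mul_card_classes : 4 * Nat.card (Quotient (actSetoid F)) =
    {U : Submodule F (Fin 9 → F) | IsMinSemi U}.ncard +
      {U : Submodule F (Fin 9 → F) | IsMinSemi U ∧ sigma ∈ stab U}.ncard := by
  classical
  have : Finite (Submodule F (Fin 9 → F)) := Finite.of_injective _ SetLike.coe_injective
  have := Fintype.ofFinite (Quotient (actSetoid F))
  let mk : {U : Submodule F (Fin 9 → F) // IsMinSemi U} → Quotient (actSetoid F) := Quotient.mk _
  have h1 : {U : Submodule F (Fin 9 → F) | IsMinSemi U}.ncard =
      ∑ q, Nat.card {V // mk V = q} := by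
    rw [← Nat.card_coe_set_eq, ← Nat.card_sigma]
    exact Nat.card_congr (Equiv.sigmaFiberEquiv mk).symm
  let mk' : {U : Submodule F (Fin 9 → F) // IsMinSemi U ∧ sigma ∈ stab U} →
    Quotient (actSetoid F) := fun U => mk ⟨U.1, U.2.1⟩
  have h2 : {U : Submodule F (Fin 9 → F) | IsMinSemi U ∧ sigma ∈ stab U}.ncard =
      ∑ q, Nat.card {V // mk' V = q} := by
    rw [← Nat.card_coe_set_eq, ← Nat.card_sigma]
    exact Nat.card_congr (Equiv.sigmaFiberEquiv mk').symm
  rw [h1, h2, ← Finset.sum_add_distrib, Nat.card_eq_fintype_card, ← Finset.card_univ, mul_comm,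
    ← smul_eq_mul, ← Finset.sum_const]
  refine Finset.sum_congr rfl fun q _ => ?_
  induction q using Quotient.inductionOn with
  | h U =>
    have hmk : ∀ V, mk V = Quotient.mk _ U ↔ V.1 ∈ orbit U.1 := by
      intro V
      rw [mem_orbit_iff U.2.1.1]
      exact eq_comm.trans Quotient.eq
    have hms : ∀ V ∈ orbit U.1, IsMinSemi V := by
      intro V hV
      obtain ⟨a, rfl⟩ := (mem_orbit_iff U.2.1.1).1 hV
      exact (isMinSemi_act_iff a U.1).2 U.2
    rw [← ncard_orbit_add U.2.1, ← Nat.card_coe_set_eq, ← Nat.card_coe_set_eq]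
    congr 1
    · exact Nat.card_congr ⟨fun V => ⟨⟨V.1, hms _ V.2⟩, (hmk _).2 V.2⟩,
        fun V => ⟨V.1.1, (hmk _).1 V.2⟩, fun _ => rfl, fun _ => rfl⟩
    · exact Nat.card_congr ⟨fun V => ⟨⟨V.1, hms _ V.2.1, V.2.2⟩, (hmk _).2 V.2.1⟩,
        fun V => ⟨V.1.1, (hmk _).1 V.2, V.1.2.2⟩, fun _ => rfl, fun _ => rfl⟩

theorem numClasses_eq_of_ncard {p : ℕ} [Fact p.Prime] {n : ℕ}
    (h : {U : Submodule (ZMod p) (Fin 9 → ZMod p) | IsMinSemi U}.ncard +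
      {U : Submodule (ZMod p) (Fin 9 → ZMod p) | IsMinSemi U ∧ sigma ∈ stab U}.ncard = 4 * n) :
    numClasses.{u} p = n := by
  have : Finite (Submodule (ZMod p) (Fin 9 → ZMod p)) := Finite.of_injective _ SetLike.coe_injective
  have h1 := four_mul_card_classes (F := ZMod p)
  rw [h] at h1
  rw [numClasses_eq, ENat.card_eq_coe_natCard, Nat.eq_of_mul_eq_mul_left (by norm_num) h1]

end Counting

end MobiusKantor

namespace MobiusKantor

/-! ### Square roots and conics over prime fields -/

section Roots

variable {p : ℕ} [Fact p.Prime]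

theorem exists_orderOf_eq {n : ℕ} (h : n ∣ p - 1) (hn : n ≠ 0) : ∃ z : ZMod p, orderOf z = n := by
  obtain ⟨g, hg⟩ := IsCyclic.exists_ofOrder_eq_natCard (α := (ZMod p)ˣ)
  rw [Nat.card_eq_fintype_card, ZMod.card_units] at hg
  refine ⟨((g ^ ((p - 1) / n) : (ZMod p)ˣ) : ZMod p), ?_⟩
  have hp := (Fact.out : p.Prime).two_le
  obtain ⟨k, hk⟩ := h
  have hk0 : k ≠ 0 := by
    rintro rfl
    omega
  rw [orderOf_units, orderOf_pow_of_dvd, hg, hk]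
  · rw [Nat.mul_div_cancel_left _ (Nat.pos_of_ne_zero hn),
      Nat.mul_div_cancel _ (Nat.pos_of_ne_zero hk0)]
  · rw [hk, Nat.mul_div_cancel_left _ (Nat.pos_of_ne_zero hn)]
    exact hk0
  · rw [hg, hk, Nat.mul_div_cancel_left _ (Nat.pos_of_ne_zero hn)]
    exact Dvd.intro_left n rfl

theorem two_ne_zero_of_odd (hp : p ≠ 2) : (2 : ZMod p) ≠ 0 := by
  intro h
  have h1 : ((2 : ℕ) : ZMod p) = 0 := by exact_mod_cast h
  rw [ZMod.natCast_eq_zero_iff] at h1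
  exact hp ((Nat.prime_dvd_prime_iff_eq Fact.out Nat.prime_two).1 h1)

theorem sq_ne_neg_one (h : p % 4 = 3) (t : ZMod p) : t ^ 2 ≠ -1 := fun ht =>
  (ZMod.mod_four_ne_three_of_sq_eq_neg_one ht) h

theorem exists_sq_eq_neg_one_of_mod (h : p % 4 = 1) : ∃ i : ZMod p, i ^ 2 = -1 := by
  obtain ⟨i, hi⟩ := (ZMod.exists_sq_eq_neg_one_iff (p := p)).2 (by omega)
  exact ⟨i, by rw [pow_two, ← hi]⟩

/-- Such an element has order 8 in the multiplicative group of order $p-1$. -/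
theorem mod_eight_of_fourth_root (hp : p ≠ 2) {z : ZMod p} (h : z ^ 4 = -1) : p % 8 = 1 := by
  have h2 := two_ne_zero_of_odd hp
  have ho : orderOf z = 2 ^ (2 + 1) := by
    refine orderOf_eq_prime_pow ?_ ?_
    · norm_num
      rw [h]
      intro h1
      exact h2 (by linear_combination -h1)
    · norm_num
      rw [show (8 : ℕ) = 4 * 2 by norm_num, pow_mul, h]
      ring
  have hz : z ≠ 0 := by
    rintro rfl
    simp at h
  have h1 := ZMod.orderOf_dvd_card_sub_one hz
  rw [ho] at h1
  have := (Fact.out : p.Prime).two_le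
  omega

theorem exists_sq_eq_neg_of_mod (h : p % 8 = 1) {i : ZMod p} (hi : i ^ 2 = -1) :
    ∃ ν : ZMod p, ν ^ 2 = -i := by
  have hp := (Fact.out : p.Prime).two_le
  obtain ⟨z, hz⟩ := exists_orderOf_eq (p := p) (n := 8) (by omega) (by norm_num)
  have h8 := pow_orderOf_eq_one z
  rw [hz] at h8
  have h4 : z ^ 4 ≠ 1 := pow_ne_one_of_lt_orderOf (by norm_num) (by omega)
  have h3 : (z ^ 4 - 1) * (z ^ 4 + 1) = 0 := by linear_combination h8
  have h5 := (mul_eq_zero.1 h3).resolve_left (sub_ne_zero.2 h4)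
  have h6 : (z ^ 2 + i) * (z ^ 2 - i) = 0 := by linear_combination h5 - hi
  rcases mul_eq_zero.1 h6 with h7 | h7
  · exact ⟨z, by linear_combination h7⟩
  · exact ⟨i * z, by linear_combination -h7 + z ^ 2 * hi⟩

theorem mod_three_of_sq_eq (hp : p ≠ 2) {c : ZMod p} (hc : c ^ 2 = -3) (hc0 : c ≠ 0) :
    p % 3 = 1 := by
  have h2 := two_ne_zero_of_odd hp
  -- This is a primitive cube root of unity. The assumption $c\ne0$ matters only for $p=3$, where
  -- $-3=0$.
  obtain ⟨z, hz⟩ : ∃ z : ZMod p, 2 * z = c - 1 := ⟨(c - 1) / 2, by field_simp⟩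
  have h8 : (8 : ZMod p) ≠ 0 := by
    rw [show (8 : ZMod p) = 2 * 2 * 2 by norm_num]
    exact mul_ne_zero (mul_ne_zero h2 h2) h2
  have h3 : z ^ 3 = 1 := by
    apply mul_left_cancel₀ h8
    grind
  have h1 : z ≠ 1 := by
    rintro rfl
    have h4 : c = 3 := by linear_combination -hz
    subst h4
    have h5 : (2 : ZMod p) * 2 * 3 = 0 := by linear_combination hc
    exact mul_ne_zero (mul_ne_zero h2 h2) hc0 h5
  have h4 : z ≠ 0 := by
    rintro rfl
    simp at h3
  have h5 := ZMod.orderOf_dvd_card_sub_one h4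
  have : Fact (Nat.Prime 3) := ⟨Nat.prime_three⟩
  rw [orderOf_eq_prime h3 h1] at h5
  have := (Fact.out : p.Prime).two_le
  omega

theorem exists_sq_eq_neg_three (h : p % 3 = 1) : ∃ c : ZMod p, c ^ 2 = -3 ∧ c ≠ 0 := by
  have hp := (Fact.out : p.Prime).two_le
  obtain ⟨z, hz⟩ := exists_orderOf_eq (p := p) (n := 3) (by omega) (by norm_num)
  have h3 := pow_orderOf_eq_one z
  rw [hz] at h3
  have h1 : z ≠ 1 := by
    rintro rfl
    simp at hz
  have h4 : (z - 1) * (z ^ 2 + z + 1) = 0 := by linear_combination h3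
  have h5 := (mul_eq_zero.1 h4).resolve_left (sub_ne_zero.2 h1)
  have h6 : (2 * z + 1) ^ 2 = -3 := by linear_combination 4 * h5
  refine ⟨2 * z + 1, h6, fun h7 => ?_⟩
  rw [h7] at h6
  have h8 : ((3 : ℕ) : ZMod p) = 0 := by
    push_cast
    linear_combination h6
  rw [ZMod.natCast_eq_zero_iff, Nat.prime_dvd_prime_iff_eq Fact.out Nat.prime_three] at h8
  subst h8
  simp at h

theorem exists_sq_eq_neg_two (h : p % 8 = 3) : ∃ b : ZMod p, b ^ 2 = -2 := by
  obtain ⟨b, hb⟩ := (ZMod.exists_sq_eq_neg_two_iff (p := p) (by omega)).2 (Or.inr h)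
  exact ⟨b, by rw [pow_two, ← hb]⟩

theorem sq_ne_neg_two (h : p % 8 = 7) (b : ZMod p) : b ^ 2 ≠ -2 := by
  intro hb
  have h1 := (ZMod.exists_sq_eq_neg_two_iff (p := p) (by omega)).1 ⟨b, by rw [← hb, pow_two]⟩
  omega

end Roots

/-! ### The conic $\alpha^2+\beta^2=-1$ has $p+1$ points -/

section ConicCount

variable {F : Type*} [Field F]

/-- Stereographic projection of the unit circle, when `-1` is not a square. -/
noncomputable def circleEquiv (h2 : (2 : F) ≠ 0) (hn : ∀ t : F, t ^ 2 ≠ -1) :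
    {q : F × F // q.1 ^ 2 + q.2 ^ 2 = 1} ≃ Option F where
  toFun q := by
    classical
    exact if q.1.1 = -1 then none else some (q.1.2 / (1 + q.1.1))
  invFun o := o.elim ⟨(-1, 0), by ring⟩ fun t =>
    ⟨((1 - t ^ 2) / (1 + t ^ 2), 2 * t / (1 + t ^ 2)), by
    have h : 1 + t ^ 2 ≠ 0 := fun h => hn t (by linear_combination h)
    field_simp
    ring⟩
  left_inv := by
    rintro ⟨⟨x, y⟩, h⟩
    dsimp only at h ⊢
    split_ifs with hx
    · subst hx
      have hy : y ^ 2 = 0 := by linear_combination h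
      rw [pow_eq_zero_iff two_ne_zero] at hy
      subst hy
      rfl
    · have h1 : 1 + x ≠ 0 := fun h1 => hx (by linear_combination h1)
      have h3 : 1 + (y / (1 + x)) ^ 2 ≠ 0 := fun h' => hn (y / (1 + x)) (by linear_combination h')
      have h4 : (1 + (y / (1 + x)) ^ 2) * (1 + x) = 2 := by
        field_simp
        linear_combination h
      refine Subtype.ext (Prod.ext ?_ ?_)
      · change (1 - (y / (1 + x)) ^ 2) / (1 + (y / (1 + x)) ^ 2) = x
        rw [div_eq_iff h3]
        linear_combination -h4
      · change 2 * (y / (1 + x)) / (1 + (y / (1 + x)) ^ 2) = y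
        rw [div_eq_iff h3, ← h4]
        field_simp
  right_inv := by
    rintro (_ | t)
    · dsimp only [Option.elim]
      exact if_pos rfl
    · have h : 1 + t ^ 2 ≠ 0 := fun h => hn t (by linear_combination h)
      have h1 : (1 - t ^ 2) / (1 + t ^ 2) ≠ -1 := by
        rw [Ne, div_eq_iff h]
        intro h3
        exact h2 (by linear_combination h3)
      dsimp only [Option.elim]
      rw [if_neg h1]
      congr 1
      have h3 : 1 + (1 - t ^ 2) / (1 + t ^ 2) = 2 / (1 + t ^ 2) := by
        field_simp
        ring
      rw [h3]
      field_simp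

/-- Multiplication by a point identifies the unit circle with `α² + β² = -1`. -/
def conicEquiv {α β : F} (h : α ^ 2 + β ^ 2 = -1) :
    {q : F × F // q.1 ^ 2 + q.2 ^ 2 = 1} ≃ {q : F × F // q.1 ^ 2 + q.2 ^ 2 = -1} where
  toFun q := ⟨(q.1.1 * α - q.1.2 * β, q.1.1 * β + q.1.2 * α), by
    linear_combination (α ^ 2 + β ^ 2) * q.2 + h⟩
  -- Pairs are multiplied like complex numbers; as $(\alpha,\beta)$ has norm $-1$, its inverse is
  -- minus its conjugate.
  invFun q := ⟨(-(q.1.1 * α + q.1.2 * β), q.1.1 * β - q.1.2 * α), by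
    linear_combination (α ^ 2 + β ^ 2) * q.2 - h⟩
  left_inv := by
    rintro ⟨⟨x, y⟩, hq⟩
    refine Subtype.ext (Prod.ext ?_ ?_)
    · dsimp only
      linear_combination -x * h
    · dsimp only
      linear_combination -y * h
  right_inv := by
    rintro ⟨⟨x, y⟩, hq⟩
    refine Subtype.ext (Prod.ext ?_ ?_)
    · dsimp only
      linear_combination -x * h
    · dsimp only
      linear_combination -y * h

theorem ncard_conic {p : ℕ} [Fact p.Prime] (h : p % 4 = 3) :
    {q : ZMod p × ZMod p | q.1 ^ 2 + q.2 ^ 2 = -1}.ncard = p + 1 := by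
  obtain ⟨α, β, hab⟩ := ZMod.sq_add_sq p (-1 : ZMod p)
  have h2 : (2 : ZMod p) ≠ 0 := two_ne_zero_of_odd (by omega)
  rw [← Nat.card_coe_set_eq]
  have e := (conicEquiv hab).symm.trans (circleEquiv h2 (sq_ne_neg_one h))
  refine (Nat.card_congr e).trans ?_
  rw [Finite.card_option, Nat.card_zmod]

end ConicCount

end MobiusKantor

namespace MobiusKantor

/-! ### Enumeration of the minimal subspaces -/

section Enumeration

variable {F : Type*} [Field F]

variable (F) in
/-- Lines whose stabiliser is edge- but not vertex-transitive. -/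
def genericLines : Set (Submodule F (Fin 9 → F)) :=
  {C | IsLine C ∧ rho ∉ stab C ∧ rho * sigma ∉ stab C}

variable (F) in
/-- Lines that are stable under `ρ`, but not under `σ`. -/
def rhoLines : Set (Submodule F (Fin 9 → F)) :=
  {C | IsLine C ∧ rho ∈ stab C ∧ rho * sigma ∉ stab C}

theorem isMinSemi_iff (h2 : (2 : F) ≠ 0) (hF : LinesIncomparable F) {U : Submodule F (Fin 9 → F)} :
    IsMinSemi U ↔ U ∈ genericLines F ∨
      ∃ c : F, (c ^ 2 = -3 ∧ c ≠ 0) ∧ ∃ C ∈ rhoLines F, U = fixedLine c ⊔ C := by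
  constructor
  · intro hU
    rcases hU.classify h2 with h | ⟨c, C, hc, hc0, hC, hr, hrs, rfl⟩
    · exact Or.inl ⟨h, hU.1.2⟩
    · exact Or.inr ⟨c, ⟨hc, hc0⟩, C, ⟨hC, hr, hrs⟩, rfl⟩
  · rintro (⟨h, hr, hrs⟩ | ⟨c, ⟨hc, hc0⟩, C, ⟨hC, hr, hrs⟩, rfl⟩)
    · exact h.isMinSemi hF hr hrs
    · exact hC.isMinSemi_sup h2 hF hc hc0 hr hrs

theorem sigma_not_mem_stab_sup (h2 : (2 : F) ≠ 0) {c : F} (hc0 : c ≠ 0)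
    {C : Submodule F (Fin 9 → F)} (hC : C ≤ Em F) : sigma ∉ stab (fixedLine c ⊔ C) := fun h =>
  (not_mem_stab_fixedLine h2 hc0).2 ((stab_sup_inf h2 (fixedLine_le c) hC).1 h).1

theorem isMinSemi_and_sigma_iff (h2 : (2 : F) ≠ 0) (hF : LinesIncomparable F)
    {U : Submodule F (Fin 9 → F)} :
    IsMinSemi U ∧ sigma ∈ stab U ↔ U ∈ genericLines F ∧ sigma ∈ stab U := by
  rw [isMinSemi_iff h2 hF]
  refine and_congr_left fun hs => or_iff_left ?_
  rintro ⟨c, ⟨hc, hc0⟩, C, ⟨hC, hr, hrs⟩, rfl⟩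
  exact sigma_not_mem_stab_sup h2 hc0 hC.le hs

/-- The sums of a fixed line and a $\rho$-stable line are determined by their two summands and are
not contained in `Em`, so they are disjoint from the lines. -/
theorem ncard_isMinSemi [Finite F] (h2 : (2 : F) ≠ 0) (hF : LinesIncomparable F) :
    {U : Submodule F (Fin 9 → F) | IsMinSemi U}.ncard =
      (genericLines F).ncard + {c : F | c ^ 2 = -3 ∧ c ≠ 0}.ncard * (rhoLines F).ncard := by
  have : Finite (Submodule F (Fin 9 → F)) := Finite.of_injective _ SetLike.coe_injective
  have h1 : {U : Submodule F (Fin 9 → F) | IsMinSemi U} = genericLines F ∪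
      (fun q : F × Submodule F (Fin 9 → F) => fixedLine q.1 ⊔ q.2) ''
        ({c : F | c ^ 2 = -3 ∧ c ≠ 0} ×ˢ rhoLines F) := by
    ext U
    refine (isMinSemi_iff h2 hF).trans (or_congr_right ?_)
    constructor
    · rintro ⟨c, hc, C, hC, rfl⟩
      exact ⟨(c, C), ⟨hc, hC⟩, rfl⟩
    · rintro ⟨⟨c, C⟩, ⟨hc, hC⟩, rfl⟩
      exact ⟨c, hc, C, hC, rfl⟩
  rw [h1, Set.ncard_union_eq, Set.InjOn.ncard_image, Set.ncard_prod]
  · rintro ⟨c, C⟩ ⟨-, hC⟩ ⟨c', C'⟩ ⟨-, hC'⟩ h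
    obtain ⟨rfl, rfl⟩ := fixedLine_sup_injective h2 hC.1.le hC'.1.le h
    rfl
  · rw [Set.disjoint_right]
    rintro _ ⟨⟨c, C⟩, ⟨-, hC⟩, rfl⟩ h
    exact fixedLine_sup_not_le h2 h.1.le

theorem numClasses_eq_of_lines {p : ℕ} [Fact p.Prime] (h2 : (2 : ZMod p) ≠ 0)
    (hF : LinesIncomparable (ZMod p)) {n : ℕ}
    (h : (genericLines (ZMod p)).ncard +
      {c : ZMod p | c ^ 2 = -3 ∧ c ≠ 0}.ncard * (rhoLines (ZMod p)).ncard +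
        {C : Submodule (ZMod p) (Fin 9 → ZMod p) | C ∈ genericLines (ZMod p) ∧
          sigma ∈ stab C}.ncard = 4 * n) : numClasses.{u} p = n := by
  refine numClasses_eq_of_ncard ?_
  rw [ncard_isMinSemi h2 hF, ← h]
  congr 2
  ext U
  exact isMinSemi_and_sigma_iff h2 hF

theorem ncard_sq_eq (h2 : (2 : F) ≠ 0) {a t : F} (ht : t ^ 2 = a) (h0 : t ≠ 0) :
    {c : F | c ^ 2 = a ∧ c ≠ 0}.ncard = 2 := by
  have h1 : {c : F | c ^ 2 = a ∧ c ≠ 0} = {t, -t} := by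
    ext c
    change c ^ 2 = a ∧ c ≠ 0 ↔ c = t ∨ c = -t
    rw [← ht, sq_eq_sq_iff_eq_or_eq_neg]
    refine and_iff_left_of_imp ?_
    rintro (rfl | rfl)
    · exact h0
    · exact neg_ne_zero.2 h0
  rw [h1, Set.ncard_pair]
  intro h
  exact mul_ne_zero h2 h0 (by linear_combination h)

end Enumeration

section EnumerationS

variable {F : Type} [Field F] {i ν : F}

theorem genericLines_eq_of_sqrt (h2 : (2 : F) ≠ 0) (hi : i ^ 2 = -1) (hν : ν ^ 2 = -i) :
    genericLines F = lineS i '' ((↑) '' ({-1, i, ν, -ν} : Set F))ᶜ := by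
  ext C
  constructor
  · rintro ⟨hC, hr, hrs⟩
    obtain ⟨s, rfl⟩ := hC.exists_eq_lineS h2 hi
    refine ⟨s, ?_, rfl⟩
    rintro ⟨t, ht, rfl⟩
    rw [rho_mem_stab_lineS h2 hi] at hr
    rw [rho_sigma_mem_stab_lineS h2 hi] at hrs
    rcases ht with rfl | rfl | rfl | rfl
    · exact hrs (Or.inl rfl)
    · exact hrs (Or.inr rfl)
    · exact hr hν
    · exact hr (by rw [neg_sq, hν])
  · rintro ⟨s, hs, rfl⟩
    refine ⟨isLine_lineS h2 hi s, ?_⟩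
    induction s using OnePoint.rec with
    | infty => exact ⟨(not_mem_stab_lineS_infty h2 hi).1, (not_mem_stab_lineS_infty h2 hi).2.2⟩
    | coe t =>
      rw [rho_mem_stab_lineS h2 hi, rho_sigma_mem_stab_lineS h2 hi, ← hν,
        sq_eq_sq_iff_eq_or_eq_neg]
      have h : t ∉ ({-1, i, ν, -ν} : Set F) := fun h => hs ⟨t, h, rfl⟩
      simp only [Set.mem_insert_iff, Set.mem_singleton_iff] at h
      exact ⟨fun h1 => h (Or.inr (Or.inr h1)),
        fun h1 => h (h1.elim Or.inl (fun h3 => Or.inr (Or.inl h3)))⟩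

theorem genericLines_eq_of_not_sqrt (h2 : (2 : F) ≠ 0) (hi : i ^ 2 = -1)
    (hν : ∀ t : F, t ^ 2 ≠ -i) : genericLines F = lineS i '' ((↑) '' ({-1, i} : Set F))ᶜ := by
  ext C
  constructor
  · rintro ⟨hC, hr, hrs⟩
    obtain ⟨s, rfl⟩ := hC.exists_eq_lineS h2 hi
    refine ⟨s, ?_, rfl⟩
    rintro ⟨t, ht, rfl⟩
    rw [rho_sigma_mem_stab_lineS h2 hi] at hrs
    exact hrs ht
  · rintro ⟨s, hs, rfl⟩
    refine ⟨isLine_lineS h2 hi s, ?_⟩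
    induction s using OnePoint.rec with
    | infty => exact ⟨(not_mem_stab_lineS_infty h2 hi).1, (not_mem_stab_lineS_infty h2 hi).2.2⟩
    | coe t =>
      rw [rho_mem_stab_lineS h2 hi, rho_sigma_mem_stab_lineS h2 hi]
      exact ⟨hν t, fun h => hs ⟨t, h, rfl⟩⟩

theorem rhoLines_eq_of_sqrt (h2 : (2 : F) ≠ 0) (hi : i ^ 2 = -1) (hν : ν ^ 2 = -i) :
    rhoLines F = lineS i '' ((↑) '' ({ν, -ν} : Set F)) := by
  ext C
  constructor
  · rintro ⟨hC, hr, hrs⟩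
    obtain ⟨s, rfl⟩ := hC.exists_eq_lineS h2 hi
    refine ⟨s, ?_, rfl⟩
    induction s using OnePoint.rec with
    | infty => exact absurd hr (not_mem_stab_lineS_infty h2 hi).1
    | coe t =>
      rw [rho_mem_stab_lineS h2 hi, ← hν, sq_eq_sq_iff_eq_or_eq_neg] at hr
      exact ⟨t, hr, rfl⟩
  · rintro ⟨_, ⟨t, ht, rfl⟩, rfl⟩
    refine ⟨isLine_lineS h2 hi _, ?_⟩
    have ht' : t ^ 2 = -i := by
      rcases ht with rfl | rfl
      · exact hν
      · rw [neg_sq, hν]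
    rw [rho_mem_stab_lineS h2 hi, rho_sigma_mem_stab_lineS h2 hi]
    refine ⟨ht', ?_⟩
    rintro (rfl | rfl)
    · apply h2
      grind
    · apply h2
      grind

theorem rhoLines_eq_of_not_sqrt (h2 : (2 : F) ≠ 0) (hi : i ^ 2 = -1) (hν : ∀ t : F, t ^ 2 ≠ -i) :
    rhoLines F = ∅ := by
  refine Set.eq_empty_of_forall_notMem ?_
  rintro C ⟨hC, hr, -⟩
  obtain ⟨s, rfl⟩ := hC.exists_eq_lineS h2 hi
  induction s using OnePoint.rec with
  | infty => exact absurd hr (not_mem_stab_lineS_infty h2 hi).1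
  | coe t => exact hν t ((rho_mem_stab_lineS h2 hi t).1 hr)

theorem sigma_mem_stab_lineS_iff (h2 : (2 : F) ≠ 0) (hi : i ^ 2 = -1) (hν : ν ^ 2 = -i) (t : F) :
    sigma ∈ stab (lineS i (t : OnePoint F)) ↔ t = -1 + ν - ν ^ 2 ∨ t = -1 - ν - ν ^ 2 := by
  rw [sigma_mem_stab_lineS h2 hi, ← hν, sq_eq_sq_iff_eq_or_eq_neg, hν]
  constructor <;> rintro (h | h)
  · exact Or.inl (by linear_combination h)
  · exact Or.inr (by linear_combination h)
  · exact Or.inl (by linear_combination h)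
  · exact Or.inr (by linear_combination h)

theorem not_mem_of_sigma_mem (h2 : (2 : F) ≠ 0) (hi : i ^ 2 = -1) (hν : ν ^ 2 = -i) {t : F}
    (ht : t = -1 + ν - ν ^ 2 ∨ t = -1 - ν - ν ^ 2) : t ∉ ({-1, i, ν, -ν} : Set F) := by
  have hi0 := I_ne_zero hi
  have h1 := (sigma_mem_stab_lineS h2 hi t).1 ((sigma_mem_stab_lineS_iff h2 hi hν t).2 ht)
  rintro (rfl | rfl | rfl | rfl)
  · apply h2
    grind
  · apply h2
    grind
  · grind
  · grind

theorem genericLines_sigma_eq_of_sqrt (h2 : (2 : F) ≠ 0) (hi : i ^ 2 = -1) (hν : ν ^ 2 = -i) :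
    {C : Submodule F (Fin 9 → F) | C ∈ genericLines F ∧ sigma ∈ stab C} =
      lineS i '' ((↑) '' ({-1 + ν - ν ^ 2, -1 - ν - ν ^ 2} : Set F)) := by
  ext C
  constructor
  · rintro ⟨hC, hs⟩
    obtain ⟨s, rfl⟩ := hC.1.exists_eq_lineS h2 hi
    refine ⟨s, ?_, rfl⟩
    induction s using OnePoint.rec with
    | infty => exact absurd hs (not_mem_stab_lineS_infty h2 hi).2.1
    | coe t => exact ⟨t, (sigma_mem_stab_lineS_iff h2 hi hν t).1 hs, rfl⟩
  · rintro ⟨_, ⟨t, ht, rfl⟩, rfl⟩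
    refine ⟨?_, (sigma_mem_stab_lineS_iff h2 hi hν t).2 ht⟩
    rw [genericLines_eq_of_sqrt h2 hi hν]
    refine ⟨_, ?_, rfl⟩
    rintro ⟨t', ht', e⟩
    rw [OnePoint.coe_eq_coe] at e
    exact not_mem_of_sigma_mem h2 hi hν ht (e ▸ ht')

theorem genericLines_sigma_eq_of_not_sqrt (h2 : (2 : F) ≠ 0) (hi : i ^ 2 = -1)
    (hν : ∀ t : F, t ^ 2 ≠ -i) :
    {C : Submodule F (Fin 9 → F) | C ∈ genericLines F ∧ sigma ∈ stab C} = ∅ := by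
  refine Set.eq_empty_of_forall_notMem ?_
  rintro C ⟨hC, hs⟩
  obtain ⟨s, rfl⟩ := hC.1.exists_eq_lineS h2 hi
  induction s using OnePoint.rec with
  | infty => exact absurd hs (not_mem_stab_lineS_infty h2 hi).2.1
  | coe t => exact hν _ ((sigma_mem_stab_lineS h2 hi t).1 hs)

theorem ncard_image_lineS (h2 : (2 : F) ≠ 0) (hi : i ^ 2 = -1) (S : Set F) :
    (lineS i '' ((↑) '' S)).ncard = S.ncard := by
  rw [Set.ncard_image_of_injective _ (lineS_injective h2 hi),
    Set.ncard_image_of_injective _ OnePoint.coe_injective]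

theorem ncard_image_lineS_compl [Finite F] (h2 : (2 : F) ≠ 0) (hi : i ^ 2 = -1) (S : Set F) :
    (lineS i '' ((↑) '' S)ᶜ).ncard = Nat.card F + 1 - S.ncard := by
  have : Finite (OnePoint F) := inferInstanceAs (Finite (Option F))
  rw [Set.ncard_image_of_injective _ (lineS_injective h2 hi), Set.ncard_compl,
    Set.ncard_image_of_injective _ OnePoint.coe_injective]
  congr 1
  exact Finite.card_option

end EnumerationS

section EnumerationAB

variable {F : Type*} [Field F] {b : F}

theorem genericLines_eq_LAB (h2 : (2 : F) ≠ 0) (hn : ∀ t : F, t ^ 2 ≠ -1) :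
    genericLines F = (fun q : F × F => LAB q.1 q.2) ''
      {q | q.1 ^ 2 + q.2 ^ 2 = -1 ∧ q.1 ≠ -1} := by
  ext C
  constructor
  · rintro ⟨hC, hr, -⟩
    obtain ⟨α, β, h, rfl⟩ := hC.exists_eq_LAB h2 hn
    rw [rho_mem_stab_LAB h2 hn h] at hr
    exact ⟨(α, β), ⟨h, hr⟩, rfl⟩
  · rintro ⟨⟨α, β⟩, ⟨h, hr⟩, rfl⟩
    exact ⟨isLine_LAB h2 h, fun h1 => hr ((rho_mem_stab_LAB h2 hn h).1 h1),
      rho_sigma_not_mem_stab_LAB h2 hn h⟩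

theorem rhoLines_eq_LAB (h2 : (2 : F) ≠ 0) (hn : ∀ t : F, t ^ 2 ≠ -1) :
    rhoLines F = (fun q : F × F => LAB q.1 q.2) ''
      {q | q.1 ^ 2 + q.2 ^ 2 = -1 ∧ q.1 = -1} := by
  ext C
  constructor
  · rintro ⟨hC, hr, -⟩
    obtain ⟨α, β, h, rfl⟩ := hC.exists_eq_LAB h2 hn
    rw [rho_mem_stab_LAB h2 hn h] at hr
    exact ⟨(α, β), ⟨h, hr⟩, rfl⟩
  · rintro ⟨⟨α, β⟩, ⟨h, hr⟩, rfl⟩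
    exact ⟨isLine_LAB h2 h, (rho_mem_stab_LAB h2 hn h).2 hr, rho_sigma_not_mem_stab_LAB h2 hn h⟩

theorem genericLines_sigma_eq_LAB (h2 : (2 : F) ≠ 0) (hn : ∀ t : F, t ^ 2 ≠ -1) :
    {C : Submodule F (Fin 9 → F) | C ∈ genericLines F ∧ sigma ∈ stab C} =
      (fun q : F × F => LAB q.1 q.2) '' {q | q.1 ^ 2 + q.2 ^ 2 = -1 ∧ q.1 = 1} := by
  rw [genericLines_eq_LAB h2 hn]
  ext C
  constructor
  · rintro ⟨⟨⟨α, β⟩, ⟨h, hr⟩, rfl⟩, hs⟩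
    exact ⟨(α, β), ⟨h, (sigma_mem_stab_LAB h2 hn h).1 hs⟩, rfl⟩
  · rintro ⟨⟨α, β⟩, ⟨h, hr⟩, rfl⟩
    dsimp only at h hr
    subst hr
    refine ⟨⟨(1, β), ⟨h, fun h1 => h2 ?_⟩, rfl⟩, (sigma_mem_stab_LAB h2 hn h).2 rfl⟩
    dsimp only at h1
    linear_combination h1

theorem ncard_image_LAB (h2 : (2 : F) ≠ 0) (S : Set (F × F)) :
    ((fun q : F × F => LAB q.1 q.2) '' S).ncard = S.ncard := by
  refine Set.ncard_image_of_injective _ fun q q' h => ?_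
  obtain ⟨h1, h3⟩ := LAB_injective h2 h
  exact Prod.ext h1 h3

theorem ncard_conic_fiber (h2 : (2 : F) ≠ 0) (hb : b ^ 2 = -2) {a : F} (ha : a ^ 2 = 1) :
    {q : F × F | q.1 ^ 2 + q.2 ^ 2 = -1 ∧ q.1 = a}.ncard = 2 := by
  have h0 : b ≠ 0 := by
    rintro rfl
    apply h2
    linear_combination hb
  have h1 : {q : F × F | q.1 ^ 2 + q.2 ^ 2 = -1 ∧ q.1 = a} = {(a, b), (a, -b)} := by
    ext ⟨x, y⟩
    simp only [Set.mem_ofPred_eq, Set.mem_insert_iff, Set.mem_singleton_iff, Prod.mk.injEq]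
    rw [← and_or_left, ← sq_eq_sq_iff_eq_or_eq_neg, hb, and_comm]
    refine and_congr_right fun h => ?_
    rw [h, ha]
    constructor <;> intro h' <;> linear_combination h'
  rw [h1, Set.ncard_pair]
  intro h
  exact mul_ne_zero h2 h0 (by linear_combination (Prod.ext_iff.1 h).2)

theorem conic_fiber_eq_empty (hb : ∀ t : F, t ^ 2 ≠ -2) {a : F} (ha : a ^ 2 = 1) :
    {q : F × F | q.1 ^ 2 + q.2 ^ 2 = -1 ∧ q.1 = a} = ∅ := by
  refine Set.eq_empty_of_forall_notMem ?_
  rintro ⟨x, y⟩ ⟨h, rfl⟩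
  exact hb y (by linear_combination h - ha)

end EnumerationAB

end MobiusKantor

namespace MobiusKantor

/-! ### The number of classes -/

section Numbers

variable {p : ℕ} [Fact p.Prime]

theorem not_sq_eq_neg_of_mod (hp : p ≠ 2) (h : p % 8 ≠ 1) {i : ZMod p} (hi : i ^ 2 = -1)
    (t : ZMod p) : t ^ 2 ≠ -i := fun ht =>
  h (mod_eight_of_fourth_root hp (z := t) (by linear_combination (t ^ 2 - i) * ht + hi))

theorem ncard_sq_eq_neg_three_of_mod (h : p % 3 = 1) (hp : p ≠ 2) :
    {c : ZMod p | c ^ 2 = -3 ∧ c ≠ 0}.ncard = 2 := by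
  obtain ⟨c, hc, hc0⟩ := exists_sq_eq_neg_three h
  exact ncard_sq_eq (two_ne_zero_of_odd hp) hc hc0

theorem ncard_sq_eq_neg_three_of_not_mod (h : p % 3 ≠ 1) (hp : p ≠ 2) :
    {c : ZMod p | c ^ 2 = -3 ∧ c ≠ 0}.ncard = 0 := by
  rw [show {c : ZMod p | c ^ 2 = -3 ∧ c ≠ 0} = ∅ from
    Set.eq_empty_of_forall_notMem fun c hc => h (mod_three_of_sq_eq hp hc.1 hc.2), Set.ncard_empty]

theorem neg_one_ne_I (h2 : (2 : ZMod p) ≠ 0) {i : ZMod p} (hi : i ^ 2 = -1) : -1 ≠ i := by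
  rintro rfl
  exact h2 (by linear_combination hi)

/-- Of the $p+1$ lines only the two fixed by $\rho\sigma$ are lost: $-i$ is not a square, so neither
$\rho$ nor $\sigma$ fixes a line. -/
theorem numClasses_of_mod_eight_eq_five (h : p % 8 = 5) : numClasses.{u} p = ((p - 1) / 4 : ℕ) := by
  have hp : p ≠ 2 := by omega
  have h2 := two_ne_zero_of_odd hp
  obtain ⟨i, hi⟩ := exists_sq_eq_neg_one_of_mod (p := p) (by omega)
  have hν := not_sq_eq_neg_of_mod hp (by omega) hi
  refine numClasses_eq_of_lines h2 (linesIncomparable_of_sq h2 hi) ?_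
  rw [genericLines_sigma_eq_of_not_sqrt h2 hi hν, rhoLines_eq_of_not_sqrt h2 hi hν,
    genericLines_eq_of_not_sqrt h2 hi hν, ncard_image_lineS_compl h2 hi, Nat.card_zmod,
    Set.ncard_pair (neg_one_ne_I h2 hi), Set.ncard_empty]
  omega

theorem ncard_exceptional (h2 : (2 : ZMod p) ≠ 0) {i ν : ZMod p} (hi : i ^ 2 = -1)
    (hν : ν ^ 2 = -i) : ({-1, i, ν, -ν} : Set (ZMod p)).ncard = 4 := by
  have hi1 := neg_one_ne_I h2 hi
  have hν0 : ν ≠ 0 := by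
    rintro rfl
    exact I_ne_zero hi (by linear_combination hν)
  rw [Set.ncard_insert_of_notMem, Set.ncard_insert_of_notMem, Set.ncard_pair]
  · intro h
    exact mul_ne_zero h2 hν0 (by linear_combination h)
  · rintro (h | h) <;> apply hi1 <;> grind
  · rintro (h | h | h)
    · exact hi1 h
    · apply hi1
      grind
    · apply hi1
      grind

theorem ncard_pair_neg (h2 : (2 : ZMod p) ≠ 0) {i ν : ZMod p} (hi : i ^ 2 = -1)
    (hν : ν ^ 2 = -i) : ({ν, -ν} : Set (ZMod p)).ncard = 2 ∧
      ({-1 + ν - ν ^ 2, -1 - ν - ν ^ 2} : Set (ZMod p)).ncard = 2 := by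
  have hν0 : ν ≠ 0 := by
    rintro rfl
    exact I_ne_zero hi (by linear_combination hν)
  rw [Set.ncard_pair, Set.ncard_pair]
  · exact ⟨rfl, rfl⟩
  · intro h
    exact mul_ne_zero h2 hν0 (by linear_combination h)
  · intro h
    exact mul_ne_zero h2 hν0 (by linear_combination h)

/-- The contributions are $p+1-4$ generic lines, $2m$ sums with the two $\rho$-stable lines, and two
$\sigma$-stable lines counted once more. -/
theorem numClasses_of_mod_eight_eq_one {m n : ℕ} (h : p % 8 = 1)
    (hm : {c : ZMod p | c ^ 2 = -3 ∧ c ≠ 0}.ncard = m) (hn : p - 1 + 2 * m = 4 * n) :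
    numClasses.{u} p = n := by
  have hp : p ≠ 2 := by omega
  have h2 := two_ne_zero_of_odd hp
  obtain ⟨i, hi⟩ := exists_sq_eq_neg_one_of_mod (p := p) (by omega)
  obtain ⟨ν, hν⟩ := exists_sq_eq_neg_of_mod h hi
  refine numClasses_eq_of_lines h2 (linesIncomparable_of_sq h2 hi) ?_
  rw [genericLines_sigma_eq_of_sqrt h2 hi hν, rhoLines_eq_of_sqrt h2 hi hν,
    genericLines_eq_of_sqrt h2 hi hν, ncard_image_lineS_compl h2 hi, ncard_image_lineS h2 hi,
    ncard_image_lineS h2 hi, Nat.card_zmod, hm, ncard_exceptional h2 hi hν,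
    (ncard_pair_neg h2 hi hν).1, (ncard_pair_neg h2 hi hν).2]
  have := (Fact.out : p.Prime).two_le
  omega

theorem numClasses_of_mod_eight_eq_seven (h : p % 8 = 7) :
    numClasses.{u} p = ((p + 1) / 4 : ℕ) := by
  have hp : p ≠ 2 := by omega
  have h2 := two_ne_zero_of_odd hp
  have hn := sq_ne_neg_one (p := p) (by omega)
  have hb := sq_ne_neg_two h
  refine numClasses_eq_of_lines h2 (linesIncomparable_of_not_sq h2 hn) ?_
  have h1 : {q : ZMod p × ZMod p | q.1 ^ 2 + q.2 ^ 2 = -1 ∧ q.1 ≠ -1} =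
      {q | q.1 ^ 2 + q.2 ^ 2 = -1} := by
    ext q
    refine and_iff_left_of_imp fun h1 h3 => ?_
    have h4 : q ∈ {q : ZMod p × ZMod p | q.1 ^ 2 + q.2 ^ 2 = -1 ∧ q.1 = -1} := ⟨h1, h3⟩
    rw [conic_fiber_eq_empty hb (by ring)] at h4
    exact h4
  rw [genericLines_sigma_eq_LAB h2 hn, rhoLines_eq_LAB h2 hn, genericLines_eq_LAB h2 hn,
    ncard_image_LAB h2, ncard_image_LAB h2, ncard_image_LAB h2, h1, ncard_conic (by omega),
    conic_fiber_eq_empty hb (by ring), conic_fiber_eq_empty hb (by ring), Set.ncard_empty]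
  omega

/-- Here $\beta^2=-2$ is solvable, so two points of the conic have $\alpha=-1$ and two have
$\alpha=1$: the former are removed from the generic lines and give $2m$ sums, the latter are
$\sigma$-stable and counted twice. -/
theorem numClasses_of_mod_eight_eq_three {m n : ℕ} (h : p % 8 = 3)
    (hm : {c : ZMod p | c ^ 2 = -3 ∧ c ≠ 0}.ncard = m) (hn : p + 1 + 2 * m = 4 * n) :
    numClasses.{u} p = n := by
  have hp : p ≠ 2 := by omega
  have h2 := two_ne_zero_of_odd hp
  have hi := sq_ne_neg_one (p := p) (by omega)
  obtain ⟨b, hb⟩ := exists_sq_eq_neg_two h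
  refine numClasses_eq_of_lines h2 (linesIncomparable_of_not_sq h2 hi) ?_
  have h1 : {q : ZMod p × ZMod p | q.1 ^ 2 + q.2 ^ 2 = -1 ∧ q.1 ≠ -1} =
      {q | q.1 ^ 2 + q.2 ^ 2 = -1} \ {q | q.1 ^ 2 + q.2 ^ 2 = -1 ∧ q.1 = -1} := by
    ext q
    change _ ∧ _ ↔ _ ∧ ¬ (_ ∧ _)
    tauto
  have h3 : {q : ZMod p × ZMod p | q.1 ^ 2 + q.2 ^ 2 = -1 ∧ q.1 = -1} ⊆
      {q | q.1 ^ 2 + q.2 ^ 2 = -1} := fun q hq => hq.1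
  rw [genericLines_sigma_eq_LAB h2 hi, rhoLines_eq_LAB h2 hi, genericLines_eq_LAB h2 hi,
    ncard_image_LAB h2, ncard_image_LAB h2, ncard_image_LAB h2, h1, Set.ncard_sdiff h3,
    ncard_conic (by omega), ncard_conic_fiber h2 hb (by ring), ncard_conic_fiber h2 hb (by ring),
    hm]
  omega

theorem numClasses_two : numClasses.{u} 2 = 0 := by
  rw [numClasses_eq, ENat.card_eq_zero_iff_empty]
  refine ⟨fun q => ?_⟩
  induction q using Quotient.inductionOn with
  | h U => exact not_isSemi_two U.1 U.2.1

theorem numClasses_count (p : ℕ) [Fact p.Prime] :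
    (p = 2 → numClasses.{u} p = 0) ∧
    (p % 24 ∈ ({5, 9, 13, 17, 21} : Set ℕ) → numClasses.{u} p = ((p - 1) / 4 : ℕ)) ∧
    (p % 24 = 1 → numClasses.{u} p = (1 + (p - 1) / 4 : ℕ)) ∧
    (p % 24 ∈ ({3, 7, 11, 15, 23} : Set ℕ) → numClasses.{u} p = ((p + 1) / 4 : ℕ)) ∧
    (p % 24 = 19 → numClasses.{u} p = (1 + (p + 1) / 4 : ℕ)) := by
  refine ⟨?_, fun h => ?_, fun h => ?_, fun h => ?_, fun h => ?_⟩
  · rintro rfl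
    exact numClasses_two
  · simp only [Set.mem_insert_iff, Set.mem_singleton_iff] at h
    by_cases h8 : p % 8 = 5
    · exact numClasses_of_mod_eight_eq_five h8
    · exact numClasses_of_mod_eight_eq_one (by omega)
        (ncard_sq_eq_neg_three_of_not_mod (by omega) (by omega)) (by omega)
  · exact numClasses_of_mod_eight_eq_one (by omega)
      (ncard_sq_eq_neg_three_of_mod (by omega) (by omega)) (by omega)
  · simp only [Set.mem_insert_iff, Set.mem_singleton_iff] at h
    by_cases h8 : p % 8 = 7
    · exact numClasses_of_mod_eight_eq_seven h8
    · exact numClasses_of_mod_eight_eq_three (by omega)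
        (ncard_sq_eq_neg_three_of_not_mod (by omega) (by omega)) (by omega)
  · exact numClasses_of_mod_eight_eq_three (by omega)
      (ncard_sq_eq_neg_three_of_mod (by omega) (by omega)) (by omega)

end Numbers

end MobiusKantor

namespace MobiusKantor

/-! ### The coverings defined by explicit voltages -/

section RowSpaces

variable {p : ℕ} [Fact p.Prime] {d d' : ℕ} {Z : Matrix (Fin d) (Fin 9) (ZMod p)}
  {Z' : Matrix (Fin d') (Fin 9) (ZMod p)} {U U' : Submodule (ZMod p) (Fin 9 → ZMod p)}

/-- The rows of `Z` form a basis of `U`. -/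
def RowsSpan (Z : Matrix (Fin d) (Fin 9) (ZMod p)) (U : Submodule (ZMod p) (Fin 9 → ZMod p)) :
    Prop :=
  LinearIndependent (ZMod p) Z.row ∧ Submodule.span (ZMod p) (Set.range Z.row) = U

theorem RowsSpan.cobSpace_eq (h : RowsSpan Z U) : cobSpace (ZMod p) (cov Z).proj = U :=
  (cobSpace_cov Z h.1).trans h.2

theorem RowsSpan.isMinSemisymCover (h : RowsSpan Z U) (hU : IsMinSemi U) :
    IsMinSemisymCover p (cov Z) :=
  isMinSemisymCover_iff.2
    ⟨cov_connected Z h.1, cov_isElementaryAbelian Z, h.cobSpace_eq.symm ▸ hU⟩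

theorem RowsSpan.isMinSemisymWith (h : RowsSpan Z U) (hU : IsMinSemi U)
    {K : Subgroup (MK ≃g MK)} (hK : stab U = K) : IsMinSemisymWith p Z K := by
  refine ⟨h.isMinSemisymCover hU, cov_isRegularNCovering Z, ?_⟩
  rw [liftGroup_eq (cov_isElementaryAbelian Z) (cov_connected Z h.1), h.cobSpace_eq, hK]

theorem RowsSpan.isMinSemisymWith_H (h : RowsSpan Z U) (hU : IsMinSemi U) (hs : sigma ∉ stab U) :
    IsMinSemisymWith p Z H :=
  h.isMinSemisymWith hU (eq_H hU.1.1 hs hU.1.2.1 hU.1.2.2)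

theorem RowsSpan.isMinSemisymWith_M (h : RowsSpan Z U) (hU : IsMinSemi U) (hs : sigma ∈ stab U) :
    IsMinSemisymWith p Z M :=
  h.isMinSemisymWith hU (eq_M hU.1.1 hs hU.1.2.1 hU.1.2.2)

theorem RowsSpan.isMinimalEdgeTransitiveProj_iff (h : RowsSpan Z U) :
    IsMinimalEdgeTransitiveProj (cov Z).proj ↔ IsMinEdge U := by
  rw [MobiusKantor.isMinimalEdgeTransitiveProj_iff (cov_isElementaryAbelian Z)
    (cov_connected Z h.1), h.cobSpace_eq]

theorem RowsSpan.isomorphic_iff (h : RowsSpan Z U) (hU : IsMinSemi U)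
    {P : GraphOver.{0, u} MK} (hP : IsMinSemisymCover p P) :
    P.Isomorphic (cov Z) ↔ U ∈ orbit (cobSpace (ZMod p) P.proj) := by
  rw [isomorphic_iff_act hP (h.isMinSemisymCover hU), h.cobSpace_eq,
    mem_orbit_iff (isMinSemisymCover_iff.1 hP).2.2.1.1]

theorem RowsSpan.isomorphic_cov_iff (h : RowsSpan Z U) (h' : RowsSpan Z' U') (hU : IsMinSemi U)
    (hU' : IsMinSemi U') : (cov Z).Isomorphic (cov Z') ↔ U' ∈ orbit U := by
  rw [h'.isomorphic_iff hU' (h.isMinSemisymCover hU), h.cobSpace_eq]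

theorem rowsSpan_pair {r r' : Fin 9 → ZMod p} {Z : Matrix (Fin 2) (Fin 9) (ZMod p)}
    (hZ : Z.row = ![r, r']) (h : ∀ s t : ZMod p, s • r + t • r' = 0 → s = 0 ∧ t = 0) :
    RowsSpan Z (Submodule.span (ZMod p) {r, r'}) := by
  constructor
  · rw [hZ]
    exact LinearIndependent.pair_iff.2 h
  · rw [hZ, Matrix.range_cons, Matrix.range_cons, Matrix.range_empty, Set.union_empty]
    rfl

theorem rowsSpan_cons (h2 : (2 : ZMod p) ≠ 0) {c : ZMod p} (h : RowsSpan Z U) (hU : U ≤ Em (ZMod p))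
    {Z' : Matrix (Fin (d + 1)) (Fin 9) (ZMod p)} (hZ : Z'.row = Matrix.vecCons (vf 1 c) Z.row) :
    RowsSpan Z' (fixedLine c ⊔ U) := by
  constructor
  · rw [hZ]
    refine linearIndependent_finCons.2 ⟨h.1, fun hm => ?_⟩
    rw [h.2] at hm
    have h1 : vf 1 c ∈ Ef (ZMod p) ⊓ Em (ZMod p) := ⟨vf_mem_Ef _ _, hU hm⟩
    rw [Ef_inf_Em h2, Submodule.mem_bot, ← vf_zero] at h1
    exact one_ne_zero (vf_injective h2 h1).1
  · rw [hZ, Matrix.range_cons, Submodule.span_union, h.2]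
    rfl

theorem rowsSpan_voltS (h2 : (2 : ZMod p) ≠ 0) {i : ZMod p} (hi : i ^ 2 = -1) (s : ZMod p) :
    RowsSpan (voltS i s) (lineS i (s : OnePoint (ZMod p))) := by
  rw [lineS_coe, LS_eq_span h2 hi (Or.inr one_ne_zero)]
  refine rowsSpan_pair ?_ fun a b h => ?_
  · funext j k
    fin_cases j <;> fin_cases k <;> simp [voltS, vm, -mul_eq_mul_right_iff] <;> ring
  · rw [vm_smul, vm_smul, vm_add, ← vm_zero] at h
    obtain ⟨e1, e2, e3, e4⟩ := vm_injective h
    have ha : a = 0 := by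
      apply mul_left_cancel₀ h2
      grind
    refine ⟨ha, ?_⟩
    subst ha
    rcases snd_ne_zero hi (Or.inr one_ne_zero : s ≠ 0 ∨ (1 : ZMod p) ≠ 0) with h3 | h3
    · exact (mul_eq_zero.1 (by linear_combination e1)).resolve_right h3
    · exact (mul_eq_zero.1 (by linear_combination e2)).resolve_right h3

theorem rowsSpan_voltAB (h2 : (2 : ZMod p) ≠ 0) (α β : ZMod p) :
    RowsSpan (voltAB α β) (LAB α β) := by
  rw [LAB_eq_span h2]
  refine rowsSpan_pair ?_ fun a b h => ?_
  · funext j k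
    fin_cases j <;> fin_cases k <;> simp [voltAB, vm]
  · rw [vm_smul, vm_smul, vm_add, ← vm_zero] at h
    obtain ⟨-, e2, -, e4⟩ := vm_injective h
    constructor <;> apply mul_left_cancel₀ h2
    · linear_combination e4 - e2
    · linear_combination e4 + e2

theorem rowsSpan_voltS3 (h2 : (2 : ZMod p) ≠ 0) {i : ZMod p} (hi : i ^ 2 = -1) (ν c : ZMod p) :
    RowsSpan (voltS3 i ν c) (fixedLine c ⊔ lineS i (ν : OnePoint (ZMod p))) := by
  refine rowsSpan_cons h2 (rowsSpan_voltS h2 hi ν) (isLine_lineS h2 hi _).le ?_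
  funext j k
  fin_cases j <;> fin_cases k <;> simp [voltS3, voltS, vf]

theorem rowsSpan_voltAB3 (h2 : (2 : ZMod p) ≠ 0) (b c : ZMod p) :
    RowsSpan (voltAB3 b c) (fixedLine c ⊔ LAB (-1) b) := by
  refine rowsSpan_cons h2 (rowsSpan_voltAB h2 (-1) b) (LAB_le _ _) ?_
  funext j k
  fin_cases j <;> fin_cases k <;> simp [voltAB3, voltAB, vf]

end RowSpaces

/-! ### Orbits of the three-dimensional subspaces -/

section OrbitsOfSums

variable {F : Type*} [Field F]

theorem le_Em_of_mem_orbit {U V : Submodule F (Fin 9 → F)} (hU : H ≤ stab U) (hV : V ∈ orbit U)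
    (h : V ≤ Em F) : U ≤ Em F := by
  obtain ⟨a, rfl⟩ := (mem_orbit_iff hU).1 hV
  have h1 := act_mono a⁻¹ h
  rwa [act_inv_act, mem_stab.1 ((stab_Em (F := F)).symm ▸ Subgroup.mem_top a⁻¹)] at h1

theorem not_mem_orbit_sup (h2 : (2 : F) ≠ 0) {c : F} {C V : Submodule F (Fin 9 → F)}
    (hU : H ≤ stab (fixedLine c ⊔ C)) (hV : IsLine V) : V ∉ orbit (fixedLine c ⊔ C) := fun h =>
  fixedLine_sup_not_le h2 (le_Em_of_mem_orbit hU h hV.le)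

/-- The sums of a line in the fixed space and a `ρ`-stable line form one orbit. -/
theorem sup_mem_orbit_sup (h2 : (2 : F) ≠ 0) {c c' : F} (hc : c ^ 2 = c' ^ 2)
    {C C' : Submodule F (Fin 9 → F)} (hr : rho ∈ stab C)
    (h : C = C' ∨ C = act sigma C') : fixedLine c ⊔ C ∈ orbit (fixedLine c' ⊔ C') := by
  have hr' := mem_stab.1 hr
  rw [orbit, act_mul, act_sup, act_sup, act_rho_fixedLine h2, act_sigma_fixedLine h2, act_sup,
    act_rho_fixedLine h2, neg_neg]
  -- Both $\rho$ and $\sigma$ negate the parameter of the fixed line, while $\rho$ fixes `C`. So the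
  -- sign of `c` and the choice of `C` can be adjusted independently.
  rcases sq_eq_sq_iff_eq_or_eq_neg.1 hc with rfl | rfl <;> rcases h with rfl | rfl
  · exact Or.inl rfl
  · exact Or.inr (Or.inr (Or.inl (by rw [hr'])))
  · exact Or.inr (Or.inl (by rw [hr']))
  · exact Or.inr (Or.inr (Or.inr rfl))

end OrbitsOfSums

/-! ### The lists of coverings when $-1$ is a square -/

section ListS

variable {p : ℕ} [Fact p.Prime] {i ν : ZMod p}

theorem voltS_generic (h2 : (2 : ZMod p) ≠ 0) (hi : i ^ 2 = -1) {s : ZMod p}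
    (hs : lineS i (s : OnePoint (ZMod p)) ∈ genericLines (ZMod p))
    (hσ : sigma ∉ stab (lineS i (s : OnePoint (ZMod p)))) :
    IsMinSemisymWith p (voltS i s) H ∧ IsMinimalEdgeTransitiveProj (cov (voltS i s)).proj ∧
      (orbitS i (s : OnePoint (ZMod p))).ncard = 4 ∧
      ∀ t : ZMod p, lineS i (t : OnePoint (ZMod p)) ∈ genericLines (ZMod p) →
        ((cov (voltS i s)).Isomorphic (cov (voltS i t)) ↔
          (t : OnePoint (ZMod p)) ∈ orbitS i (s : OnePoint (ZMod p))) := by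
  have hF := linesIncomparable_of_sq h2 hi
  have hR := rowsSpan_voltS h2 hi
  have hm := hs.1.isMinSemi hF hs.2.1 hs.2.2
  refine ⟨(hR s).isMinSemisymWith_H hm hσ,
    (hR s).isMinimalEdgeTransitiveProj_iff.2 (hs.1.isMinEdge hF), ?_, fun t ht => ?_⟩
  · rw [← Set.ncard_image_of_injective _ (lineS_injective h2 hi), image_lineS_orbitS h2 hi]
    exact ncard_orbit hs.1.stable hσ hs.2.1 hs.2.2
  · rw [(hR s).isomorphic_cov_iff (hR t) hm (ht.1.isMinSemi hF ht.2.1 ht.2.2),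
      ← (lineS_injective h2 hi).mem_set_image, image_lineS_orbitS h2 hi]
    rfl

theorem mem_orbit_self {F : Type*} [Field F] (U : Submodule F (Fin 9 → F)) : U ∈ orbit U :=
  Or.inl rfl

/-- The matrices `voltS` do not cover the parameter at infinity; $\rho$ moves it to zero, so no
isomorphism class is lost. -/
theorem lineS_zero_mem_orbit (h2 : (2 : ZMod p) ≠ 0) (hi : i ^ 2 = -1) :
    lineS i ((0 : ZMod p) : OnePoint (ZMod p)) ∈ orbit (lineS i OnePoint.infty) := by
  refine Or.inr (Or.inl ?_)
  rw [lineS_infty, act_rho_LS h2 hi (Or.inl one_ne_zero), mul_zero, lineS_coe]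

theorem lineS_coe_mem_genericLines_of_sqrt (h2 : (2 : ZMod p) ≠ 0) (hi : i ^ 2 = -1)
    (hν : ν ^ 2 = -i) {s : ZMod p} : lineS i (s : OnePoint (ZMod p)) ∈ genericLines (ZMod p) ↔
      s ∉ ({-1, i, ν, -ν} : Set (ZMod p)) := by
  rw [genericLines_eq_of_sqrt h2 hi hν, (lineS_injective h2 hi).mem_set_image, Set.mem_compl_iff,
    OnePoint.coe_injective.mem_set_image]

theorem lineS_coe_mem_genericLines_of_not_sqrt (h2 : (2 : ZMod p) ≠ 0) (hi : i ^ 2 = -1)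
    (hν : ∀ t : ZMod p, t ^ 2 ≠ -i) {s : ZMod p} :
    lineS i (s : OnePoint (ZMod p)) ∈ genericLines (ZMod p) ↔ s ∉ ({-1, i} : Set (ZMod p)) := by
  rw [genericLines_eq_of_not_sqrt h2 hi hν, (lineS_injective h2 hi).mem_set_image,
    Set.mem_compl_iff, OnePoint.coe_injective.mem_set_image]

theorem list_of_mod_eight_eq_five (h8 : p % 8 = 5) (hi : i ^ 2 = -1) :
    (∀ s : ZMod p, s ∉ ({-1, i} : Set (ZMod p)) →
        IsMinSemisymWith p (voltS i s) H ∧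
        IsMinimalEdgeTransitiveProj (cov (voltS i s)).proj ∧
        (orbitS i (s : OnePoint (ZMod p))).ncard = 4 ∧
        ∀ t : ZMod p, t ∉ ({-1, i} : Set (ZMod p)) →
          ((cov (voltS i s)).Isomorphic (cov (voltS i t)) ↔
            (t : OnePoint (ZMod p)) ∈ orbitS i (s : OnePoint (ZMod p)))) ∧
      (∀ P : GraphOver.{0, u} MK, IsMinSemisymCover p P →
        ∃ s : ZMod p, s ∉ ({-1, i} : Set (ZMod p)) ∧ P.Isomorphic (cov (voltS i s))) := by
  have hp : p ≠ 2 := by omega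
  have h2 := two_ne_zero_of_odd hp
  have hν := not_sq_eq_neg_of_mod hp (by omega) hi
  have hF := linesIncomparable_of_sq h2 hi
  have hg := fun s => lineS_coe_mem_genericLines_of_not_sqrt h2 hi hν (s := s)
  refine ⟨fun s hs => ?_, fun P hP => ?_⟩
  · obtain ⟨h3, h4, h5, h6⟩ := voltS_generic h2 hi ((hg s).2 hs)
      (fun h => hν _ ((sigma_mem_stab_lineS h2 hi s).1 h))
    exact ⟨h3, h4, h5, fun t ht => h6 t ((hg t).2 ht)⟩
  · have hU := (isMinSemisymCover_iff.1 hP).2.2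
    have key : ∀ s : ZMod p, s ∉ ({-1, i} : Set (ZMod p)) →
        lineS i (s : OnePoint (ZMod p)) ∈ orbit (cobSpace (ZMod p) P.proj) →
        ∃ s : ZMod p, s ∉ ({-1, i} : Set (ZMod p)) ∧ P.Isomorphic (cov (voltS i s)) := by
      intro s hs ho
      have h3 := (hg s).2 hs
      exact ⟨s, hs, ((rowsSpan_voltS h2 hi s).isomorphic_iff
        (h3.1.isMinSemi hF h3.2.1 h3.2.2) hP).2 ho⟩
    rcases (isMinSemi_iff h2 hF).1 hU with h3 | ⟨c, -, C, hC, -⟩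
    · obtain ⟨s, e⟩ := h3.1.exists_eq_lineS h2 hi
      induction s using OnePoint.rec with
      | infty =>
        refine key 0 ?_ (e ▸ lineS_zero_mem_orbit h2 hi)
        rintro (h | h)
        · exact one_ne_zero (by linear_combination h : (1 : ZMod p) = 0)
        · exact I_ne_zero hi h.symm
      | coe s =>
        rw [e] at h3
        exact key s ((hg s).1 h3) (e ▸ mem_orbit_self _)
    · rw [rhoLines_eq_of_not_sqrt h2 hi hν] at hC
      exact hC.elim

theorem not_mem_exceptS_iff (h2 : (2 : ZMod p) ≠ 0) (hi : i ^ 2 = -1) (hν : ν ^ 2 = -i)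
    {s : ZMod p} : s ∉ exceptS i ν ↔ lineS i (s : OnePoint (ZMod p)) ∈ genericLines (ZMod p) ∧
      sigma ∉ stab (lineS i (s : OnePoint (ZMod p))) := by
  rw [lineS_coe_mem_genericLines_of_sqrt h2 hi hν, sigma_mem_stab_lineS_iff h2 hi hν, exceptS]
  simp only [Set.mem_insert_iff, Set.mem_singleton_iff, not_or, and_assoc]

/-- The two $\rho$-stable lines are interchanged by $\sigma$, so a single choice of $\nu$ suffices
for the three-dimensional covering. -/
theorem act_sigma_lineS_of_sqrt (h2 : (2 : ZMod p) ≠ 0) (hi : i ^ 2 = -1) {t : ZMod p}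
    (ht : t ^ 2 = -i) : act sigma (lineS i (t : OnePoint (ZMod p))) =
      lineS i ((-t : ZMod p) : OnePoint (ZMod p)) := by
  rw [lineS_coe, lineS_coe, act_sigma_LS h2 hi (Or.inr one_ne_zero), LS_eq_iff h2 hi _
    (Or.inr one_ne_zero)]
  · linear_combination ht
  · by_contra! hcon
    apply h2
    grind

theorem voltS_sigma (h2 : (2 : ZMod p) ≠ 0) (hi : i ^ 2 = -1) (hν : ν ^ 2 = -i) :
    lineS i ((-1 + ν - ν ^ 2 : ZMod p) : OnePoint (ZMod p)) ∈ genericLines (ZMod p) ∧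
      sigma ∈ stab (lineS i ((-1 + ν - ν ^ 2 : ZMod p) : OnePoint (ZMod p))) :=
  ⟨(lineS_coe_mem_genericLines_of_sqrt h2 hi hν).2 (not_mem_of_sigma_mem h2 hi hν (Or.inl rfl)),
    (sigma_mem_stab_lineS_iff h2 hi hν _).2 (Or.inl rfl)⟩

/-- The two $\sigma$-stable lines are interchanged by $\rho$, which leaves one class with group $M$.
-/
theorem lineS_sigma_mem_orbit (h2 : (2 : ZMod p) ≠ 0) (hi : i ^ 2 = -1) (hν : ν ^ 2 = -i)
    {s : ZMod p} (hs : sigma ∈ stab (lineS i (s : OnePoint (ZMod p)))) :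
    lineS i ((-1 + ν - ν ^ 2 : ZMod p) : OnePoint (ZMod p)) ∈
      orbit (lineS i (s : OnePoint (ZMod p))) := by
  rcases (sigma_mem_stab_lineS_iff h2 hi hν s).1 hs with rfl | rfl
  · exact mem_orbit_self _
  · refine Or.inr (Or.inl ?_)
    rw [lineS_coe, lineS_coe, act_rho_LS h2 hi (Or.inr one_ne_zero),
      LS_eq_iff h2 hi (Or.inr one_ne_zero) (Or.inr ?_)]
    · grind
    · intro h
      grind

theorem list_of_mod_eight_eq_one (h8 : p % 8 = 1) (hi : i ^ 2 = -1) (hν : ν ^ 2 = -i) :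
    (∀ s : ZMod p, s ∉ exceptS i ν →
        IsMinSemisymWith p (voltS i s) H ∧
        IsMinimalEdgeTransitiveProj (cov (voltS i s)).proj ∧
        (orbitS i (s : OnePoint (ZMod p))).ncard = 4 ∧
        ¬ (cov (voltS i s)).Isomorphic (cov (voltS i (-1 + ν - ν ^ 2))) ∧
        ∀ t : ZMod p, t ∉ exceptS i ν →
          ((cov (voltS i s)).Isomorphic (cov (voltS i t)) ↔
            (t : OnePoint (ZMod p)) ∈ orbitS i (s : OnePoint (ZMod p)))) ∧
      (IsMinSemisymWith p (voltS i (-1 + ν - ν ^ 2)) M ∧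
        IsMinimalEdgeTransitiveProj (cov (voltS i (-1 + ν - ν ^ 2))).proj) ∧
      (p % 24 ≠ 1 → ∀ P : GraphOver.{0, u} MK, IsMinSemisymCover p P →
        (∃ s : ZMod p, s ∉ exceptS i ν ∧ P.Isomorphic (cov (voltS i s))) ∨
          P.Isomorphic (cov (voltS i (-1 + ν - ν ^ 2)))) ∧
      (p % 24 = 1 → ∀ c : ZMod p, c ^ 2 = -3 →
        IsMinSemisymWith p (voltS3 i ν c) H ∧
        ¬ IsMinimalEdgeTransitiveProj (cov (voltS3 i ν c)).proj ∧
        ¬ (cov (voltS3 i ν c)).Isomorphic (cov (voltS i (-1 + ν - ν ^ 2))) ∧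
        (∀ s : ZMod p, s ∉ exceptS i ν → ¬ (cov (voltS3 i ν c)).Isomorphic (cov (voltS i s))) ∧
        ∀ P : GraphOver.{0, u} MK, IsMinSemisymCover p P →
          (∃ s : ZMod p, s ∉ exceptS i ν ∧ P.Isomorphic (cov (voltS i s))) ∨
            P.Isomorphic (cov (voltS i (-1 + ν - ν ^ 2))) ∨
              P.Isomorphic (cov (voltS3 i ν c))) := by
  have hp : p ≠ 2 := by omega
  have h2 := two_ne_zero_of_odd hp
  have hF := linesIncomparable_of_sq h2 hi
  have hR := rowsSpan_voltS h2 hi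
  have hex := fun s => not_mem_exceptS_iff h2 hi hν (s := s)
  obtain ⟨hM, hMs⟩ := voltS_sigma h2 hi hν
  have hms : ∀ {C}, C ∈ genericLines (ZMod p) → IsMinSemi C := fun h =>
    h.1.isMinSemi hF h.2.1 h.2.2
  have hlines : ∀ P : GraphOver.{0, u} MK, IsMinSemisymCover p P →
      cobSpace (ZMod p) P.proj ∈ genericLines (ZMod p) →
        (∃ s : ZMod p, s ∉ exceptS i ν ∧ P.Isomorphic (cov (voltS i s))) ∨
          P.Isomorphic (cov (voltS i (-1 + ν - ν ^ 2))) := by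
    intro P hP h3
    have key : ∀ s : ZMod p, s ∉ exceptS i ν →
        lineS i (s : OnePoint (ZMod p)) ∈ orbit (cobSpace (ZMod p) P.proj) →
        ∃ s : ZMod p, s ∉ exceptS i ν ∧ P.Isomorphic (cov (voltS i s)) := fun s hs ho =>
      ⟨s, hs, ((hR s).isomorphic_iff (hms ((hex s).1 hs).1) hP).2 ho⟩
    obtain ⟨s, e⟩ := h3.1.exists_eq_lineS h2 hi
    induction s using OnePoint.rec with
    | infty =>
      refine Or.inl (key 0 ?_ (e ▸ lineS_zero_mem_orbit h2 hi))
      have hi0 := I_ne_zero hi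
      rw [hex, lineS_coe_mem_genericLines_of_sqrt h2 hi hν, sigma_mem_stab_lineS h2 hi]
      constructor
      · rintro (h | h | h | h) <;> grind
      · grind
    | coe s =>
      rw [e] at h3
      by_cases hs : sigma ∈ stab (lineS i (s : OnePoint (ZMod p)))
      · right
        rw [(hR _).isomorphic_iff (hms hM) hP, e]
        exact lineS_sigma_mem_orbit h2 hi hν hs
      · exact Or.inl (key s ((hex s).2 ⟨h3, hs⟩) (e ▸ mem_orbit_self _))
  refine ⟨fun s hs => ?_, ⟨(hR _).isMinSemisymWith_M (hms hM) hMs,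
    (hR _).isMinimalEdgeTransitiveProj_iff.2 (hM.1.isMinEdge hF)⟩, fun h24 P hP => ?_,
    fun h24 c hc => ?_⟩
  · obtain ⟨hs1, hs2⟩ := (hex s).1 hs
    obtain ⟨h3, h4, h5, h6⟩ := voltS_generic h2 hi hs1 hs2
    refine ⟨h3, h4, h5, ?_, fun t ht => h6 t ((hex t).1 ht).1⟩
    rw [(hR s).isomorphic_cov_iff (hR _) (hms hs1) (hms hM)]
    -- Stability under $\sigma$ is an invariant of the orbit and separates this item from the one
    -- with group $M$.
    exact fun h => hs2 ((sigma_mem_stab_of_mem_orbit hs1.1.stable h).1 hMs)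
  · rcases (isMinSemi_iff h2 hF).1 (isMinSemisymCover_iff.1 hP).2.2 with h3 | ⟨c, hc, -⟩
    · exact hlines P hP h3
    · have := mod_three_of_sq_eq hp hc.1 hc.2
      omega
  -- Otherwise $3=0$ and $p=3$, against the congruence.
  · have hc0 : c ≠ 0 := by
      rintro rfl
      have h3 : ((3 : ℕ) : ZMod p) = 0 := by
        push_cast
        linear_combination hc
      rw [ZMod.natCast_eq_zero_iff, Nat.prime_dvd_prime_iff_eq Fact.out Nat.prime_three] at h3
      omega
    have hC : lineS i (ν : OnePoint (ZMod p)) ∈ rhoLines (ZMod p) := by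
      rw [rhoLines_eq_of_sqrt h2 hi hν]
      exact ⟨_, ⟨ν, Or.inl rfl, rfl⟩, rfl⟩
    have h3 : IsMinSemi (fixedLine c ⊔ lineS i (ν : OnePoint (ZMod p))) :=
      hC.1.isMinSemi_sup h2 hF hc hc0 hC.2.1 hC.2.2
    have hR3 := rowsSpan_voltS3 h2 hi ν c
    refine ⟨hR3.isMinSemisymWith_H h3 (sigma_not_mem_stab_sup h2 hc0 hC.1.le), ?_, ?_,
      fun s hs => ?_, fun P hP => ?_⟩
    · rw [hR3.isMinimalEdgeTransitiveProj_iff]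
      exact hC.1.not_isMinEdge_sup h2
    · rw [hR3.isomorphic_cov_iff (hR _) h3 (hms hM)]
      exact not_mem_orbit_sup h2 h3.1.1 hM.1
    · rw [hR3.isomorphic_cov_iff (hR s) h3 (hms ((hex s).1 hs).1)]
      exact not_mem_orbit_sup h2 h3.1.1 ((hex s).1 hs).1.1
    · rcases (isMinSemi_iff h2 hF).1 (isMinSemisymCover_iff.1 hP).2.2 with h4 | ⟨c', hc', C, hC', e⟩
      · exact (hlines P hP h4).imp_right Or.inl
      · refine Or.inr (Or.inr ?_)
        rw [hR3.isomorphic_iff h3 hP, e]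
        refine sup_mem_orbit_sup h2 (hc.trans hc'.1.symm) hC.2.1 ?_
        rw [rhoLines_eq_of_sqrt h2 hi hν] at hC'
        obtain ⟨_, ⟨t, rfl | rfl, rfl⟩, rfl⟩ := hC'
        · exact Or.inl rfl
        · rw [act_sigma_lineS_of_sqrt h2 hi (by rw [neg_sq, hν]), neg_neg]
          exact Or.inr rfl

end ListS

end MobiusKantor

namespace MobiusKantor

/-! ### The lists of coverings when $-1$ is not a square -/

section ListAB

variable {p : ℕ} [Fact p.Prime] {α β b : ZMod p}

theorem LAB_mem_genericLines_iff (h2 : (2 : ZMod p) ≠ 0) (hn : ∀ t : ZMod p, t ^ 2 ≠ -1)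
    (h : α ^ 2 + β ^ 2 = -1) : LAB α β ∈ genericLines (ZMod p) ↔ α ≠ -1 := by
  refine ⟨fun h1 h3 => h1.2.1 ((rho_mem_stab_LAB h2 hn h).2 h3), fun h1 => ⟨isLine_LAB h2 h, ?_,
    rho_sigma_not_mem_stab_LAB h2 hn h⟩⟩
  rwa [rho_mem_stab_LAB h2 hn h]

theorem voltAB_generic (h2 : (2 : ZMod p) ≠ 0) (hn : ∀ t : ZMod p, t ^ 2 ≠ -1)
    (h : α ^ 2 + β ^ 2 = -1) (h1 : α ≠ 1) (h3 : α ≠ -1) :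
    IsMinSemisymWith p (voltAB α β) H ∧ IsMinimalEdgeTransitiveProj (cov (voltAB α β)).proj ∧
      (orbitAB (α, β)).ncard = 4 ∧
      ∀ α' β' : ZMod p, α' ^ 2 + β' ^ 2 = -1 → α' ≠ -1 →
        ((cov (voltAB α β)).Isomorphic (cov (voltAB α' β')) ↔ (α', β') ∈ orbitAB (α, β)) := by
  have hF := linesIncomparable_of_not_sq h2 hn
  have hR := rowsSpan_voltAB h2
  have hg := (LAB_mem_genericLines_iff h2 hn h).2 h3
  have hm := hg.1.isMinSemi hF hg.2.1 hg.2.2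
  have hσ : sigma ∉ stab (LAB α β) := fun h4 => h1 ((sigma_mem_stab_LAB h2 hn h).1 h4)
  have hinj : Function.Injective fun q : ZMod p × ZMod p => LAB q.1 q.2 := fun q q' h =>
    Prod.ext (LAB_injective h2 h).1 (LAB_injective h2 h).2
  refine ⟨(hR α β).isMinSemisymWith_H hm hσ,
    (hR α β).isMinimalEdgeTransitiveProj_iff.2 (hg.1.isMinEdge hF), ?_, fun α' β' h' ha' => ?_⟩
  · rw [← Set.ncard_image_of_injective _ hinj, image_LAB_orbitAB h2 hn h]
    exact ncard_orbit hg.1.stable hσ hg.2.1 hg.2.2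
  · have ht := (LAB_mem_genericLines_iff h2 hn h').2 ha'
    rw [(hR α β).isomorphic_cov_iff (hR α' β') hm (ht.1.isMinSemi hF ht.2.1 ht.2.2),
      ← hinj.mem_set_image, image_LAB_orbitAB h2 hn h]
    rfl

theorem list_of_mod_eight_eq_seven (h8 : p % 8 = 7) :
    (∀ α β : ZMod p, α ^ 2 + β ^ 2 = -1 →
        IsMinSemisymWith p (voltAB α β) H ∧
        IsMinimalEdgeTransitiveProj (cov (voltAB α β)).proj ∧
        (orbitAB (α, β)).ncard = 4 ∧
        ∀ α' β' : ZMod p, α' ^ 2 + β' ^ 2 = -1 →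
          ((cov (voltAB α β)).Isomorphic (cov (voltAB α' β')) ↔ (α', β') ∈ orbitAB (α, β))) ∧
      (∀ P : GraphOver.{0, u} MK, IsMinSemisymCover p P →
        ∃ α β : ZMod p, α ^ 2 + β ^ 2 = -1 ∧ P.Isomorphic (cov (voltAB α β))) := by
  have h2 : (2 : ZMod p) ≠ 0 := two_ne_zero_of_odd (by omega)
  have hn := sq_ne_neg_one (p := p) (by omega)
  have hF := linesIncomparable_of_not_sq h2 hn
  have hb : ∀ {α β : ZMod p}, α ^ 2 + β ^ 2 = -1 → α ≠ 1 ∧ α ≠ -1 := by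
    intro α β h
    constructor <;> rintro rfl <;> exact sq_ne_neg_two h8 β (by linear_combination h)
  refine ⟨fun α β h => ?_, fun P hP => ?_⟩
  · obtain ⟨h3, h4, h5, h6⟩ := voltAB_generic h2 hn h (hb h).1 (hb h).2
    exact ⟨h3, h4, h5, fun α' β' h' => h6 α' β' h' (hb h').2⟩
  · have hU := (isMinSemisymCover_iff.1 hP).2.2
    rcases (isMinSemi_iff h2 hF).1 hU with h3 | ⟨c, -, C, hC, -⟩
    · obtain ⟨α, β, h, e⟩ := h3.1.exists_eq_LAB h2 hn
      refine ⟨α, β, h, ((rowsSpan_voltAB h2 α β).isomorphic_iff (e ▸ hU) hP).2 ?_⟩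
      rw [e]
      exact mem_orbit_self _
    · rw [rhoLines_eq_LAB h2 hn] at hC
      obtain ⟨⟨α, β⟩, ⟨h, h'⟩, -⟩ := hC
      exact absurd h' (hb h).2

/-- On the conic, $\alpha=\pm1$ already forces $\beta=\pm b$. -/
theorem not_mem_exceptAB_iff (hb : b ^ 2 = -2) (h : α ^ 2 + β ^ 2 = -1) :
    (α, β) ∉ exceptAB b ↔ α ≠ 1 ∧ α ≠ -1 := by
  have key : ∀ a : ZMod p, a ^ 2 = 1 → (α = a ↔ (α, β) = (a, b) ∨ (α, β) = (a, -b)) := by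
    intro a ha
    rw [Prod.mk.injEq, Prod.mk.injEq, ← and_or_left, ← sq_eq_sq_iff_eq_or_eq_neg]
    refine (and_iff_left_of_imp fun e => ?_).symm
    rw [e, ha] at h
    linear_combination h - hb
  rw [Ne, Ne, key 1 (by ring), key (-1) (by ring), ← not_or, or_assoc]
  rfl

theorem conic_of_sq (hb : b ^ 2 = -2) {a : ZMod p} (ha : a ^ 2 = 1) : a ^ 2 + b ^ 2 = -1 := by
  linear_combination ha + hb

/-- The $\sigma$-stable points $(1,\pm b)$ are interchanged by $\rho\sigma$, so they give one class.
-/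
theorem LAB_one_mem_orbit (h2 : (2 : ZMod p) ≠ 0) (hn : ∀ t : ZMod p, t ^ 2 ≠ -1)
    (hb : b ^ 2 = -2) (h : (1 : ZMod p) ^ 2 + β ^ 2 = -1) : LAB 1 b ∈ orbit (LAB 1 β) := by
  have h3 : b ^ 2 = β ^ 2 := by linear_combination hb - h
  rcases sq_eq_sq_iff_eq_or_eq_neg.1 h3 with rfl | rfl
  · exact mem_orbit_self _
  · refine Or.inr (Or.inr (Or.inl ?_))
    rw [act_rho_sigma_LAB h2 hn h]

theorem list_of_mod_eight_eq_three (h8 : p % 8 = 3) (hb : b ^ 2 = -2) :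
    (∀ α β : ZMod p, α ^ 2 + β ^ 2 = -1 → (α, β) ∉ exceptAB b →
        IsMinSemisymWith p (voltAB α β) H ∧
        IsMinimalEdgeTransitiveProj (cov (voltAB α β)).proj ∧
        (orbitAB (α, β)).ncard = 4 ∧
        ¬ (cov (voltAB α β)).Isomorphic (cov (voltAB 1 b)) ∧
        ∀ α' β' : ZMod p, α' ^ 2 + β' ^ 2 = -1 → (α', β') ∉ exceptAB b →
          ((cov (voltAB α β)).Isomorphic (cov (voltAB α' β')) ↔ (α', β') ∈ orbitAB (α, β))) ∧
      (IsMinSemisymWith p (voltAB 1 b) M ∧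
        IsMinimalEdgeTransitiveProj (cov (voltAB 1 b)).proj) ∧
      (p % 24 ≠ 19 → ∀ P : GraphOver.{0, u} MK, IsMinSemisymCover p P →
        (∃ α β : ZMod p, α ^ 2 + β ^ 2 = -1 ∧ (α, β) ∉ exceptAB b ∧
          P.Isomorphic (cov (voltAB α β))) ∨ P.Isomorphic (cov (voltAB 1 b))) ∧
      (p % 24 = 19 → ∀ c : ZMod p, c ^ 2 = -3 →
        IsMinSemisymWith p (voltAB3 b c) H ∧
        ¬ IsMinimalEdgeTransitiveProj (cov (voltAB3 b c)).proj ∧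
        ¬ (cov (voltAB3 b c)).Isomorphic (cov (voltAB 1 b)) ∧
        (∀ α β : ZMod p, α ^ 2 + β ^ 2 = -1 → (α, β) ∉ exceptAB b →
          ¬ (cov (voltAB3 b c)).Isomorphic (cov (voltAB α β))) ∧
        ∀ P : GraphOver.{0, u} MK, IsMinSemisymCover p P →
          (∃ α β : ZMod p, α ^ 2 + β ^ 2 = -1 ∧ (α, β) ∉ exceptAB b ∧
            P.Isomorphic (cov (voltAB α β))) ∨
            P.Isomorphic (cov (voltAB 1 b)) ∨ P.Isomorphic (cov (voltAB3 b c))) := by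
  have hp : p ≠ 2 := by omega
  have h2 := two_ne_zero_of_odd hp
  have hn := sq_ne_neg_one (p := p) (by omega)
  have hF := linesIncomparable_of_not_sq h2 hn
  have hR := rowsSpan_voltAB h2
  have h1 : (1 : ZMod p) ^ 2 + b ^ 2 = -1 := conic_of_sq hb (by ring)
  have hone : (1 : ZMod p) ≠ -1 := fun h => h2 (by linear_combination h)
  have hM := (LAB_mem_genericLines_iff h2 hn h1).2 hone
  have hMs := (sigma_mem_stab_LAB h2 hn h1).2 rfl
  have hms : ∀ {C}, C ∈ genericLines (ZMod p) → IsMinSemi C := fun h =>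
    h.1.isMinSemi hF h.2.1 h.2.2
  have hg : ∀ {α β : ZMod p}, α ^ 2 + β ^ 2 = -1 → (α, β) ∉ exceptAB b →
      LAB α β ∈ genericLines (ZMod p) := fun h hs =>
    (LAB_mem_genericLines_iff h2 hn h).2 ((not_mem_exceptAB_iff hb h).1 hs).2
  have hlines : ∀ P : GraphOver.{0, u} MK, IsMinSemisymCover p P →
      cobSpace (ZMod p) P.proj ∈ genericLines (ZMod p) →
        (∃ α β : ZMod p, α ^ 2 + β ^ 2 = -1 ∧ (α, β) ∉ exceptAB b ∧
          P.Isomorphic (cov (voltAB α β))) ∨ P.Isomorphic (cov (voltAB 1 b)) := by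
    intro P hP h3
    obtain ⟨α, β, h, e⟩ := h3.1.exists_eq_LAB h2 hn
    rw [e] at h3
    by_cases ha : α = 1
    · subst ha
      right
      rw [(hR _ _).isomorphic_iff (hms hM) hP, e]
      exact LAB_one_mem_orbit h2 hn hb h
    · refine Or.inl ⟨α, β, h, (not_mem_exceptAB_iff hb h).2
        ⟨ha, (LAB_mem_genericLines_iff h2 hn h).1 h3⟩, ?_⟩
      rw [(hR _ _).isomorphic_iff (hms h3) hP, e]
      exact mem_orbit_self _
  refine ⟨fun α β h hs => ?_, ⟨(hR _ _).isMinSemisymWith_M (hms hM) hMs,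
    (hR _ _).isMinimalEdgeTransitiveProj_iff.2 (hM.1.isMinEdge hF)⟩, fun h24 P hP => ?_,
    fun h24 c hc => ?_⟩
  · have ha := (not_mem_exceptAB_iff hb h).1 hs
    obtain ⟨h3, h4, h5, h6⟩ := voltAB_generic h2 hn h ha.1 ha.2
    refine ⟨h3, h4, h5, ?_, fun α' β' h' hs' =>
      h6 α' β' h' ((not_mem_exceptAB_iff hb h').1 hs').2⟩
    rw [(hR _ _).isomorphic_cov_iff (hR _ _) (hms (hg h hs)) (hms hM)]
    exact fun h7 => ha.1 ((sigma_mem_stab_LAB h2 hn h).1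
      ((sigma_mem_stab_of_mem_orbit (hg h hs).1.stable h7).1 hMs))
  · rcases (isMinSemi_iff h2 hF).1 (isMinSemisymCover_iff.1 hP).2.2 with h3 | ⟨c, hc, -⟩
    · exact hlines P hP h3
    · have := mod_three_of_sq_eq hp hc.1 hc.2
      omega
  · have hc0 : c ≠ 0 := by
      rintro rfl
      have h3 : ((3 : ℕ) : ZMod p) = 0 := by
        push_cast
        linear_combination hc
      rw [ZMod.natCast_eq_zero_iff, Nat.prime_dvd_prime_iff_eq Fact.out Nat.prime_three] at h3
      omega
    have hneg : (-1 : ZMod p) ^ 2 + b ^ 2 = -1 := conic_of_sq hb (by ring)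
    have hC : LAB (-1) b ∈ rhoLines (ZMod p) := by
      rw [rhoLines_eq_LAB h2 hn]
      exact ⟨(-1, b), ⟨hneg, rfl⟩, rfl⟩
    have h3 : IsMinSemi (fixedLine c ⊔ LAB (-1) b) :=
      hC.1.isMinSemi_sup h2 hF hc hc0 hC.2.1 hC.2.2
    have hR3 := rowsSpan_voltAB3 h2 b c
    refine ⟨hR3.isMinSemisymWith_H h3 (sigma_not_mem_stab_sup h2 hc0 hC.1.le), ?_, ?_,
      fun α β h hs => ?_, fun P hP => ?_⟩
    · rw [hR3.isMinimalEdgeTransitiveProj_iff]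
      exact hC.1.not_isMinEdge_sup h2
    · rw [hR3.isomorphic_cov_iff (hR _ _) h3 (hms hM)]
      exact not_mem_orbit_sup h2 h3.1.1 hM.1
    · rw [hR3.isomorphic_cov_iff (hR _ _) h3 (hms (hg h hs))]
      exact not_mem_orbit_sup h2 h3.1.1 (hg h hs).1
    · rcases (isMinSemi_iff h2 hF).1 (isMinSemisymCover_iff.1 hP).2.2 with h4 | ⟨c', hc', C, hC', e⟩
      · exact (hlines P hP h4).imp_right Or.inl
      · refine Or.inr (Or.inr ?_)
        rw [hR3.isomorphic_iff h3 hP, e]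
        refine sup_mem_orbit_sup h2 (hc.trans hc'.1.symm) hC.2.1 ?_
        rw [rhoLines_eq_LAB h2 hn] at hC'
        obtain ⟨⟨α, β⟩, ⟨h, h'⟩, rfl⟩ := hC'
        dsimp only at h h' ⊢
        subst h'
        have h5 : b ^ 2 = β ^ 2 := by linear_combination hneg - h
        rcases sq_eq_sq_iff_eq_or_eq_neg.1 h5 with rfl | rfl
        · exact Or.inl rfl
        · right
          -- The two $\rho$-stable points $(-1,\pm b)$ are interchanged by $\sigma$.
          rw [act_sigma_LAB h2 hn h, one_div, inv_neg_one, div_neg, div_one]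

end ListAB

end MobiusKantor

/-! ### Assembly of the numbers and the lists -/

theorem mainTheorem1 (p : ℕ) [Fact p.Prime] :
    -- the number of isomorphism classes
    (p = 2 → numClasses.{u} p = 0) ∧
    (p % 24 ∈ ({5, 9, 13, 17, 21} : Set ℕ) → numClasses.{u} p = ((p - 1) / 4 : ℕ)) ∧
    (p % 24 = 1 → numClasses.{u} p = (1 + (p - 1) / 4 : ℕ)) ∧
    (p % 24 ∈ ({3, 7, 11, 15, 23} : Set ℕ) → numClasses.{u} p = ((p + 1) / 4 : ℕ)) ∧
    (p % 24 = 19 → numClasses.{u} p = (1 + (p + 1) / 4 : ℕ)) ∧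
    -- the list for `p ≡ 5 (mod 8)`
    (p % 8 = 5 → ∀ i : ZMod p, i ^ 2 = -1 →
      (∀ s : ZMod p, s ∉ ({-1, i} : Set (ZMod p)) →
        IsMinSemisymWith p (voltS i s) H ∧
        IsMinimalEdgeTransitiveProj (cov (voltS i s)).proj ∧
        (orbitS i (s : OnePoint (ZMod p))).ncard = 4 ∧
        ∀ t : ZMod p, t ∉ ({-1, i} : Set (ZMod p)) →
          ((cov (voltS i s)).Isomorphic (cov (voltS i t)) ↔
            (t : OnePoint (ZMod p)) ∈ orbitS i (s : OnePoint (ZMod p)))) ∧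
      (∀ P : GraphOver.{0, u} MK, IsMinSemisymCover p P →
        ∃ s : ZMod p, s ∉ ({-1, i} : Set (ZMod p)) ∧ P.Isomorphic (cov (voltS i s)))) ∧
    -- the list for `p ≡ 1 (mod 8)`
    (p % 8 = 1 → ∀ i ν : ZMod p, i ^ 2 = -1 → ν ^ 2 = -i →
      (∀ s : ZMod p, s ∉ exceptS i ν →
        IsMinSemisymWith p (voltS i s) H ∧
        IsMinimalEdgeTransitiveProj (cov (voltS i s)).proj ∧
        (orbitS i (s : OnePoint (ZMod p))).ncard = 4 ∧
        ¬ (cov (voltS i s)).Isomorphic (cov (voltS i (-1 + ν - ν ^ 2))) ∧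
        ∀ t : ZMod p, t ∉ exceptS i ν →
          ((cov (voltS i s)).Isomorphic (cov (voltS i t)) ↔
            (t : OnePoint (ZMod p)) ∈ orbitS i (s : OnePoint (ZMod p)))) ∧
      (IsMinSemisymWith p (voltS i (-1 + ν - ν ^ 2)) M ∧
        IsMinimalEdgeTransitiveProj (cov (voltS i (-1 + ν - ν ^ 2))).proj) ∧
      (p % 24 ≠ 1 → ∀ P : GraphOver.{0, u} MK, IsMinSemisymCover p P →
        (∃ s : ZMod p, s ∉ exceptS i ν ∧ P.Isomorphic (cov (voltS i s))) ∨
          P.Isomorphic (cov (voltS i (-1 + ν - ν ^ 2)))) ∧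
      (p % 24 = 1 → ∀ c : ZMod p, c ^ 2 = -3 →
        IsMinSemisymWith p (voltS3 i ν c) H ∧
        ¬ IsMinimalEdgeTransitiveProj (cov (voltS3 i ν c)).proj ∧
        ¬ (cov (voltS3 i ν c)).Isomorphic (cov (voltS i (-1 + ν - ν ^ 2))) ∧
        (∀ s : ZMod p, s ∉ exceptS i ν → ¬ (cov (voltS3 i ν c)).Isomorphic (cov (voltS i s))) ∧
        ∀ P : GraphOver.{0, u} MK, IsMinSemisymCover p P →
          (∃ s : ZMod p, s ∉ exceptS i ν ∧ P.Isomorphic (cov (voltS i s))) ∨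
            P.Isomorphic (cov (voltS i (-1 + ν - ν ^ 2))) ∨ P.Isomorphic (cov (voltS3 i ν c)))) ∧
    -- the list for `p ≡ 7 (mod 8)`
    (p % 8 = 7 →
      (∀ α β : ZMod p, α ^ 2 + β ^ 2 = -1 →
        IsMinSemisymWith p (voltAB α β) H ∧
        IsMinimalEdgeTransitiveProj (cov (voltAB α β)).proj ∧
        (orbitAB (α, β)).ncard = 4 ∧
        ∀ α' β' : ZMod p, α' ^ 2 + β' ^ 2 = -1 →
          ((cov (voltAB α β)).Isomorphic (cov (voltAB α' β')) ↔ (α', β') ∈ orbitAB (α, β))) ∧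
      (∀ P : GraphOver.{0, u} MK, IsMinSemisymCover p P →
        ∃ α β : ZMod p, α ^ 2 + β ^ 2 = -1 ∧ P.Isomorphic (cov (voltAB α β)))) ∧
    -- the list for `p ≡ 3 (mod 8)`
    (p % 8 = 3 → ∀ b : ZMod p, b ^ 2 = -2 →
      (∀ α β : ZMod p, α ^ 2 + β ^ 2 = -1 → (α, β) ∉ exceptAB b →
        IsMinSemisymWith p (voltAB α β) H ∧
        IsMinimalEdgeTransitiveProj (cov (voltAB α β)).proj ∧
        (orbitAB (α, β)).ncard = 4 ∧
        ¬ (cov (voltAB α β)).Isomorphic (cov (voltAB 1 b)) ∧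
        ∀ α' β' : ZMod p, α' ^ 2 + β' ^ 2 = -1 → (α', β') ∉ exceptAB b →
          ((cov (voltAB α β)).Isomorphic (cov (voltAB α' β')) ↔ (α', β') ∈ orbitAB (α, β))) ∧
      (IsMinSemisymWith p (voltAB 1 b) M ∧
        IsMinimalEdgeTransitiveProj (cov (voltAB 1 b)).proj) ∧
      (p % 24 ≠ 19 → ∀ P : GraphOver.{0, u} MK, IsMinSemisymCover p P →
        (∃ α β : ZMod p, α ^ 2 + β ^ 2 = -1 ∧ (α, β) ∉ exceptAB b ∧ P.Isomorphic (cov (voltAB α β))) ∨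
          P.Isomorphic (cov (voltAB 1 b))) ∧
      (p % 24 = 19 → ∀ c : ZMod p, c ^ 2 = -3 →
        IsMinSemisymWith p (voltAB3 b c) H ∧
        ¬ IsMinimalEdgeTransitiveProj (cov (voltAB3 b c)).proj ∧
        ¬ (cov (voltAB3 b c)).Isomorphic (cov (voltAB 1 b)) ∧
        (∀ α β : ZMod p, α ^ 2 + β ^ 2 = -1 → (α, β) ∉ exceptAB b →
          ¬ (cov (voltAB3 b c)).Isomorphic (cov (voltAB α β))) ∧
        ∀ P : GraphOver.{0, u} MK, IsMinSemisymCover p P →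
          (∃ α β : ZMod p, α ^ 2 + β ^ 2 = -1 ∧ (α, β) ∉ exceptAB b ∧
            P.Isomorphic (cov (voltAB α β))) ∨
            P.Isomorphic (cov (voltAB 1 b)) ∨ P.Isomorphic (cov (voltAB3 b c)))) := by
  obtain ⟨h1, h2, h3, h4, h5⟩ := numClasses_count.{u} p
  exact ⟨h1, h2, h3, h4, h5, fun h _ hi => list_of_mod_eight_eq_five h hi,
    fun h _ _ hi hν => list_of_mod_eight_eq_one h hi hν, list_of_mod_eight_eq_seven,
    fun h _ hb => list_of_mod_eight_eq_three h hb⟩
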